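/- **Setting.** Let $F,f:\mathbb R^m\times\mathbb R^n\to\mathbb R$, $n\ge 1$, $y^*(x)=\arg\min_y f(x,y)$ and $\Phi(x)=F(x,y^*(x))$. Assume: (A) $F$ is differentiable; $\nabla_xF$ is Lipschitz in $y$ with constant $L_{F_x}$ and in $x$ with constant $\bar L_{F_x}$; $\nabla_yF$ is Lipschitz in $y$ with constant $L_{F_y}$ and in $x$ with constant $\bar L_{F_y}$; $\|\nabla_yF\|\le C_{F_y}$. (B) $f$ is $C^2$; $f(x,\cdot)$ is $\mu$-strongly convex, $\mu>0$; $\nabla_yf$ is $L$-Lipschitz in $y$; $\nabla^2_{yy}f$ is Lipschitz in $y$ and in $x$ with constants $L_{f_{yy}}$, $\bar L_{f_{yy}}$; the $n\times m$ matrix $\nabla^2_{xy}f$ is Lipschitz in $y$ and in $x$ with constants $L_{f_{xy}}$, $\bar L_{f_{xy}}$; $\|\nabla^2_{xy}f\|\le M_{f_{xy}}$. (C) $\inf_x\Phi(x)>-\infty$. **Algorithm.** Let $H_0=L^{-1}I$ (that is, $B_0=H_0^{-1}=LI$). For vectors $s,g$ the BFGS update of $H$ is $(I-\rho sg^T)H(I-\rho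 gs^T)+\rho ss^T$, $\rho=1/(g^Ts)$; if $s=0$, then $H$ is left unchanged. Given $x_0,y_0$, $\alpha>0$, $0<\beta\le 2/(L+\mu)$, $P,T\ge0$ and $Q_k\ge1$, do for $k=0,\dots,K-1$ ($K\ge1$): 1. From $y_k$ make $P$ gradient steps $y\leftarrow y-\beta\nabla_yf(x_k,y)$, then from the resulting point $y_{k,0}$ make $T$ BFGS steps $y_{k,t+1}=y_{k,t}-H_t\nabla_yf(x_k,y_{k,t})$, where $H_{t+1}$ is the BFGS update of $H_t$ with $s_t=y_{k,t+1}-y_{k,t}$ and $g_t=\nabla_yf(x_k,y_{k,t+1})-\nabla_yf(x_k,y_{k,t})$. Put $y_{k+1}=y_{k,T}$ and $d_k=\nabla_yF(x_k,y_{k+1})$. 2. If $Q_k=1$, put $u_{k+1}=H_Td_k$. If $Q_k>1$, start again from $H_0$: for $i=0,1,\dots,Q_k-1$ put $u_{k,i}=H_id_k$, $s_i=\zeta_{k,i}u_{k,i}$ with a stepsize $\zeta_{k,i}>0$, $g_i=\nabla_yf(x_k,y_{k+1}+s_i)-\nabla_yf(x_k,y_{k+1})$, and let $H_{i+1}$ be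 the BFGS update of $H_i$. Let $u_{k+1}$ be one of $u_{k,0},\dots,u_{k,Q_k-1}$ that is closest to $[\nabla^2_{yy}f(x_k,y_{k+1})]^{-1}d_k$. 3. $x_{k+1}=x_k-\alpha\big(\nabla_xF(x_k,y_{k+1})-[\nabla^2_{xy}f(x_k,y_{k+1})]^Tu_{k+1}\big)$. **Constants.** $\kappa=L/\mu$, $L_y=M_{f_{xy}}/\mu$, $M=L_{f_{yy}}/\mu^{3/2}$, $K_0=8n\ln\frac{2L}{\mu}$, $t_c=\frac98K_0$, $c_l=2t_c^{T/2}$, $$K_1=\frac{2\ln\frac32\,\sqrt\mu}{(\frac32)^{3/2}ML}\max\Big\{\frac{\mu}{2L},\frac1{K_0+9}\Big\}\quad(K_1=\infty\text{ if }L_{f_{yy}}=0),$$ $$D=L_{F_x}^2+\frac{L_{f_{xy}}^2C_{F_y}^2}{\mu^2}+\frac{4M_{f_{xy}}^2L_{F_y}^2}{\mu^2}+\frac{4M_{f_{xy}}^2C_{F_y}^2L_{f_{yy}}^2}{\mu^4},$$ $$C=L_{F_x}+\frac{L_{F_y}M_{f_{xy}}}{\mu}+C_{F_y}\Big(\frac{L_{f_{xy}}}{\mu}+\frac{L_{f_{yy}}M_{f_{xy}}}{\mu^2}\Big),\qquad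 L_\Phi=\frac{(\bar L_{F_y}+C)M_{f_{xy}}}{\mu}+\bar L_{F_x}+C_{F_y}\Big(\frac{\bar L_{f_{xy}}}{\mu}+\frac{\bar L_{f_{yy}}M_{f_{xy}}}{\mu^2}\Big).$$ With $\|v\|_{y_{k+1}}=\langle\nabla^2_{yy}f(x_k,y_{k+1})v,v\rangle^{1/2}$ and $\xi_{k,i}=\exp\big(M\sum_{j<i}\|\zeta_{k,j}u_{k,j}\|_{y_{k+1}}\big)$, let $\tilde\xi$ be the minimum over $k<K$ of $\min_{1\le i\le Q_k}\frac1{2(\xi_{k,i}^2+\xi_{k,i})}$ (of $\frac14$ for those $k$ with $Q_k=1$). **Theorem.** Assume (A), (B), (C), $T\ge 8n\ln\frac{2L}{\mu}$, and $(1-\beta\mu)^P\|y_k-y^*(x_k)\|\le K_1$ for all $k<K$. Let $\varepsilon>0$, $$\tau=c_l^2\kappa^3\big(\tfrac1T\big)^T(1-\beta\mu)^P\Big((1+\varepsilon)+6\big(1+\tfrac1\varepsilon\big)L_y^2\alpha^2D\Big),\quad \omega=6D\big(1+\tfrac1\varepsilon\big)c_l^2\kappa^3\big(\tfrac1T\big)^T(1-\beta\mu)^PL_y^2,$$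 and suppose that $\tau<1$ and $\alpha L_\Phi+\omega\alpha^2\big(\frac12+\alpha L_\Phi\big)\frac1{1-\tau}\le\frac14$. Then $\Phi$ is differentiable and $$\frac1K\sum_{k=0}^{K-1}\|\nabla\Phi(x_k)\|^2\le\frac{4(\Phi(x_0)-\inf_x\Phi(x))}{\alpha K}+\frac{3\delta_0}{K(1-\tau)}+\frac1K\sum_{k=0}^{K-1}\frac{18nLM_{f_{xy}}^2C_{F_y}^2}{\mu^3\tilde\xi\,Q_k},$$ where $\delta_0=3c_l^2\kappa^3(\frac1T)^T(1-\beta\mu)^PD\,\|y^*(x_0)-y_0\|^2$. In particular, if $Q_k=k+1$ for all $k<K$, then $$\frac1K\sum_{k=0}^{K-1}\|\nabla\Phi(x_k)\|^2\le\frac{4(\Phi(x_0)-\inf_x\Phi(x))}{\alpha K}+\frac{3\delta_0}{K(1-\tau)}+\frac{18nLM_{f_{xy}}^2C_{F_y}^2\ln K}{\mu^3\tilde\xi K}.$$ -/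

import Mathlib

noncomputable section

namespace QNBO

/-- The `d`-dimensional Euclidean space. -/
abbrev E (d : ℕ) : Type := EuclideanSpace ℝ (Fin d)

variable {m n : ℕ}

/-! ### Partial derivatives of a function of two vector variables -/

/-- `∇_x G (x, y)`. -/
def gradX (G : E m → E n → ℝ) (x : E m) (y : E n) : E m :=
  gradient (fun x' => G x' y) x

/-- `∇_y G (x, y)`. -/
def gradY (G : E m → E n → ℝ) (x : E m) (y : E n) : E n :=
  gradient (fun y' => G x y') y

/-- `∇²_{yy} G (x, y)`, as a linear operator on `ℝⁿ`. -/
def hessYY (G : E m → E n → ℝ) (x : E m) (y : E n) : E n →L[ℝ] E n :=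
  fderiv ℝ (fun y' => gradY G x y') y

/-- `∇²_{xy} G (x, y)`, the `n × m` derivative of `∇_y G` in `x`. -/
def hessXY (G : E m → E n → ℝ) (x : E m) (y : E n) : E m →L[ℝ] E n :=
  fderiv ℝ (fun x' => gradY G x' y) x

/-- The local norm `‖v‖_z = ⟨∇²_{yy} G (x, z) v, v⟩^{1/2}`. -/
def localNorm (G : E m → E n → ℝ) (x : E m) (z v : E n) : ℝ :=
  Real.sqrt (inner ℝ (hessYY G x z v) v)

/-! ### The bilevel problem -/

/-- `y^*(x)`, a minimizer of `f (x, ·)` (unique if `f (x, ·)` is strongly convex). -/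
def yStar (f : E m → E n → ℝ) (x : E m) : E n :=
  Classical.epsilon fun y => ∀ y', f x y ≤ f x y'

/-- `Φ(x) = F (x, y^*(x))`. -/
def Phi (F f : E m → E n → ℝ) (x : E m) : ℝ := F x (yStar f x)

/-- The constants of the assumptions; a final `'` stands for a bar, that is, for a Lipschitz
constant with respect to `x`. -/
structure Consts where
  LFx : ℝ
  LFx' : ℝ
  LFy : ℝ
  LFy' : ℝ
  CFy : ℝ
  μ : ℝ
  L : ℝ
  Lfyy : ℝ
  Lfyy' : ℝ
  Lfxy : ℝ
  Lfxy' : ℝ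
  Mfxy : ℝ

/-- Assumption on the upper-level function. -/
structure UpperAssumption (F : E m → E n → ℝ) (c : Consts) : Prop where
  differentiable : Differentiable ℝ fun p : E m × E n => F p.1 p.2
  LFx_nonneg : 0 ≤ c.LFx
  LFx'_nonneg : 0 ≤ c.LFx'
  LFy_nonneg : 0 ≤ c.LFy
  LFy'_nonneg : 0 ≤ c.LFy'
  gradX_lip_y : ∀ x y₁ y₂, ‖gradX F x y₁ - gradX F x y₂‖ ≤ c.LFx * ‖y₁ - y₂‖
  gradY_lip_y : ∀ x y₁ y₂, ‖gradY F x y₁ - gradY F x y₂‖ ≤ c.LFy * ‖y₁ - y₂‖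
  gradX_lip_x : ∀ x₁ x₂ y, ‖gradX F x₁ y - gradX F x₂ y‖ ≤ c.LFx' * ‖x₁ - x₂‖
  gradY_lip_x : ∀ x₁ x₂ y, ‖gradY F x₁ y - gradY F x₂ y‖ ≤ c.LFy' * ‖x₁ - x₂‖
  gradY_bound : ∀ x y, ‖gradY F x y‖ ≤ c.CFy

/-- Assumption on the lower-level function. -/
structure LowerAssumption (f : E m → E n → ℝ) (c : Consts) : Prop where
  contDiff : ContDiff ℝ 2 fun p : E m × E n => f p.1 p.2
  μ_pos : 0 < c.μ
  Lfyy_nonneg : 0 ≤ c.Lfyy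
  Lfyy'_nonneg : 0 ≤ c.Lfyy'
  Lfxy_nonneg : 0 ≤ c.Lfxy
  Lfxy'_nonneg : 0 ≤ c.Lfxy'
  strongConvex : ∀ x, StrongConvexOn Set.univ c.μ (f x)
  gradY_lip_y : ∀ x y₁ y₂, ‖gradY f x y₁ - gradY f x y₂‖ ≤ c.L * ‖y₁ - y₂‖
  hessYY_lip_y : ∀ x y₁ y₂, ‖hessYY f x y₁ - hessYY f x y₂‖ ≤ c.Lfyy * ‖y₁ - y₂‖
  hessXY_lip_y : ∀ x y₁ y₂, ‖hessXY f x y₁ - hessXY f x y₂‖ ≤ c.Lfxy * ‖y₁ - y₂‖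
  hessXY_bound : ∀ x y, ‖hessXY f x y‖ ≤ c.Mfxy
  hessXY_lip_x : ∀ x₁ x₂ y, ‖hessXY f x₁ y - hessXY f x₂ y‖ ≤ c.Lfxy' * ‖x₁ - x₂‖
  hessYY_lip_x : ∀ x₁ x₂ y, ‖hessYY f x₁ y - hessYY f x₂ y‖ ≤ c.Lfyy' * ‖x₁ - x₂‖

/-! ### BFGS and the algorithm -/

/-- The matrix `a bᵀ`. -/
def outer (a b : E n) : E n →L[ℝ] E n := (innerSL ℝ b).smulRight a

/-- One BFGS update of the inverse Hessian approximation,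
`(I - ρ s gᵀ) H (I - ρ g sᵀ) + ρ s sᵀ` with `ρ = 1 / (gᵀ s)`. If `s = 0`, then `ρ = 0` here and
`H` is left unchanged. -/
def bfgsUpdate (H : E n →L[ℝ] E n) (s g : E n) : E n →L[ℝ] E n :=
  let ρ : ℝ := 1 / inner ℝ g s
  (ContinuousLinearMap.id ℝ (E n) - ρ • outer s g) ∘L H ∘L
      (ContinuousLinearMap.id ℝ (E n) - ρ • outer g s) + ρ • outer s s

/-- `j` gradient descent steps `y ← y - β ∇_y f (x, y)`. -/
def gdIter (f : E m → E n → ℝ) (β : ℝ) (x : E m) (y : E n) : ℕ → E n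
  | 0 => y
  | j + 1 => gdIter f β x y j - β • gradY f x (gdIter f β x y j)

/-- The pair `(y_t, H_t)` after `t` BFGS steps `y_{t+1} = y_t - γ H_t ∇_y f (x, y_t)`, where `H_t`
is built from `H₀` and the pairs `s_i = y_{i+1} - y_i`, `g_i = ∇_y f (x, y_{i+1}) - ∇_y f (x, y_i)`,
`i < t`. -/
def qnIter (f : E m → E n → ℝ) (H₀ : E n →L[ℝ] E n) (γ : ℝ) (x : E m) (y : E n) :
    ℕ → E n × (E n →L[ℝ] E n)
  | 0 => (y, H₀)
  | t + 1 =>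
    let p := qnIter f H₀ γ x y t
    let y' := p.1 - γ • p.2 (gradY f x p.1)
    (y', bfgsUpdate p.2 (y' - p.1) (gradY f x y' - gradY f x p.1))

/-- Subroutine `𝒜`: `P` gradient descent steps, then `T` BFGS steps; it returns the last point
`y_T` and the last inverse Hessian approximation `H_T`. -/
def subA (f : E m → E n → ℝ) (H₀ : E n →L[ℝ] E n) (β γ : ℝ) (P T : ℕ) (x : E m) (y : E n) :
    E n × (E n →L[ℝ] E n) :=
  qnIter f H₀ γ x (gdIter f β x y P) T

/-- The matrices `H_i` of subroutine `ℬ` at `(x, y)` in the direction `d`: with `u_i = H_i d`,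
`s_i = ζ_i u_i` and `g_i = ∇_y f (x, y + s_i) - ∇_y f (x, y)`. -/
def subBMat (f : E m → E n → ℝ) (H₀ : E n →L[ℝ] E n) (ζ : ℕ → ℝ) (x : E m) (y d : E n) :
    ℕ → (E n →L[ℝ] E n)
  | 0 => H₀
  | i + 1 =>
    let H := subBMat f H₀ ζ x y d i
    let s := ζ i • H d
    bfgsUpdate H s (gradY f x (y + s) - gradY f x y)

/-- The iterate `u_i = H_i d` of subroutine `ℬ`. -/
def subB (f : E m → E n → ℝ) (H₀ : E n →L[ℝ] E n) (ζ : ℕ → ℝ) (x : E m) (y d : E n) (i : ℕ) :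
    E n :=
  subBMat f H₀ ζ x y d i d

/-- `x, y, u` are the iterates of `K` outer iterations of qNBO (BFGS). If `Q_k = 1`, the matrix of
subroutine `𝒜` is shared; if `Q_k > 1`, then `u_{k+1}` is an iterate `u_{k,i}`, `i < Q_k`, of
subroutine `ℬ` that is closest to `[∇²_{yy} f (x_k, y_{k+1})]⁻¹ ∇_y F (x_k, y_{k+1})`. -/
structure IsRun (F f : E m → E n → ℝ) (H₀ : E n →L[ℝ] E n) (α β γ : ℝ) (P T K : ℕ) (Q : ℕ → ℕ)
    (ζ : ℕ → ℕ → ℝ) (x : ℕ → E m) (y u : ℕ → E n) : Prop where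
  y_step : ∀ k < K, y (k + 1) = (subA f H₀ β γ P T (x k) (y k)).1
  u_shared : ∀ k < K, Q k = 1 →
    u (k + 1) = (subA f H₀ β γ P T (x k) (y k)).2 (gradY F (x k) (y (k + 1)))
  u_step : ∀ k < K, 1 < Q k → ∃ i < Q k,
    u (k + 1) = subB f H₀ (ζ k) (x k) (y (k + 1)) (gradY F (x k) (y (k + 1))) i ∧
    ∀ j < Q k,
      ‖(hessYY f (x k) (y (k + 1))).inverse (gradY F (x k) (y (k + 1))) - u (k + 1)‖ ≤
      ‖(hessYY f (x k) (y (k + 1))).inverse (gradY F (x k) (y (k + 1))) -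
        subB f H₀ (ζ k) (x k) (y (k + 1)) (gradY F (x k) (y (k + 1))) j‖
  x_step : ∀ k < K, x (k + 1) = x k - α •
    (gradX F (x k) (y (k + 1)) - (hessXY f (x k) (y (k + 1))).adjoint (u (k + 1)))

/-! ### The constants of the rate -/

namespace Consts

/-- Condition number `κ = L / μ`. -/
def κ (c : Consts) : ℝ := c.L / c.μ

/-- Lipschitz constant of `y^*`. -/
def Ly (c : Consts) : ℝ := c.Mfxy / c.μ

/-- Strong self-concordance constant of `f (x, ·)`. -/
def M (c : Consts) : ℝ := c.Lfyy / c.μ ^ (3 / 2 : ℝ)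

/-- Lipschitz constant of the approximate hypergradient in `y`. -/
def C (c : Consts) : ℝ :=
  c.LFx + c.LFy * c.Mfxy / c.μ + c.CFy * (c.Lfxy / c.μ + c.Lfyy * c.Mfxy / c.μ ^ 2)

/-- Lipschitz constant of `∇Φ`. -/
def LPhi (c : Consts) : ℝ :=
  (c.LFy' + c.C) * c.Mfxy / c.μ + c.LFx' +
    c.CFy * (c.Lfxy' / c.μ + c.Lfyy' * c.Mfxy / c.μ ^ 2)

/-- `K₀ = 8 n ln (2L/μ)`. -/
def K₀ (c : Consts) (n : ℕ) : ℝ := 8 * n * Real.log (2 * c.L / c.μ)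

/-- Radius of local superlinear convergence of BFGS (meaningful for `L_{f_yy} > 0`). -/
def K₁ (c : Consts) (n : ℕ) : ℝ :=
  2 * Real.log (3 / 2) * Real.sqrt c.μ / ((3 / 2 : ℝ) ^ (3 / 2 : ℝ) * c.M * c.L) *
    max (c.μ / (2 * c.L)) (1 / (c.K₀ n + 9))

/-- `t_c = (9/8) K₀`. -/
def tc (c : Consts) (n : ℕ) : ℝ := 9 / 8 * c.K₀ n

/-- `c_l = 2 t_c^{T/2}`. -/
def cl (c : Consts) (n T : ℕ) : ℝ := 2 * (c.tc n) ^ ((T : ℝ) / 2)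

/-- `c_l² κ³ (1/T)^T (1 - βμ)^P`. -/
def contr (c : Consts) (n T P : ℕ) (β : ℝ) : ℝ :=
  c.cl n T ^ 2 * c.κ ^ 3 * (1 / (T : ℝ)) ^ T * (1 - β * c.μ) ^ P

/-- The sum of squared constants that occurs in `τ`, `ω` and `δ₀`. -/
def D (c : Consts) : ℝ :=
  c.LFx ^ 2 + c.Lfxy ^ 2 * c.CFy ^ 2 / c.μ ^ 2 + 4 * c.Mfxy ^ 2 * c.LFy ^ 2 / c.μ ^ 2 +
    4 * c.Mfxy ^ 2 * c.CFy ^ 2 * c.Lfyy ^ 2 / c.μ ^ 4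

/-- The factor `τ`. -/
def τ (c : Consts) (n T P : ℕ) (α β ε : ℝ) : ℝ :=
  c.contr n T P β * ((1 + ε) + 6 * (1 + 1 / ε) * c.Ly ^ 2 * α ^ 2 * c.D)

/-- The factor `ω`. -/
def ω (c : Consts) (n T P : ℕ) (β ε : ℝ) : ℝ :=
  6 * c.D * (1 + 1 / ε) * c.contr n T P β * c.Ly ^ 2

/-- The initial error `δ₀`, where `r = ‖y^*(x_0) - y_0‖`. -/
def δ₀ (c : Consts) (n T P : ℕ) (β r : ℝ) : ℝ := 3 * c.contr n T P β * c.D * r ^ 2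

end Consts

/-- `ξ_{k,i} = exp (M ∑_{j<i} ‖ζ_{k,j} u_{k,j}‖_{y_{k+1}})` for the iterates `u_{k,j}` of
subroutine `ℬ`. -/
def xi (F f : E m → E n → ℝ) (c : Consts) (H₀ : E n →L[ℝ] E n) (ζ : ℕ → ℕ → ℝ)
    (x : ℕ → E m) (y : ℕ → E n) (k i : ℕ) : ℝ :=
  Real.exp (c.M * ∑ j ∈ Finset.range i, localNorm f (x k) (y (k + 1))
    (ζ k j • subB f H₀ (ζ k) (x k) (y (k + 1)) (gradY F (x k) (y (k + 1))) j))

/-- `min_{1 ≤ i ≤ Q_k} 1 / (2 (ξ_{k,i}² + ξ_{k,i}))` if `Q_k > 1`. If `Q_k = 1`, subroutine `ℬ` is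
not called, and the value is `1/4`, which belongs to `ξ = 1`. -/
def xiTildeAt (F f : E m → E n → ℝ) (c : Consts) (H₀ : E n →L[ℝ] E n) (Q : ℕ → ℕ)
    (ζ : ℕ → ℕ → ℝ) (x : ℕ → E m) (y : ℕ → E n) (k : ℕ) : ℝ :=
  if 1 < Q k then
    ⨅ i : Fin (Q k), 1 / (2 * (xi F f c H₀ ζ x y k (i + 1) ^ 2 + xi F f c H₀ ζ x y k (i + 1)))
  else 1 / 4

/-- `ξ̃`, the minimum of the preceding quantities over the outer iterations `k < K`. -/
def xiTilde (F f : E m → E n → ℝ) (c : Consts) (H₀ : E n →L[ℝ] E n) (Q : ℕ → ℕ)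
    (ζ : ℕ → ℕ → ℝ) (x : ℕ → E m) (y : ℕ → E n) (K : ℕ) : ℝ :=
  ⨅ k : Fin K, xiTildeAt F f c H₀ Q ζ x y k

end QNBO

end

/-! The outer iteration is inexact gradient descent on Φ. The lower-level equation ∇_y f(x, y*(x)) =
0 can be differentiated, which gives a formula for ∇Φ and its Lipschitz constant L_Φ
(`hasGradientAt_Phi`, `gradient_Phi_lip`). The squared error of the direction used in iteration k is
at most r_k + b_k, where r_k = 3D‖y_{k+1} - y*(x_k)‖² and b_k is 6M_{f_xy}² times the squared error
of the linear system (`hyperGrad_error`). Subroutine 𝒜 contracts the distance to y*(x_k), while y*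
moves by at most L_y‖x_{k+1} - x_k‖; hence r_{k+1} ≤ τ r_k + ωα²(‖∇Φ(x_k)‖² + b_k). Summed together
with the descent inequality, this leaves only the initial gap, δ₀ and the b_k (`sum_le_of_descent`,
`run_sum_le`).

Both BFGS estimates are made in coordinates in which a reference Hessian A = R² is the identity.
BFGS commutes with this change (`bfgsUpdate_conj`), and every secant pair becomes g = Js with J a
mean Hessian close to the identity (`conj_near`). The potentials tr B - ln det B and tr H - ln det H
are at least n for positive definite matrices, so their total decrease is bounded by the initial
value and the accumulated perturbations.

For the minimization phase, the decrease D_i of the second potential controls the ratio of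
consecutive values of ⟨Hγ, γ⟩, γ being the gradient, by 3(exp D_i - 1). Since the sum of the D_i is
about n ln κ, the arithmetic-geometric mean inequality turns the product of the ratios into
(const/T)^T (`superlinear`). This requires the errors M‖z_i‖ to have a small sum, which a bootstrap
shows for either of the two radii in K₁ (`linear_phase`, `superlinear_phase`).

For the linear system, all steps of subroutine ℬ are multiples of H_i d, so B_i maps them to
multiples of the one vector d, and the decrease of the first potential dominates the relative error
of H_i d. The total error is bounded independently of Q apart from ξ, so the best of Q candidates
has an error of order 1/Q (`exists_direction_error_le`). With Q_k = 1 the last matrix of 𝒜 already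
has an error small enough for the same bound (`qnIter_solve`). -/

noncomputable section

namespace QNBO

open scoped InnerProductSpace

/-! ### Positive definite operators and their inverses -/

/-- `B` is symmetric and positive definite, and `H` is its inverse. -/
structure PosPair {n : ℕ} (H B : E n →L[ℝ] E n) : Prop where
  left : ∀ v, H (B v) = v
  right : ∀ v, B (H v) = v
  symm : ∀ v w, ⟪B v, w⟫_ℝ = ⟪v, B w⟫_ℝ
  pos : ∀ v, v ≠ 0 → 0 < ⟪B v, v⟫_ℝ

namespace PosPair

variable {n : ℕ} {H B : E n →L[ℝ] E n}

theorem swap (h : PosPair H B) : PosPair B H where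
  left := h.right
  right := h.left
  symm v w := by
    rw [← h.right w, h.left, ← h.symm, h.right]
  pos v hv := by
    have h1 : H v ≠ 0 := fun h0 => hv (by rw [← h.right v, h0, map_zero])
    have h2 := h.pos _ h1
    rwa [h.right, real_inner_comm] at h2

theorem nonneg (h : PosPair H B) (v : E n) : 0 ≤ ⟪B v, v⟫_ℝ := by
  by_cases hv : v = 0
  · simp [hv]
  · exact (h.pos v hv).le

theorem symm_inv (h : PosPair H B) (v w : E n) : ⟪H v, w⟫_ℝ = ⟪v, H w⟫_ℝ := h.swap.symm v w

/-- Cauchy–Schwarz for the form of `B`. -/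
theorem cauchy (h : PosPair H B) (v w : E n) :
    ⟪B v, w⟫_ℝ ^ 2 ≤ ⟪B v, v⟫_ℝ * ⟪B w, w⟫_ℝ := by
  by_cases hw : w = 0
  · simp [hw]
  have hσ := h.pos w hw
  have h1 := h.nonneg (⟪B w, w⟫_ℝ • v - ⟪B v, w⟫_ℝ • w)
  have h2 : ⟪B w, v⟫_ℝ = ⟪B v, w⟫_ℝ := by rw [h.symm, real_inner_comm]
  simp only [map_sub, map_smul, inner_sub_left, inner_sub_right, inner_smul_left, inner_smul_right,
    RCLike.conj_to_real, h2] at h1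
  have h3 : 0 ≤ ⟪B w, w⟫_ℝ * (⟪B v, v⟫_ℝ * ⟪B w, w⟫_ℝ - ⟪B v, w⟫_ℝ ^ 2) := by nlinarith
  linarith [nonneg_of_mul_nonneg_right h3 hσ]

/-- Duality of Cauchy–Schwarz between `B` and `H`. -/
theorem cauchy_dual (h : PosPair H B) (v w : E n) :
    ⟪v, w⟫_ℝ ^ 2 ≤ ⟪H v, v⟫_ℝ * ⟪B w, w⟫_ℝ := by
  have := h.cauchy (H v) w
  rwa [h.right, real_inner_comm (H v) v] at this

theorem of_symm_of_lower {c : ℝ} (hc : 0 < c) (hs : ∀ v w, ⟪B v, w⟫_ℝ = ⟪v, B w⟫_ℝ)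
    (hB : ∀ v, c * ‖v‖ ^ 2 ≤ ⟪B v, v⟫_ℝ) : ∃ H, PosPair H B := by
  have hpos : ∀ v, v ≠ 0 → 0 < ⟪B v, v⟫_ℝ := fun v hv => by
    have := norm_pos_iff.2 hv
    exact lt_of_lt_of_le (by positivity) (hB v)
  have hinj : Function.Injective (B : E n →ₗ[ℝ] E n) := by
    rw [injective_iff_map_eq_zero]
    intro v hv
    by_contra h0
    have := hpos v h0
    rw [show B v = 0 from hv] at this
    simp at this
  let e := (LinearEquiv.ofInjectiveEndo (B : E n →ₗ[ℝ] E n) hinj).toContinuousLinearEquiv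
  have he : ∀ v, e v = B v := fun v => rfl
  refine ⟨e.symm, ?_, ?_, hs, hpos⟩
  · intro v; change e.symm (B v) = v; rw [← he]; simp
  · intro v; change B (e.symm v) = v; rw [← he]; simp

theorem inverse_eq (h : PosPair H B) : B.inverse = H :=
  ContinuousLinearMap.inverse_eq (ContinuousLinearMap.ext h.right) (ContinuousLinearMap.ext h.left)

/-- Inversion reverses the order: `⟨B'v,v⟩ ≤ c⟨Bv,v⟩` gives `⟨Hv,v⟩ ≤ c⟨H'v,v⟩`. -/
theorem inv_le (h : PosPair H B) {H' B' : E n →L[ℝ] E n} (h' : PosPair H' B') {c : ℝ}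
    (hle : ∀ v, ⟪B' v, v⟫_ℝ ≤ c * ⟪B v, v⟫_ℝ) (v : E n) :
    ⟪H v, v⟫_ℝ ≤ c * ⟪H' v, v⟫_ℝ := by
  by_cases hv : v = 0
  · simp [hv]
  -- Duality is tested on the pair v, Hv: the B-form of Hv equals ⟨Hv, v⟩, so one such factor
  -- cancels at the end.
  have h1 := h'.cauchy_dual v (H v)
  have h2 := hle (H v)
  rw [h.right, real_inner_comm (H v) v] at h2
  rw [real_inner_comm (H v) v] at h1
  have h3 := h.swap.pos v hv
  have h4 := h'.swap.nonneg v
  have h5 : ⟪H v, v⟫_ℝ * ⟪H v, v⟫_ℝ ≤ (c * ⟪H' v, v⟫_ℝ) * ⟪H v, v⟫_ℝ := by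
    have : ⟪H' v, v⟫_ℝ * ⟪B' (H v), H v⟫_ℝ ≤ ⟪H' v, v⟫_ℝ * (c * ⟪H v, v⟫_ℝ) :=
      mul_le_mul_of_nonneg_left h2 h4
    nlinarith
  exact le_of_mul_le_mul_right h5 h3

theorem refl_id : PosPair (ContinuousLinearMap.id ℝ (E n)) (ContinuousLinearMap.id ℝ (E n)) where
  left _ := rfl
  right _ := rfl
  symm _ _ := rfl
  pos _ hv := real_inner_self_pos.2 hv

theorem conj {R S : E n →L[ℝ] E n} (hR : PosPair S R) (h : PosPair H B) :
    PosPair (R ∘L H ∘L R) (S ∘L B ∘L S) where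
  left v := by simp [hR.right, h.left]
  right v := by simp [hR.left, h.right]
  symm v w := by simp [hR.symm_inv, h.symm]
  pos v hv := by
    have h1 : S v ≠ 0 := fun h0 => hv (by rw [← hR.right v, h0, map_zero])
    simpa [hR.symm_inv] using h.pos _ h1

end PosPair

/-- If a symmetric form is bounded by a multiple of a positive form, then so is its polarization. -/
theorem symm_form_bound {n : ℕ} {X B H : E n →L[ℝ] E n} (hB : PosPair H B)
    (hX : ∀ v w, ⟪X v, w⟫_ℝ = ⟪v, X w⟫_ℝ) {c : ℝ}
    (hle : ∀ v, |⟪X v, v⟫_ℝ| ≤ c * ⟪B v, v⟫_ℝ) (v w : E n) :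
    ⟪X v, w⟫_ℝ ^ 2 ≤ c ^ 2 * (⟪B v, v⟫_ℝ * ⟪B w, w⟫_ℝ) := by
  have key : ∀ v w, 2 * ⟪X v, w⟫_ℝ ≤ c * (⟪B v, v⟫_ℝ + ⟪B w, w⟫_ℝ) := by
    intro v w
    have h1 := (abs_le.1 (hle (v + w))).2
    have h2 := (abs_le.1 (hle (v - w))).1
    have h3 : ⟪X w, v⟫_ℝ = ⟪X v, w⟫_ℝ := by rw [hX, real_inner_comm]
    have h4 : ⟪B w, v⟫_ℝ = ⟪B v, w⟫_ℝ := by rw [hB.symm, real_inner_comm]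
    simp only [map_sub, map_add, inner_sub_left, inner_sub_right, inner_add_left, inner_add_right,
      h3, h4] at h1 h2
    linarith
  by_cases hw : w = 0
  · simp [hw]
  by_cases hv : v = 0
  · simp [hv]
  have ha := hB.pos v hv
  have hb := hB.pos w hw
  set a := ⟪B v, v⟫_ℝ
  set b := ⟪B w, w⟫_ℝ
  have hab : Real.sqrt a * Real.sqrt a = a := Real.mul_self_sqrt ha.le
  have hbb : Real.sqrt b * Real.sqrt b = b := Real.mul_self_sqrt hb.le
  -- This scaling gives both vectors the same form value ab, so the arithmetic mean in `key` becomes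
  -- the geometric mean √(ab). The opposite sign of w gives the lower bound.
  have h1 := key (Real.sqrt b • v) (Real.sqrt a • w)
  have h2 := key (Real.sqrt b • v) (-(Real.sqrt a) • w)
  simp only [map_smul, inner_smul_left, inner_smul_right, RCLike.conj_to_real] at h1 h2
  have hsa := Real.sqrt_pos.2 ha
  have hsb := Real.sqrt_pos.2 hb
  set p := Real.sqrt a
  set q := Real.sqrt b
  have e1 : q * (q * a) = p * p * (q * q) := by rw [hab]; ring
  have e2 : p * (p * b) = p * p * (q * q) := by rw [hbb]; ring
  have hpq : 0 < p * q := by positivity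
  have h1' : ⟪X v, w⟫_ℝ ≤ c * (p * q) := by
    have : (p * q) * ⟪X v, w⟫_ℝ ≤ (p * q) * (c * (p * q)) := by
      change 2 * (p * (q * ⟪X v, w⟫_ℝ)) ≤ c * (q * (q * a) + p * (p * b)) at h1
      rw [e1, e2] at h1
      nlinarith
    exact le_of_mul_le_mul_left this hpq
  have h2' : -(c * (p * q)) ≤ ⟪X v, w⟫_ℝ := by
    have : (p * q) * -⟪X v, w⟫_ℝ ≤ (p * q) * (c * (p * q)) := by
      change 2 * (-p * (q * ⟪X v, w⟫_ℝ)) ≤ c * (q * (q * a) + -p * (-p * b)) at h2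
      rw [show -p * (-p * b) = p * (p * b) by ring, e1, e2] at h2
      nlinarith
    linarith [le_of_mul_le_mul_left this hpq]
  calc ⟪X v, w⟫_ℝ ^ 2 ≤ (c * (p * q)) ^ 2 := sq_le_sq' h2' h1'
    _ = c ^ 2 * (p * p * (q * q)) := by ring
    _ = _ := by rw [hab, hbb]

/-- The polarized bound relative to the identity is applied with w = Xv, and ‖Xv‖² is cancelled. -/
theorem norm_le_of_symm_form_bound {n : ℕ} {X : E n →L[ℝ] E n}
    (hX : ∀ v w, ⟪X v, w⟫_ℝ = ⟪v, X w⟫_ℝ) {c : ℝ} (hc : 0 ≤ c)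
    (hle : ∀ v, |⟪X v, v⟫_ℝ| ≤ c * ‖v‖ ^ 2) (v : E n) : ‖X v‖ ≤ c * ‖v‖ := by
  have h1 := symm_form_bound PosPair.refl_id hX (by simpa using hle) v (X v)
  simp only [ContinuousLinearMap.id_apply, real_inner_self_eq_norm_sq] at h1
  by_cases h0 : X v = 0
  · rw [h0, norm_zero]; positivity
  have h2 : 0 < ‖X v‖ := norm_pos_iff.2 h0
  have h3 : ‖X v‖ ^ 2 ≤ (c * ‖v‖) ^ 2 := by
    have : ‖X v‖ ^ 2 * ‖X v‖ ^ 2 ≤ (c * ‖v‖) ^ 2 * ‖X v‖ ^ 2 := by nlinarith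
    exact le_of_mul_le_mul_right this (by positivity)
  exact (abs_le_of_sq_le_sq' h3 (by positivity)).2

/-- `J` is symmetric, and `a⁻¹ I ≤ J ≤ a I`. -/
structure Near {n : ℕ} (a : ℝ) (J : E n →L[ℝ] E n) : Prop where
  symm : ∀ v w, ⟪J v, w⟫_ℝ = ⟪v, J w⟫_ℝ
  lower : ∀ v, ‖v‖ ^ 2 ≤ a * ⟪J v, v⟫_ℝ
  upper : ∀ v, ⟪J v, v⟫_ℝ ≤ a * ‖v‖ ^ 2

namespace Near

variable {n : ℕ} {a : ℝ} {J : E n →L[ℝ] E n}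

theorem exists_pair (h : Near a J) (ha : 0 < a) : ∃ Ji, PosPair Ji J :=
  PosPair.of_symm_of_lower (c := 1 / a) (by positivity) h.symm fun v => by
    rw [div_mul_eq_mul_div, one_mul, div_le_iff₀ ha, mul_comm]
    exact h.lower v

/-- On eigenvalues this is λ² ≤ aλ. It follows by inverting J ≤ aI to I ≤ aJ⁻¹ and evaluating at Jv.
-/
theorem norm_sq_le (h : Near a J) (ha : 0 < a) (v : E n) : ‖J v‖ ^ 2 ≤ a * ⟪J v, v⟫_ℝ := by
  obtain ⟨Ji, hJ⟩ := h.exists_pair ha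
  have := PosPair.refl_id.inv_le hJ (c := a) (by simpa using h.upper) (J v)
  simpa [hJ.left, real_inner_comm] using this

theorem norm_le (h : Near a J) (ha : 0 < a) (v : E n) : ‖J v‖ ≤ a * ‖v‖ :=
  norm_le_of_symm_form_bound h.symm ha.le (fun v => by
    rw [abs_of_nonneg]
    · exact h.upper v
    · have := h.lower v
      by_contra hneg
      push Not at hneg
      nlinarith [sq_nonneg ‖v‖]) v

theorem le_norm (h : Near a J) (v : E n) (ha : 0 < a) : ‖v‖ ≤ a * ‖J v‖ := by
  by_cases h0 : v = 0
  · simp [h0]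
  have h2 : 0 < ‖v‖ := norm_pos_iff.2 h0
  have h1 := h.lower v
  have h3 := real_inner_le_norm (J v) v
  have : ‖v‖ * ‖v‖ ≤ (a * ‖J v‖) * ‖v‖ := by nlinarith
  exact le_of_mul_le_mul_right this h2

theorem norm_sub_le {η : ℝ} (hη : 0 ≤ η) (h : Near (1 + η) J) (v : E n) :
    ‖v - J v‖ ≤ η * ‖v‖ := by
  refine norm_le_of_symm_form_bound (X := ContinuousLinearMap.id ℝ (E n) - J) ?_ hη ?_ v
  · intro v w
    simp [inner_sub_left, inner_sub_right, h.symm]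
  · intro v
    have h1 := h.lower v
    have h2 := h.upper v
    simp only [sub_apply, ContinuousLinearMap.id_apply, inner_sub_left,
      real_inner_self_eq_norm_sq]
    rw [abs_le]
    constructor
    · linarith
    · nlinarith

end Near

/-! ### Trace and determinant -/

/-- Trace of an operator. -/
def tr {n : ℕ} (X : E n →L[ℝ] E n) : ℝ := LinearMap.trace ℝ (E n) X

/-- Determinant of an operator. -/
def dt {n : ℕ} (X : E n →L[ℝ] E n) : ℝ := LinearMap.det (X : E n →ₗ[ℝ] E n)

section spectral

variable {n : ℕ} {X : E n →L[ℝ] E n}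

theorem tr_add (X Y : E n →L[ℝ] E n) : tr (X + Y) = tr X + tr Y := by simp [tr]

theorem tr_sub (X Y : E n →L[ℝ] E n) : tr (X - Y) = tr X - tr Y := by simp [tr]

theorem tr_smul (c : ℝ) (X : E n →L[ℝ] E n) : tr (c • X) = c * tr X := by simp [tr]

theorem tr_outer (a b : E n) : tr (outer a b) = ⟪b, a⟫_ℝ := by
  have : (outer a b : E n →ₗ[ℝ] E n) = ((innerSL ℝ b : E n →L[ℝ] ℝ) : E n →ₗ[ℝ] ℝ).smulRight a := by
    ext v; simp [outer]
  rw [tr, this, LinearMap.trace_smulRight]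
  simp

theorem tr_le {C : ℝ} (h : ∀ v, ⟪X v, v⟫_ℝ ≤ C * ‖v‖ ^ 2) : tr X ≤ n * C := by
  rw [tr, LinearMap.trace_eq_sum_inner _ (EuclideanSpace.basisFun (Fin n) ℝ)]
  calc _ ≤ ∑ i : Fin n, C := Finset.sum_le_sum fun i _ => by
        have := h (EuclideanSpace.basisFun (Fin n) ℝ i)
        rw [OrthonormalBasis.norm_eq_one, real_inner_comm] at this
        simpa using this
    _ = n * C := by simp

theorem eigenvalue_ge (hs : (X : E n →ₗ[ℝ] E n).IsSymmetric) {c : ℝ}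
    (h : ∀ v, c * ‖v‖ ^ 2 ≤ ⟪X v, v⟫_ℝ) (i : Fin n) :
    c ≤ hs.eigenvalues (by simp) i := by
  have h1 := h (hs.eigenvectorBasis (by simp) i)
  have h2 := hs.apply_eigenvectorBasis (n := n) (by simp) i
  rw [show X (hs.eigenvectorBasis (n := n) (by simp) i) = _ from h2, inner_smul_left,
    real_inner_self_eq_norm_sq, OrthonormalBasis.norm_eq_one] at h1
  simpa using h1

theorem pow_le_dt (hs : ∀ v w, ⟪X v, w⟫_ℝ = ⟪v, X w⟫_ℝ) {c : ℝ} (hc : 0 ≤ c)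
    (h : ∀ v, c * ‖v‖ ^ 2 ≤ ⟪X v, v⟫_ℝ) : c ^ n ≤ dt X := by
  have hs' : (X : E n →ₗ[ℝ] E n).IsSymmetric := hs
  rw [dt, hs'.det_eq_prod_eigenvalues (n := n) (by simp)]
  calc c ^ n = ∏ i : Fin n, c := by simp
    _ ≤ _ := Finset.prod_le_prod (fun _ _ => hc) fun i _ => eigenvalue_ge hs' h i

theorem PosPair.exists_lower {H B : E n →L[ℝ] E n} (h : PosPair H B) :
    ∃ c > 0, ∀ v, c * ‖v‖ ^ 2 ≤ ⟪B v, v⟫_ℝ := by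
  have hH : 0 ≤ ‖H‖ := norm_nonneg _
  -- The summand 1 keeps the constant meaningful when H = 0, as happens for n = 0.
  refine ⟨1 / (‖H‖ + 1), by positivity, fun v => ?_⟩
  rw [div_mul_eq_mul_div, one_mul, div_le_iff₀ (by positivity)]
  have := h.inv_le PosPair.refl_id.swap (c := ‖H‖ + 1)
  have h2 : ∀ v, ⟪H v, v⟫_ℝ ≤ (‖H‖ + 1) * ⟪ContinuousLinearMap.id ℝ (E n) v, v⟫_ℝ := by
    intro v
    have h3 := real_inner_le_norm (H v) v
    have h4 := H.le_opNorm v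
    simp only [ContinuousLinearMap.id_apply, real_inner_self_eq_norm_sq]
    nlinarith [norm_nonneg v, sq_nonneg ‖v‖]
  have h5 := PosPair.refl_id.inv_le h.swap h2 v
  simp only [ContinuousLinearMap.id_apply, real_inner_self_eq_norm_sq] at h5
  linarith

theorem PosPair.dt_pos {H B : E n →L[ℝ] E n} (h : PosPair H B) : 0 < dt B := by
  obtain ⟨c, hc, hB⟩ := h.exists_lower
  exact lt_of_lt_of_le (by positivity) (pow_le_dt h.symm hc.le hB)

/-- `ln det ≤ tr - n`. -/
theorem PosPair.log_dt_le {H B : E n →L[ℝ] E n} (h : PosPair H B) :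
    n + Real.log (dt B) ≤ tr B := by
  obtain ⟨c, hc, hB⟩ := h.exists_lower
  have hs' : (B : E n →ₗ[ℝ] E n).IsSymmetric := h.symm
  have hpos := fun i => lt_of_lt_of_le hc (eigenvalue_ge hs' hB i)
  rw [dt, tr, hs'.det_eq_prod_eigenvalues (n := n) (by simp),
    hs'.trace_eq_sum_eigenvalues (n := n) (by simp)]
  simp only [RCLike.ofReal_real_eq_id, id_eq]
  rw [Real.log_prod fun i _ => (hpos i).ne']
  calc _ = ∑ i : Fin n, (1 + Real.log (hs'.eigenvalues (n := n) (by simp) i)) := by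
        rw [Finset.sum_add_distrib]; simp
    _ ≤ _ := by
      refine Finset.sum_le_sum fun i _ => ?_
      have := Real.log_le_sub_one_of_pos (hpos i)
      linarith

theorem dt_comp (X Y : E n →L[ℝ] E n) : dt (X ∘L Y) = dt X * dt Y := by
  exact LinearMap.det_comp _ _

theorem dt_id_add_outer (a b : E n) :
    dt (ContinuousLinearMap.id ℝ (E n) + outer a b) = 1 + ⟪b, a⟫_ℝ := by
  have : ((ContinuousLinearMap.id ℝ (E n) + outer a b : E n →L[ℝ] E n) : E n →ₗ[ℝ] E n) =
      LinearMap.transvection ((innerSL ℝ b : E n →L[ℝ] ℝ) : E n →ₗ[ℝ] ℝ) a := by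
    ext v; simp [outer, LinearMap.transvection]
  rw [dt, this, LinearMap.transvection.det]
  simp

theorem PosPair.dt_mul {H B : E n →L[ℝ] E n} (h : PosPair H B) : dt H * dt B = 1 := by
  rw [← dt_comp, show H ∘L B = ContinuousLinearMap.id ℝ (E n) from ContinuousLinearMap.ext h.left]
  simp [dt]

end spectral

/-- A positive definite operator has a positive definite square root. -/
theorem PosPair.exists_sqrt {n : ℕ} {H B : E n →L[ℝ] E n} (h : PosPair H B) :
    ∃ S R : E n →L[ℝ] E n, PosPair S R ∧ ∀ v, R (R v) = B v := by
  obtain ⟨c, hc, hB⟩ := h.exists_lower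
  have hs' : (B : E n →ₗ[ℝ] E n).IsSymmetric := h.symm
  have hn : Module.finrank ℝ (E n) = n := by simp
  set e := hs'.eigenvectorBasis hn with he
  set l := hs'.eigenvalues hn with hl
  have hpos : ∀ i, 0 < l i := fun i => lt_of_lt_of_le hc (eigenvalue_ge hs' hB i)
  let R : E n →L[ℝ] E n := ∑ i, Real.sqrt (l i) • outer (e i) (e i)
  have hR : ∀ v, R v = ∑ i, Real.sqrt (l i) • ⟪e i, v⟫_ℝ • e i := fun v => by
    simp [R, outer]
  have hRe : ∀ i, R (e i) = Real.sqrt (l i) • e i := fun i => by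
    rw [hR]
    simp [OrthonormalBasis.inner_eq_ite]
  have hRR : ∀ v, R (R v) = B v := by
    intro v
    conv_lhs => rw [hR v, map_sum]
    conv_rhs => rw [← e.sum_repr' v, map_sum]
    refine Finset.sum_congr rfl fun i _ => ?_
    rw [map_smul, map_smul, hRe, map_smul, show B (e i) = l i • e i from
      hs'.apply_eigenvectorBasis hn i, smul_smul, smul_smul, smul_smul, mul_right_comm,
      Real.mul_self_sqrt (hpos i).le, mul_comm]
  have hsym : ∀ v w, ⟪R v, w⟫_ℝ = ⟪v, R w⟫_ℝ := by
    intro v w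
    rw [hR, hR, sum_inner, inner_sum]
    refine Finset.sum_congr rfl fun i _ => ?_
    simp only [inner_smul_left, inner_smul_right, RCLike.conj_to_real]
    rw [real_inner_comm (e i) v]
    ring
  have hRpos : ∀ v, v ≠ 0 → 0 < ⟪R v, v⟫_ℝ := by
    intro v hv
    rw [hR, sum_inner]
    have hterm : ∀ i, ⟪Real.sqrt (l i) • ⟪e i, v⟫_ℝ • e i, v⟫_ℝ =
        Real.sqrt (l i) * ⟪e i, v⟫_ℝ ^ 2 := fun i => by
      simp only [inner_smul_left, RCLike.conj_to_real]; ring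
    simp only [hterm]
    have hnn : ∀ i ∈ Finset.univ, 0 ≤ Real.sqrt (l i) * ⟪e i, v⟫_ℝ ^ 2 :=
      fun i _ => by positivity
    refine lt_of_le_of_ne (Finset.sum_nonneg hnn) fun h0 => hv ?_
    have h1 := (Finset.sum_eq_zero_iff_of_nonneg hnn).1 h0.symm
    rw [← e.sum_repr' v]
    refine Finset.sum_eq_zero fun i hi => ?_
    have h2 := h1 i hi
    have h3 := Real.sqrt_pos.2 (hpos i)
    have : ⟪e i, v⟫_ℝ = 0 := by
      rcases mul_eq_zero.1 h2 with h4 | h4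
      · exact absurd h4 h3.ne'
      · exact pow_eq_zero_iff two_ne_zero |>.1 h4
    rw [this, zero_smul]
  have hl' : ∀ v, H (R (R v)) = v := fun v => by rw [hRR, h.left]
  have hr' : ∀ v, R (R (H v)) = v := fun v => by rw [hRR, h.right]
  -- The inverse of R is HR = B⁻¹R. That it is also a right inverse follows by cancelling R on the
  -- left of R(RHRv) = Rv.
  refine ⟨H ∘L R, R, ⟨hl', fun v => ?_, hsym, hRpos⟩, hRR⟩
  change R (H (R v)) = v
  have h1 : R (R (H (R v))) = R v := hr' (R v)
  have := congrArg H (congrArg R h1)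
  rwa [hl', hl'] at this

/-! ### One BFGS update -/

section bfgs

variable {n : ℕ} {H B J : E n →L[ℝ] E n} {s g : E n}

theorem bfgsUpdate_apply (H : E n →L[ℝ] E n) (s g v : E n) :
    bfgsUpdate H s g v = H (v - (1 / ⟪g, s⟫_ℝ * ⟪s, v⟫_ℝ) • g) -
      (1 / ⟪g, s⟫_ℝ * ⟪g, H (v - (1 / ⟪g, s⟫_ℝ * ⟪s, v⟫_ℝ) • g)⟫_ℝ) • s +
      (1 / ⟪g, s⟫_ℝ * ⟪s, v⟫_ℝ) • s := by
  simp only [bfgsUpdate, outer, ContinuousLinearMap.comp_apply, add_apply, sub_apply,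
    ContinuousLinearMap.id_apply, FunLike.coe_smul, Pi.smul_apply,
    ContinuousLinearMap.smulRight_apply, innerSL_apply_apply, smul_smul]

theorem bfgsUpdate_zero (H : E n →L[ℝ] E n) (g : E n) : bfgsUpdate H 0 g = H := by
  ext1 v
  simp [bfgsUpdate_apply]

/-- The BFGS update of the Hessian approximation `B = H⁻¹`. -/
def bfgsDirect (B : E n →L[ℝ] E n) (s g : E n) : E n →L[ℝ] E n :=
  B - (1 / ⟪B s, s⟫_ℝ) • outer (B s) (B s) + (1 / ⟪g, s⟫_ℝ) • outer g g

theorem bfgsDirect_apply (B : E n →L[ℝ] E n) (s g v : E n) :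
    bfgsDirect B s g v = B v - (1 / ⟪B s, s⟫_ℝ * ⟪B s, v⟫_ℝ) • B s +
      (1 / ⟪g, s⟫_ℝ * ⟪g, v⟫_ℝ) • g := by
  simp [bfgsDirect, outer, smul_smul]

theorem ne_zero_of_inner_pos (h : 0 < ⟪g, s⟫_ℝ) : s ≠ 0 := fun h0 => by simp [h0] at h

theorem bfgsDirect_inner_self (B : E n →L[ℝ] E n) (s g v : E n) :
    ⟪bfgsDirect B s g v, v⟫_ℝ =
      ⟪B v, v⟫_ℝ - ⟪B s, v⟫_ℝ ^ 2 / ⟪B s, s⟫_ℝ + ⟪g, v⟫_ℝ ^ 2 / ⟪g, s⟫_ℝ := by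
  rw [bfgsDirect_apply, inner_add_left, inner_sub_left, inner_smul_left, inner_smul_left]
  simp only [RCLike.conj_to_real]
  ring

/-- A direct check gives a left inverse, which in finite dimension is two-sided. For positivity, the
new form at v is the B-form of the component of v that is B-orthogonal to s, plus ⟨g, v⟩²/⟨g, s⟩.
The first part vanishes only when v is a multiple of s, and then the second is positive by the
curvature condition. -/
theorem PosPair.bfgs (h : PosPair H B) (hgs : 0 < ⟪g, s⟫_ℝ) :
    PosPair (bfgsUpdate H s g) (bfgsDirect B s g) := by
  have hs := ne_zero_of_inner_pos hgs
  have hσ := h.pos s hs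
  have hleft : ∀ v, bfgsUpdate H s g (bfgsDirect B s g v) = v := by
    intro v
    have e0 : ⟪s, B v⟫_ℝ = ⟪B s, v⟫_ℝ := (h.symm s v).symm
    have e1 : ⟪s, bfgsDirect B s g v⟫_ℝ = ⟪g, v⟫_ℝ := by
      rw [bfgsDirect_apply, inner_add_right, inner_sub_right, inner_smul_right, inner_smul_right,
        e0, real_inner_comm (B s) s, real_inner_comm g s]
      field_simp
      ring
    have e2 : bfgsDirect B s g v - (1 / ⟪g, s⟫_ℝ * ⟪g, v⟫_ℝ) • g =
        B v - (1 / ⟪B s, s⟫_ℝ * ⟪B s, v⟫_ℝ) • B s := by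
      rw [bfgsDirect_apply, add_sub_cancel_right]
    rw [bfgsUpdate_apply, e1, e2, map_sub, map_smul, h.left, h.left, inner_sub_right,
      inner_smul_right]
    have e3 : 1 / ⟪g, s⟫_ℝ * (⟪g, v⟫_ℝ - 1 / ⟪B s, s⟫_ℝ * ⟪B s, v⟫_ℝ * ⟪g, s⟫_ℝ) =
        1 / ⟪g, s⟫_ℝ * ⟪g, v⟫_ℝ - 1 / ⟪B s, s⟫_ℝ * ⟪B s, v⟫_ℝ := by
      field_simp
    rw [e3, sub_smul]
    abel
  refine ⟨hleft, ?_, ?_, ?_⟩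
  · have h1 : (bfgsUpdate H s g : E n →ₗ[ℝ] E n) * (bfgsDirect B s g : E n →ₗ[ℝ] E n) = 1 :=
      LinearMap.ext hleft
    have h2 := mul_eq_one_comm.1 h1
    exact fun v => LinearMap.congr_fun h2 v
  · intro v w
    rw [bfgsDirect_apply, bfgsDirect_apply]
    simp only [inner_add_left, inner_sub_left, inner_smul_left, inner_add_right, inner_sub_right,
      inner_smul_right, RCLike.conj_to_real, h.symm v w]
    rw [real_inner_comm (B s) v, real_inner_comm g v]
    ring
  · intro v hv
    rw [bfgsDirect_inner_self]
    have hg2 : 0 ≤ ⟪g, v⟫_ℝ ^ 2 / ⟪g, s⟫_ℝ := by positivity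
    set l := ⟪B s, v⟫_ℝ / ⟪B s, s⟫_ℝ with hl
    have e1 : ⟪B (v - l • s), v - l • s⟫_ℝ =
        ⟪B v, v⟫_ℝ - ⟪B s, v⟫_ℝ ^ 2 / ⟪B s, s⟫_ℝ := by
      have e0 : ⟪B v, s⟫_ℝ = ⟪B s, v⟫_ℝ := by rw [h.symm, real_inner_comm]
      simp only [map_sub, map_smul, inner_sub_left, inner_sub_right, inner_smul_left,
        inner_smul_right, RCLike.conj_to_real, e0]
      rw [hl]
      field_simp
      ring
    rw [← e1]
    by_cases h0 : v - l • s = 0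
    · have hv' : v = l • s := sub_eq_zero.1 h0
      have hl0 : l ≠ 0 := fun hl0 => hv (by rw [hv', hl0, zero_smul])
      rw [h0, map_zero, inner_zero_left, zero_add, hv', inner_smul_right]
      positivity
    · have := h.pos _ h0
      linarith

theorem tr_bfgsDirect (B : E n →L[ℝ] E n) (s g : E n) :
    tr (bfgsDirect B s g) = tr B - ‖B s‖ ^ 2 / ⟪B s, s⟫_ℝ + ‖g‖ ^ 2 / ⟪g, s⟫_ℝ := by
  rw [bfgsDirect, tr_add, tr_sub, tr_smul, tr_smul, tr_outer, tr_outer,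
    real_inner_self_eq_norm_sq, real_inner_self_eq_norm_sq]
  ring

theorem PosPair.tr_bfgsUpdate (h : PosPair H B) (s g : E n) :
    tr (bfgsUpdate H s g) = tr H - 2 * ⟪g, H s⟫_ℝ / ⟪g, s⟫_ℝ +
      ⟪g, H g⟫_ℝ * ‖s‖ ^ 2 / ⟪g, s⟫_ℝ ^ 2 + ‖s‖ ^ 2 / ⟪g, s⟫_ℝ := by
  have e : bfgsUpdate H s g = H - (1 / ⟪g, s⟫_ℝ) • outer (H g) s - (1 / ⟪g, s⟫_ℝ) • outer s (H g) +
      (1 / ⟪g, s⟫_ℝ ^ 2 * ⟪g, H g⟫_ℝ) • outer s s + (1 / ⟪g, s⟫_ℝ) • outer s s := by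
    ext1 v
    rw [bfgsUpdate_apply]
    have e1 : ⟪g, H v⟫_ℝ = ⟪H g, v⟫_ℝ := (h.symm_inv g v).symm
    simp only [map_sub, map_smul, inner_sub_right, inner_smul_right, e1, outer, add_apply,
      sub_apply, FunLike.coe_smul, Pi.smul_apply, ContinuousLinearMap.smulRight_apply,
      innerSL_apply_apply, smul_smul, mul_sub, sub_smul]
    rw [show 1 / ⟪g, s⟫_ℝ * (1 / ⟪g, s⟫_ℝ * ⟪s, v⟫_ℝ * ⟪g, H g⟫_ℝ) =
      1 / ⟪g, s⟫_ℝ ^ 2 * ⟪g, H g⟫_ℝ * ⟪s, v⟫_ℝ by ring]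
    abel
  rw [e]
  simp only [tr_add, tr_sub, tr_smul, tr_outer, real_inner_self_eq_norm_sq]
  rw [h.symm_inv g s, show ⟪s, H g⟫_ℝ = ⟪g, H s⟫_ℝ by rw [← h.symm_inv, real_inner_comm]]
  ring

/-- The updated matrix factors as (I + psᵀ)B(I + spᵀ) with p = (θg - Bs)/σ, where θ² = σ/t is what
makes the coefficient of ggᵀ equal to 1/t. Each outer factor has determinant 1 + ⟨s, p⟩ = θt/σ, and
the square of this is t/σ. -/
theorem PosPair.dt_bfgsDirect (h : PosPair H B) (hgs : 0 < ⟪g, s⟫_ℝ) :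
    dt (bfgsDirect B s g) = dt B * (⟪g, s⟫_ℝ / ⟪B s, s⟫_ℝ) := by
  have hσ := h.pos s (ne_zero_of_inner_pos hgs)
  set σ := ⟪B s, s⟫_ℝ with hσd
  set t := ⟪g, s⟫_ℝ with htd
  set θ := Real.sqrt (σ / t) with hθ
  have hθ2 : θ ^ 2 = σ / t := Real.sq_sqrt (by positivity)
  set p : E n := (1 / σ) • (θ • g - B s) with hp
  have hfac : bfgsDirect B s g = (ContinuousLinearMap.id ℝ (E n) + outer p s) ∘L B ∘L
      (ContinuousLinearMap.id ℝ (E n) + outer s p) := by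
    ext1 v
    have e0 : ⟪s, B v⟫_ℝ = ⟪B s, v⟫_ℝ := (h.symm s v).symm
    have e1 : ⟪s, B s⟫_ℝ = σ := by rw [real_inner_comm]
    have e2 : ⟪p, v⟫_ℝ = 1 / σ * (θ * ⟪g, v⟫_ℝ - ⟪B s, v⟫_ℝ) := by
      rw [hp, inner_smul_left, inner_sub_left, inner_smul_left]; simp
    rw [bfgsDirect_apply]
    simp only [outer, ContinuousLinearMap.comp_apply, add_apply, ContinuousLinearMap.id_apply,
      ContinuousLinearMap.smulRight_apply, innerSL_apply_apply, map_add, map_smul,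
      e0, e1, e2]
    rw [hp, smul_smul, smul_sub, smul_smul]
    have e3 : 1 / t * ⟪g, v⟫_ℝ = ⟪B s, v⟫_ℝ * (1 / σ) * θ +
        1 / σ * (θ * ⟪g, v⟫_ℝ - ⟪B s, v⟫_ℝ) * θ := by
      rw [show ⟪B s, v⟫_ℝ * (1 / σ) * θ + 1 / σ * (θ * ⟪g, v⟫_ℝ - ⟪B s, v⟫_ℝ) * θ =
        θ ^ 2 * ⟪g, v⟫_ℝ / σ by ring, hθ2]
      field_simp
    rw [smul_smul σ, mul_one_div_cancel hσ.ne', one_smul, add_sub_cancel, ← htd, ← hσd, e3,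
      smul_smul, add_smul, mul_comm (1 / σ) ⟪B s, v⟫_ℝ]
    abel
  have hps : ⟪s, p⟫_ℝ = θ * t / σ - 1 := by
    rw [hp, inner_smul_right, inner_sub_right, inner_smul_right, real_inner_comm g s,
      real_inner_comm (B s) s, ← htd, ← hσd]
    field_simp
  rw [hfac, dt_comp, dt_comp, dt_id_add_outer, dt_id_add_outer, real_inner_comm s p, hps]
  rw [show (1 + (θ * t / σ - 1)) * (dt B * (1 + (θ * t / σ - 1))) =
    dt B * (θ ^ 2 * t ^ 2 / σ ^ 2) by ring, hθ2]
  field_simp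

theorem PosPair.log_dt_bfgsDirect (h : PosPair H B) (hgs : 0 < ⟪g, s⟫_ℝ) :
    Real.log (dt (bfgsDirect B s g)) = Real.log (dt B) + Real.log (⟪g, s⟫_ℝ / ⟪B s, s⟫_ℝ) := by
  have hσ := h.pos s (ne_zero_of_inner_pos hgs)
  rw [h.dt_bfgsDirect hgs, Real.log_mul h.dt_pos.ne' (by positivity)]

theorem PosPair.log_dt_inv (h : PosPair H B) : Real.log (dt H) = -Real.log (dt B) := by
  have h1 := congrArg Real.log h.dt_mul
  rw [Real.log_mul h.swap.dt_pos.ne' h.dt_pos.ne', Real.log_one] at h1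
  linarith

/-- `B ≥ c J`, `c ≤ 1`, is preserved by the BFGS update with `g = J s`. -/
theorem PosPair.bfgsDirect_ge (h : PosPair H B) {Ji : E n →L[ℝ] E n} (hJ : PosPair Ji J)
    {c : ℝ} (hc0 : 0 ≤ c) (hc : c ≤ 1) (hle : ∀ v, c * ⟪J v, v⟫_ℝ ≤ ⟪B v, v⟫_ℝ)
    (hs : s ≠ 0) (v : E n) :
    c * ⟪J v, v⟫_ℝ ≤ ⟪bfgsDirect B s (J s) v, v⟫_ℝ := by
  have hσ := h.pos s hs
  have ht := hJ.pos s hs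
  rw [bfgsDirect_inner_self]
  set l := ⟪B s, v⟫_ℝ / ⟪B s, s⟫_ℝ with hl
  have e1 : ⟪B (v - l • s), v - l • s⟫_ℝ =
      ⟪B v, v⟫_ℝ - ⟪B s, v⟫_ℝ ^ 2 / ⟪B s, s⟫_ℝ := by
    have e0 : ⟪B v, s⟫_ℝ = ⟪B s, v⟫_ℝ := by rw [h.symm, real_inner_comm]
    simp only [map_sub, map_smul, inner_sub_left, inner_sub_right, inner_smul_left,
      inner_smul_right, RCLike.conj_to_real, e0]
    rw [hl]
    field_simp
    ring
  -- The new B-form at v is the old one at v - ls plus ⟨Js, v⟩²/⟨Js, s⟩. The J-form splits with the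
  -- same square and a further nonnegative one, so c ≤ 1 suffices.
  have h1 := hle (v - l • s)
  rw [e1] at h1
  have e2 : ⟪J (v - l • s), v - l • s⟫_ℝ =
      ⟪J v, v⟫_ℝ - ⟪J s, v⟫_ℝ ^ 2 / ⟪J s, s⟫_ℝ +
        (l * ⟪J s, s⟫_ℝ - ⟪J s, v⟫_ℝ) ^ 2 / ⟪J s, s⟫_ℝ := by
    have e0 : ⟪J v, s⟫_ℝ = ⟪J s, v⟫_ℝ := by rw [hJ.symm, real_inner_comm]
    simp only [map_sub, map_smul, inner_sub_left, inner_sub_right, inner_smul_left,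
      inner_smul_right, RCLike.conj_to_real, e0]
    field_simp
    ring
  rw [e2] at h1
  have h2 : 0 ≤ ⟪J s, v⟫_ℝ ^ 2 / ⟪J s, s⟫_ℝ := by positivity
  have h3 : 0 ≤ c * ((l * ⟪J s, s⟫_ℝ - ⟪J s, v⟫_ℝ) ^ 2 / ⟪J s, s⟫_ℝ) := by positivity
  nlinarith

/-- `H ≥ c J⁻¹`, `c ≤ 1`, is preserved by the BFGS update with `g = J s`. -/
theorem bfgsUpdate_ge {Ji : E n →L[ℝ] E n} (hJ : PosPair Ji J)
    {c : ℝ} (hc : c ≤ 1) (hle : ∀ v, c * ⟪Ji v, v⟫_ℝ ≤ ⟪H v, v⟫_ℝ)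
    (hs : s ≠ 0) (v : E n) :
    c * ⟪Ji v, v⟫_ℝ ≤ ⟪bfgsUpdate H s (J s) v, v⟫_ℝ := by
  have ht := hJ.pos s hs
  set t := ⟪J s, s⟫_ℝ with htd
  set w := v - (1 / t * ⟪s, v⟫_ℝ) • J s with hw
  have e1 : ⟪bfgsUpdate H s (J s) v, v⟫_ℝ = ⟪H w, w⟫_ℝ + ⟪s, v⟫_ℝ ^ 2 / t := by
    rw [bfgsUpdate_apply, ← htd, ← hw, inner_add_left, inner_sub_left, inner_smul_left,
      inner_smul_left]
    simp only [RCLike.conj_to_real]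
    have : ⟪H w, w⟫_ℝ = ⟪H w, v⟫_ℝ - 1 / t * ⟪s, v⟫_ℝ * ⟪J s, H w⟫_ℝ := by
      nth_rw 2 [hw]
      rw [inner_sub_right, inner_smul_right, real_inner_comm (J s) (H w)]
    rw [this]
    ring
  have e2 : ⟪Ji w, w⟫_ℝ = ⟪Ji v, v⟫_ℝ - ⟪s, v⟫_ℝ ^ 2 / t := by
    have f1 : ⟪Ji v, J s⟫_ℝ = ⟪s, v⟫_ℝ := by
      rw [hJ.symm_inv, hJ.left, real_inner_comm]
    have f2 : ⟪s, J s⟫_ℝ = t := by rw [real_inner_comm]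
    rw [hw]
    simp only [map_sub, map_smul, inner_sub_left, inner_sub_right, inner_smul_left,
      inner_smul_right, RCLike.conj_to_real, hJ.left, f1, f2]
    field_simp
    ring
  -- The new H-form and the J⁻¹-form at v exceed the H-form and the J⁻¹-form at w by the same square
  -- ⟨s, v⟩²/t; this is where c ≤ 1 enters.
  have h1 := hle w
  rw [e1]
  rw [e2] at h1
  have h2 : 0 ≤ ⟪s, v⟫_ℝ ^ 2 / t := by positivity
  nlinarith

/-- The BFGS update commutes with a symmetric change of coordinates. -/
theorem bfgsUpdate_conj {S R : E n →L[ℝ] E n} (hR : PosPair S R) (H : E n →L[ℝ] E n) (s g : E n) :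
    R ∘L bfgsUpdate H s g ∘L R = bfgsUpdate (R ∘L H ∘L R) (R s) (S g) := by
  ext1 v
  have e1 : ⟪S g, R s⟫_ℝ = ⟪g, s⟫_ℝ := by rw [hR.symm_inv, hR.left]
  have e2 : ⟪R s, v⟫_ℝ = ⟪s, R v⟫_ℝ := hR.symm s v
  have e3 : ∀ w, ⟪S g, R w⟫_ℝ = ⟪g, w⟫_ℝ := fun w => by rw [hR.symm_inv, hR.left]
  have e4 : ∀ c : ℝ, R (v - c • S g) = R v - c • g := fun c => by
    rw [map_sub, map_smul, hR.right]
  rw [ContinuousLinearMap.comp_apply, ContinuousLinearMap.comp_apply, bfgsUpdate_apply,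
    bfgsUpdate_apply, e1, e2]
  simp only [ContinuousLinearMap.comp_apply, e4, e3]
  simp only [map_sub, map_add, map_smul]

/-- Bounds for `H` carry over from one step to the next. -/
theorem PosPair.bfgs_bounds (h : PosPair H B) {a x l : ℝ} (ha : 1 ≤ a) (hJ : Near a J)
    (hx : 1 ≤ x) (hl0 : 0 < l) (hl : l ≤ 1) (hup : ∀ v, ⟪H v, v⟫_ℝ ≤ x * ‖v‖ ^ 2)
    (hlo : ∀ v, l * ‖v‖ ^ 2 ≤ ⟪H v, v⟫_ℝ) (hs : s ≠ 0) :
    PosPair (bfgsUpdate H s (J s)) (bfgsDirect B s (J s)) ∧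
    (∀ v, ⟪bfgsUpdate H s (J s) v, v⟫_ℝ ≤ x * a ^ 2 * ‖v‖ ^ 2) ∧
    (∀ v, l / a ^ 2 * ‖v‖ ^ 2 ≤ ⟪bfgsUpdate H s (J s) v, v⟫_ℝ) := by
  have ha0 : 0 < a := by linarith
  obtain ⟨Ji, hJi⟩ := hJ.exists_pair ha0
  have hp := h.bfgs (hJi.pos s hs)
  refine ⟨hp, fun v => ?_, fun v => ?_⟩
  -- The update preserves bounds relative to J, not to I. One factor a is lost in passing from I to
  -- J and another in passing back, hence a².
  · have h1 : ∀ v, ‖v‖ ^ 2 ≤ x * ⟪B v, v⟫_ℝ := fun v => by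
      simpa using PosPair.refl_id.inv_le h.swap (c := x) (by simpa using hup) v
    have h2 : ∀ v, 1 / (x * a) * ⟪J v, v⟫_ℝ ≤ ⟪B v, v⟫_ℝ := fun v => by
      rw [div_mul_eq_mul_div, one_mul, div_le_iff₀ (by positivity)]
      have := h1 v
      have := hJ.upper v
      nlinarith
    have h3 : 1 / (x * a) ≤ 1 := by
      rw [div_le_one (by positivity)]; nlinarith
    have h4 := h.bfgsDirect_ge hJi (s := s) (by positivity) h3 h2 hs
    have h5 : ∀ w, ⟪ContinuousLinearMap.id ℝ (E n) w, w⟫_ℝ ≤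
        x * a ^ 2 * ⟪bfgsDirect B s (J s) w, w⟫_ℝ := fun w => by
      have f1 := h4 w
      have f2 := hJ.lower w
      rw [div_mul_eq_mul_div, one_mul, div_le_iff₀ (by positivity)] at f1
      simp only [ContinuousLinearMap.id_apply, real_inner_self_eq_norm_sq]
      nlinarith
    simpa using hp.inv_le PosPair.refl_id h5 v
  · have h1 : ∀ v, ⟪Ji v, v⟫_ℝ ≤ a * ‖v‖ ^ 2 := fun v => by
      simpa using hJi.inv_le PosPair.refl_id (c := a) (by simpa using hJ.lower) v
    have h1' : ∀ v, ‖v‖ ^ 2 ≤ a * ⟪Ji v, v⟫_ℝ := fun v => by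
      simpa using PosPair.refl_id.inv_le hJi (c := a) (by simpa using hJ.upper) v
    have h2 : ∀ v, l / a * ⟪Ji v, v⟫_ℝ ≤ ⟪H v, v⟫_ℝ := fun v => by
      refine le_trans ?_ (hlo v)
      rw [div_mul_eq_mul_div, div_le_iff₀ ha0]
      have := h1 v
      nlinarith
    have h3 : l / a ≤ 1 := by rw [div_le_one ha0]; linarith
    have h4 := bfgsUpdate_ge hJi h3 h2 hs v
    refine le_trans ?_ h4
    rw [div_mul_eq_mul_div, div_mul_eq_mul_div, div_le_div_iff₀ (by positivity) ha0]
    have := h1' v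
    have hla : 0 ≤ l * a := by positivity
    nlinarith

end bfgs

/-! ### Scalar inequalities for the logarithm -/

/-- This is t ≤ sinh t at t = -ln q. -/
theorem neg_two_log_le {q : ℝ} (hq : 0 < q) (hq1 : q ≤ 1) : -2 * Real.log q ≤ 1 / q - q := by
  have h1 : 0 ≤ -Real.log q := by linarith [Real.log_nonpos hq.le hq1]
  have h2 := Real.self_le_sinh_iff.2 h1
  rw [Real.sinh_eq, neg_neg, Real.exp_neg, Real.exp_log hq] at h2
  rw [one_div]
  linarith

theorem two_mul_sub_one_div_le_log {v : ℝ} (hv : 1 ≤ v) : 2 * (v - 1) / (v + 1) ≤ Real.log v := by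
  have h := Real.le_log_one_add_of_nonneg (x := v - 1) (by linarith)
  rw [show 1 + (v - 1) = v by ring, show v - 1 + 2 = v + 1 by ring] at h
  exact h

/-- The bound ln v ≥ 2(v - 1)/(v + 1) gives (v + 1)(v ln v - v + 1) ≥ (v - 1)². -/
theorem sq_sub_one_le {v x : ℝ} (hv : 1 ≤ v) (hvx : v ≤ x) :
    (v - 1) ^ 2 ≤ 2 * (x + 1) * (v * Real.log v - v + 1) := by
  have h := two_mul_sub_one_div_le_log hv
  rw [div_le_iff₀ (by linarith)] at h
  have h0 : 0 ≤ v * Real.log v - v + 1 := by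
    have : (v + 1) * (v * Real.log v - v + 1) ≥ (v - 1) ^ 2 := by nlinarith
    by_contra hc
    push Not at hc
    nlinarith [sq_nonneg (v - 1)]
  have h1 : (v - 1) ^ 2 ≤ (v + 1) * (v * Real.log v - v + 1) := by nlinarith
  nlinarith

theorem log_chord {v x : ℝ} (hv : 1 ≤ v) (hvx : v ≤ x) :
    (v - 1) * Real.log x ≤ (x - 1) * Real.log v := by
  rcases eq_or_lt_of_le (hv.trans hvx) with hx | hx
  · have : v = 1 := le_antisymm (hvx.trans hx.symm.le) hv
    rw [this, ← hx]
  have hc := strictConcaveOn_log_Ioi.concaveOn.2 (Set.mem_Ioi.2 one_pos)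
    (Set.mem_Ioi.2 (show 0 < x by linarith))
    (show 0 ≤ (x - v) / (x - 1) from div_nonneg (by linarith) (by linarith))
    (show 0 ≤ (v - 1) / (x - 1) from div_nonneg (by linarith) (by linarith))
    (by field_simp [sub_ne_zero.2 hx.ne']; ring)
  have hx1 : x - 1 ≠ 0 := sub_ne_zero.2 hx.ne'
  have e : (x - v) / (x - 1) * 1 + (v - 1) / (x - 1) * x = v := by field_simp; ring
  simp only [smul_eq_mul, Real.log_one, mul_zero, zero_add, e] at hc
  rw [div_mul_eq_mul_div, div_le_iff₀ (by linarith)] at hc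
  linarith

/-- The difference of the two sides vanishes at v = 1. Its derivative is nonnegative on [1, x]
because the concave logarithm lies above its chord. -/
theorem sq_sub_one_mul_log_le {v x : ℝ} (hv : 1 ≤ v) (hvx : v ≤ x) :
    (v - 1) ^ 2 * Real.log x ≤ 2 * (x + 1) * (v * Real.log v - v + 1) := by
  set φ : ℝ → ℝ := fun v => 2 * (x + 1) * (v * Real.log v - v + 1) - (v - 1) ^ 2 * Real.log x
  have hd : ∀ w ∈ Set.Icc 1 x, HasDerivAt φ
      (2 * (x + 1) * (Real.log w) - 2 * (w - 1) * Real.log x) w := by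
    intro w hw
    have hw0 : w ≠ 0 := by linarith [hw.1]
    have h1 := ((Real.hasDerivAt_mul_log hw0).sub (hasDerivAt_id w)).add_const 1
    have h2 := (((hasDerivAt_id w).sub_const 1).pow 2).mul_const (Real.log x)
    convert! (h1.const_mul (2 * (x + 1))).sub h2 using 1
    simp
  have hmono : MonotoneOn φ (Set.Icc 1 x) := by
    refine monotoneOn_of_deriv_nonneg (convex_Icc 1 x)
      (fun w hw => (hd w hw).continuousAt.continuousWithinAt) ?_ ?_
    · intro w hw
      rw [interior_Icc] at hw
      exact (hd w ⟨hw.1.le, hw.2.le⟩).differentiableAt.differentiableWithinAt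
    · intro w hw
      rw [interior_Icc] at hw
      rw [(hd w ⟨hw.1.le, hw.2.le⟩).deriv]
      have h1 := log_chord hw.1.le hw.2.le
      have h2 := Real.log_nonneg hw.1.le
      nlinarith
  have h := hmono ⟨le_refl 1, hv.trans hvx⟩ ⟨hv, hvx⟩ hv
  simp only [φ] at h
  simp at h
  linarith

/-- The error of a BFGS direction is controlled by the decrease of the potential. -/
theorem direction_error_le {p q x : ℝ} (hq : 0 < q) (hpq : 1 ≤ p * q) (hqx : q ≤ x)
    (hx : 1 ≤ x) :
    p - 2 + q ≤ 2 * (x + 1) * (p - 1 + Real.log q) ∧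
    Real.log x * (p - 2 + q) ≤ 2 * (x + 1) * (p - 1 + Real.log q) := by
  have hp : 1 / q ≤ p := by rwa [div_le_iff₀ hq]
  have hlx : Real.log x ≤ x - 1 := Real.log_le_sub_one_of_pos (by linarith)
  have hlx0 := Real.log_nonneg hx
  -- An excess of p over 1/q enters both sides with a harmless sign, so p = 1/q is the critical
  -- case. For q ≤ 1 the factor 2 suffices; for q ≥ 1 the two quantities are (q - 1)²/q and (q ln q
  -- - q + 1)/q.
  rcases le_total q 1 with h1 | h1
  · have h2 := neg_two_log_le hq h1
    have h3 : p - 2 + q ≤ 2 * (p - 1 + Real.log q) := by linarith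
    have h4 : 0 ≤ p - 2 + q := by
      have : 2 ≤ 1 / q + q := by
        rw [div_add' _ _ _ hq.ne', le_div_iff₀ hq]
        nlinarith [sq_nonneg (q - 1)]
      linarith
    constructor <;> nlinarith
  · have e1 : p - 2 + q = (p - 1 / q) + (q - 1) ^ 2 / q := by field_simp; ring
    have e2 : p - 1 + Real.log q = (p - 1 / q) + (q * Real.log q - q + 1) / q := by
      field_simp; ring
    have h2 : (q - 1) ^ 2 / q ≤ 2 * (x + 1) * ((q * Real.log q - q + 1) / q) := by
      rw [← mul_div_assoc]
      exact div_le_div_of_nonneg_right (sq_sub_one_le h1 hqx) hq.le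
    have h3 : (q - 1) ^ 2 / q * Real.log x ≤ 2 * (x + 1) * ((q * Real.log q - q + 1) / q) := by
      rw [← mul_div_assoc, div_mul_eq_mul_div]
      exact div_le_div_of_nonneg_right (sq_sub_one_mul_log_le h1 hqx) hq.le
    rw [e1, e2]
    have h4 : 0 ≤ p - 1 / q := by linarith
    constructor <;> nlinarith

/-! ### BFGS sequences with nearly exact Hessians -/

section sequence

variable {n : ℕ}

theorem PosPair.unique {H B B' : E n →L[ℝ] E n} (h : PosPair H B) (h' : PosPair H B') : B = B' := by
  ext1 v
  rw [← h.right (B' v), h'.left]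

theorem one_add_sq_le_exp {t : ℝ} (ht : 0 ≤ t) : (1 + t) ^ 2 ≤ Real.exp (2 * t) := by
  have := Real.add_one_le_exp t
  rw [two_mul, Real.exp_add, ← sq]
  exact pow_le_pow_left₀ (by linarith) (by linarith) 2

/-- A single update spoils each bound by a factor (1 + η_i)² ≤ exp(2η_i), and a zero step changes
nothing. -/
theorem bfgs_seq_bounds {H J : ℕ → E n →L[ℝ] E n} {s : ℕ → E n} {η : ℕ → ℝ} {κ : ℝ} (hκ : 1 ≤ κ)
    {B₀ : E n →L[ℝ] E n} (h0 : PosPair (H 0) B₀)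
    (hlo : ∀ v, 1 / κ * ‖v‖ ^ 2 ≤ ⟪H 0 v, v⟫_ℝ) (hup : ∀ v, ⟪H 0 v, v⟫_ℝ ≤ ‖v‖ ^ 2)
    (hη : ∀ i, 0 ≤ η i) (hJ : ∀ i, Near (1 + η i) (J i))
    (hstep : ∀ i, H (i + 1) = bfgsUpdate (H i) (s i) (J i (s i))) (i : ℕ) :
    (∃ B, PosPair (H i) B) ∧
    (∀ v, ⟪H i v, v⟫_ℝ ≤ Real.exp (2 * ∑ j ∈ Finset.range i, η j) * ‖v‖ ^ 2) ∧
    (∀ v, Real.exp (-(2 * ∑ j ∈ Finset.range i, η j)) / κ * ‖v‖ ^ 2 ≤ ⟪H i v, v⟫_ℝ) := by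
  induction i with
  | zero => exact ⟨⟨B₀, h0⟩, by simpa using hup, by simpa using hlo⟩
  | succ i ih =>
    obtain ⟨⟨B, hB⟩, hu, hl⟩ := ih
    set Λ := 2 * ∑ j ∈ Finset.range i, η j with hΛ
    have hΛ0 : 0 ≤ Λ := mul_nonneg two_pos.le (Finset.sum_nonneg fun j _ => hη j)
    rw [Finset.sum_range_succ, mul_add, ← hΛ]
    have hηi := hη i
    have ha := one_add_sq_le_exp (hη i)
    have ha1 : (1 : ℝ) ≤ (1 + η i) ^ 2 := by nlinarith
    have hκ0 : 0 < κ := by linarith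
    by_cases hs : s i = 0
    · rw [hstep, hs, bfgsUpdate_zero]
      refine ⟨⟨B, hB⟩, fun v => (hu v).trans ?_, fun v => le_trans ?_ (hl v)⟩
      · gcongr; linarith
      · gcongr; linarith
    · obtain ⟨h1, h2, h3⟩ := hB.bfgs_bounds (a := 1 + η i) (x := Real.exp Λ)
        (l := Real.exp (-Λ) / κ) (by linarith) (hJ i) (Real.one_le_exp hΛ0) (by positivity)
        (by rw [div_le_one hκ0]; exact le_trans (Real.exp_le_one_iff.2 (by linarith)) hκ) hu hl hs
      rw [hstep]
      refine ⟨⟨_, h1⟩, fun v => (h2 v).trans ?_, fun v => le_trans ?_ (h3 v)⟩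
      · rw [Real.exp_add]
        gcongr
      · rw [neg_add, Real.exp_add, Real.exp_neg (2 * η i), ← div_eq_mul_inv, div_right_comm]
        gcongr

/-- Decrease of `tr B - ln det B`. -/
theorem PosPair.potential_step {H B J : E n →L[ℝ] E n} (h : PosPair H B) {η : ℝ} (hη : 0 ≤ η)
    (hJ : Near (1 + η) J) {s : E n} (hs : s ≠ 0) :
    ‖B s‖ ^ 2 / ⟪B s, s⟫_ℝ - 1 + Real.log (‖s‖ ^ 2 / ⟪B s, s⟫_ℝ) - 2 * η ≤
      (tr B - Real.log (dt B)) -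
        (tr (bfgsDirect B s (J s)) - Real.log (dt (bfgsDirect B s (J s)))) := by
  obtain ⟨Ji, hJi⟩ := hJ.exists_pair (by linarith)
  have ht := hJi.pos s hs
  have hσ := h.pos s hs
  have hs0 : 0 < ‖s‖ := norm_pos_iff.2 hs
  rw [tr_bfgsDirect, h.log_dt_bfgsDirect ht]
  -- For J = I the estimate would hold without the term 2η. One η is lost here in the trace, the
  -- other below in the logarithm of the determinant.
  have h1 : ‖J s‖ ^ 2 / ⟪J s, s⟫_ℝ ≤ 1 + η := by
    rw [div_le_iff₀ ht]
    exact hJ.norm_sq_le (by linarith) s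
  have h2 : Real.log (‖s‖ ^ 2 / ⟪B s, s⟫_ℝ) - η ≤ Real.log (⟪J s, s⟫_ℝ / ⟪B s, s⟫_ℝ) := by
    have h3 : ‖s‖ ^ 2 / ⟪B s, s⟫_ℝ ≤ (1 + η) * (⟪J s, s⟫_ℝ / ⟪B s, s⟫_ℝ) := by
      rw [← mul_div_assoc]
      exact div_le_div_of_nonneg_right (hJ.lower s) hσ.le
    have h4 := Real.log_le_log (by positivity) h3
    rw [Real.log_mul (by positivity) (by positivity)] at h4
    have h5 := Real.log_le_sub_one_of_pos (show 0 < 1 + η by linarith)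
    linarith
  linarith

/-- Among `Q` BFGS directions one approximates `d` with a squared error of order `1 / Q`. -/
theorem exists_direction_error_le (hn : 1 ≤ n) {M κ : ℝ} (hM : 0 ≤ M) (hκ : 1 ≤ κ) {d : E n}
    {H J : ℕ → E n →L[ℝ] E n} {ζ : ℕ → ℝ} (hζ : ∀ i, 0 < ζ i)
    {B₀ : E n →L[ℝ] E n} (h0 : PosPair (H 0) B₀)
    (hlo : ∀ v, 1 / κ * ‖v‖ ^ 2 ≤ ⟪H 0 v, v⟫_ℝ) (hup : ∀ v, ⟪H 0 v, v⟫_ℝ ≤ ‖v‖ ^ 2)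
    (hJ : ∀ i, Near (1 + M * ‖ζ i • H i d‖ / 2) (J i))
    (hstep : ∀ i, H (i + 1) = bfgsUpdate (H i) (ζ i • H i d) (J i (ζ i • H i d)))
    {Q : ℕ} (hQ : 1 ≤ Q) {ξ : ℝ}
    (hξ : ξ = Real.exp (M * ∑ i ∈ Finset.range Q, ‖ζ i • H i d‖)) :
    ∃ i < Q, Q * ‖H i d - d‖ ^ 2 ≤ 2 * n * κ * (ξ ^ 2 + ξ) * ‖d‖ ^ 2 := by
  have hκ0 : 0 < κ := by linarith
  by_cases hd : d = 0
  · exact ⟨0, hQ, by simp [hd]⟩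
  set s : ℕ → E n := fun i => ζ i • H i d with hsdef
  set η : ℕ → ℝ := fun i => M * ‖s i‖ / 2 with hηdef
  have hη : ∀ i, 0 ≤ η i := fun i => by positivity
  have hb := bfgs_seq_bounds hκ h0 hlo hup hη hJ hstep
  choose B hB using fun i => (hb i).1
  have hHd : ∀ i, H i d ≠ 0 := fun i h => hd (by rw [← (hB i).right d, h, map_zero])
  have hs : ∀ i, s i ≠ 0 := fun i => smul_ne_zero (hζ i).ne' (hHd i)
  -- Every update therefore tests the matrix on the same vector d, and p_i - 2 + q_i is the squared
  -- error of H_i d relative to ⟨H_i d, d⟩; the stepsize cancels.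
  have hBs : ∀ i, B i (s i) = ζ i • d := fun i => by
    rw [hsdef]; simp only; rw [map_smul, (hB i).right]
  have hBstep : ∀ i, B (i + 1) = bfgsDirect (B i) (s i) (J i (s i)) := fun i => by
    obtain ⟨Ji, hJi⟩ := (hJ i).exists_pair (by have := hη i; simp only [hηdef, hsdef] at this; linarith)
    have h1 := (hB i).bfgs (hJi.pos _ (hs i))
    rw [← hstep] at h1
    exact (hB (i + 1)).unique h1
  set V : ℕ → ℝ := fun i => tr (B i) - Real.log (dt (B i)) with hV
  set p : ℕ → ℝ := fun i => ‖B i (s i)‖ ^ 2 / ⟪B i (s i), s i⟫_ℝ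
  set q : ℕ → ℝ := fun i => ‖s i‖ ^ 2 / ⟪B i (s i), s i⟫_ℝ
  have hVstep : ∀ i, p i - 1 + Real.log (q i) - 2 * η i ≤ V i - V (i + 1) := fun i => by
    have := (hB i).potential_step (hη i) (hJ i) (hs i)
    simp only [hV, hBstep]
    exact this
  have hσ : ∀ i, 0 < ⟪B i (s i), s i⟫_ℝ := fun i => (hB i).pos _ (hs i)
  have hsn : ∀ i, 0 < ‖s i‖ := fun i => norm_pos_iff.2 (hs i)
  have hsumη : ∀ i, 2 * ∑ j ∈ Finset.range i, η j = M * ∑ j ∈ Finset.range i, ‖s j‖ := fun i => by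
    rw [Finset.mul_sum, Finset.mul_sum]
    refine Finset.sum_congr rfl fun j _ => ?_
    simp only [hηdef]; ring
  have hlogξ : Real.log ξ = M * ∑ i ∈ Finset.range Q, ‖s i‖ := by rw [hξ, Real.log_exp]
  have hξ1 : 1 ≤ ξ := by
    rw [hξ]
    exact Real.one_le_exp (mul_nonneg hM (Finset.sum_nonneg fun j _ => norm_nonneg _))
  have hξi : ∀ i < Q, Real.exp (2 * ∑ j ∈ Finset.range i, η j) ≤ ξ := fun i hi => by
    rw [hξ, hsumη]
    refine Real.exp_le_exp.2 (mul_le_mul_of_nonneg_left ?_ hM)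
    exact Finset.sum_le_sum_of_subset_of_nonneg (Finset.range_mono hi.le)
      fun j _ _ => norm_nonneg _
  have hqx : ∀ i < Q, q i ≤ ξ := fun i hi => by
    rw [div_le_iff₀ (hσ i)]
    have h1 := PosPair.refl_id.inv_le (hB i).swap (by simpa using (hb i).2.1) (s i)
    simp only [ContinuousLinearMap.id_apply, real_inner_self_eq_norm_sq] at h1
    exact h1.trans (mul_le_mul_of_nonneg_right (hξi i hi) (hσ i).le)
  have hq0 : ∀ i, 0 < q i := fun i => div_pos (pow_pos (hsn i) 2) (hσ i)
  have hpq : ∀ i, 1 ≤ p i * q i := fun i => by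
    have h1 := real_inner_le_norm (B i (s i)) (s i)
    have h2 := hσ i
    simp only [p, q]
    rw [div_mul_div_comm, one_le_div (by positivity)]
    nlinarith
  -- total decrease of the potential
  have hV0 : V 0 ≤ n * κ := by
    have h1 : tr (B 0) ≤ n * κ := tr_le fun v => by
      have := (hB 0).swap.inv_le PosPair.refl_id (c := κ) (fun w => by
        have := hlo w
        rw [div_mul_eq_mul_div, one_mul, div_le_iff₀ hκ0] at this
        simp only [ContinuousLinearMap.id_apply, real_inner_self_eq_norm_sq]
        linarith) v
      simpa using this
    have h2 : 1 ≤ dt (B 0) := by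
      have := pow_le_dt (hB 0).symm (c := 1) zero_le_one fun v => by
        have := PosPair.refl_id.inv_le (hB 0).swap (c := 1) (by simpa using hup) v
        simpa using this
      simpa using this
    have h3 := Real.log_nonneg h2
    simp only [hV]
    linarith
  have hVQ : (n : ℝ) ≤ V Q := by
    have := (hB Q).log_dt_le
    simp only [hV]
    linarith
  have hsum : ∑ i ∈ Finset.range Q, (p i - 1 + Real.log (q i)) ≤ n * (κ - 1) + Real.log ξ := by
    have h1 : ∑ i ∈ Finset.range Q, (p i - 1 + Real.log (q i)) ≤
        ∑ i ∈ Finset.range Q, ((V i - V (i + 1)) + 2 * η i) :=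
      Finset.sum_le_sum fun i _ => by linarith [hVstep i]
    rw [Finset.sum_add_distrib (f := fun i => V i - V (i + 1)), Finset.sum_range_sub',
      ← Finset.mul_sum, hsumη, ← hlogξ] at h1
    linarith
  -- total error
  have hn1 : (1 : ℝ) ≤ n := by exact_mod_cast hn
  have hE : ∑ i ∈ Finset.range Q, (p i - 2 + q i) ≤ 2 * n * κ * (ξ + 1) := by
    have hA : ∑ i ∈ Finset.range Q, (p i - 2 + q i) ≤ 2 * (ξ + 1) * (n * (κ - 1) + Real.log ξ) := by
      refine le_trans ?_ (mul_le_mul_of_nonneg_left hsum (by linarith))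
      rw [Finset.mul_sum]
      exact Finset.sum_le_sum fun i hi =>
        (direction_error_le (hq0 i) (hpq i) (hqx i (Finset.mem_range.1 hi)) hξ1).1
    have hB' : Real.log ξ * ∑ i ∈ Finset.range Q, (p i - 2 + q i) ≤
        2 * (ξ + 1) * (n * (κ - 1) + Real.log ξ) := by
      refine le_trans ?_ (mul_le_mul_of_nonneg_left hsum (by linarith))
      rw [Finset.mul_sum, Finset.mul_sum]
      exact Finset.sum_le_sum fun i hi =>
        (direction_error_le (hq0 i) (hpq i) (hqx i (Finset.mem_range.1 hi)) hξ1).2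
    have hnk : 0 ≤ n * (κ - 1) := mul_nonneg (by linarith) (by linarith)
    -- The decrease available is n(κ - 1) + ln ξ. If ln ξ ≤ 1, this is at most nκ. Otherwise it is
    -- at most nκ ln ξ, and the factor ln ξ cancels against the weighted version of the inequality.
    rcases le_total (Real.log ξ) 1 with hl | hl
    · refine hA.trans ?_
      have : n * (κ - 1) + Real.log ξ ≤ n * κ := by nlinarith
      nlinarith
    · have hl0 : 0 < Real.log ξ := by linarith
      refine le_of_mul_le_mul_left (hB'.trans ?_) hl0
      have : n * (κ - 1) + Real.log ξ ≤ Real.log ξ * (n * κ) := by nlinarith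
      nlinarith
  have herr : ∀ i < Q, ‖H i d - d‖ ^ 2 ≤ (p i - 2 + q i) * (ξ * ‖d‖ ^ 2) := fun i hi => by
    have e1 : p i - 2 + q i = ‖s i - B i (s i)‖ ^ 2 / ⟪B i (s i), s i⟫_ℝ := by
      rw [norm_sub_sq_real, real_inner_comm (B i (s i)) (s i)]
      have := (hσ i).ne'
      simp only [p, q]
      field_simp
      ring
    have e2 : s i - B i (s i) = ζ i • (H i d - d) := by rw [hBs, smul_sub]
    have e3 : ⟪B i (s i), s i⟫_ℝ = ζ i ^ 2 * ⟪H i d, d⟫_ℝ := by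
      rw [hBs]; simp only [hsdef]
      rw [inner_smul_left, inner_smul_right, real_inner_comm d (H i d)]
      simp only [RCLike.conj_to_real]
      ring
    have h1 : ⟪H i d, d⟫_ℝ ≤ ξ * ‖d‖ ^ 2 :=
      ((hb i).2.1 d).trans (mul_le_mul_of_nonneg_right (hξi i hi) (by positivity))
    have h2 := (hB i).swap.pos d hd
    have h3 := hζ i
    rw [e1, e2, e3, norm_smul, mul_pow, Real.norm_eq_abs, sq_abs,
      mul_div_mul_left _ _ (by positivity), div_mul_eq_mul_div, le_div_iff₀ h2]
    exact mul_le_mul_of_nonneg_left h1 (by positivity)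
  -- If all Q errors exceeded the bound, their sum would contradict `hE`; the factor ξ in ⟨H_i d, d⟩
  -- ≤ ξ‖d‖² turns ξ + 1 into ξ² + ξ.
  by_contra! hcon
  have hξd : 0 ≤ ξ * ‖d‖ ^ 2 := by positivity
  have hQ0 : (0 : ℝ) < Q := by exact_mod_cast hQ
  have h1 : ∑ i ∈ Finset.range Q, 2 * n * κ * (ξ ^ 2 + ξ) * ‖d‖ ^ 2 <
      ∑ i ∈ Finset.range Q, Q * ((p i - 2 + q i) * (ξ * ‖d‖ ^ 2)) := by
    refine Finset.sum_lt_sum_of_nonempty (Finset.nonempty_range_iff.2 (by omega)) fun i hi => ?_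
    have hi' := Finset.mem_range.1 hi
    exact (hcon i hi').trans_le (mul_le_mul_of_nonneg_left (herr i hi') hQ0.le)
  rw [Finset.sum_const, Finset.card_range, nsmul_eq_mul, ← Finset.mul_sum, ← Finset.sum_mul] at h1
  have h2 := lt_of_mul_lt_mul_left h1 hQ0.le
  have h3 := mul_le_mul_of_nonneg_right hE hξd
  nlinarith

end sequence

/-! ### Scalar inequalities for the exponential -/

/-- With 1/2 in place of 1/3 this fails for negative x. At x = -1 it reads 1/3 ≤ 1/e, and on [-1, 0]
the Taylor polynomial of degree four with its remainder is precise enough. -/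
theorem one_third_sq_le_exp {x : ℝ} (hx : -1 ≤ x) : 1 + x + x ^ 2 / 3 ≤ Real.exp x := by
  rcases le_total 0 x with h | h
  · have := Real.quadratic_le_exp_of_nonneg h
    nlinarith [sq_nonneg x]
  · have h1 := Real.exp_bound (x := x) (abs_le.2 ⟨hx, by linarith⟩) (n := 5) (by norm_num)
    rw [abs_of_nonpos h, abs_le] at h1
    norm_num [Finset.sum_range_succ, Nat.factorial] at h1
    have h2 : 0 ≤ x ^ 2 * (1 + x) := mul_nonneg (sq_nonneg x) (by linarith)
    have h3 : 0 ≤ x ^ 4 * (1 + x) := mul_nonneg (by positivity) (by linarith)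
    have h4 : 0 ≤ x ^ 4 := by positivity
    nlinarith [h1.1]

/-- Writing exp(p - 1) = exp(q - 1) exp(p - q), the second factor is bounded below linearly, with
coefficient exp(q - 1) ≥ 1/3, and the first by `one_third_sq_le_exp`. Both give 1/3, hence the
factor 3. -/
theorem qn_ratio_le {p q : ℝ} (hq : 0 < q) (hpq : q ≤ p) :
    p - q + (1 - q) ^ 2 ≤ 3 * (Real.exp (p - 1) - q) := by
  have h1 := one_third_sq_le_exp (x := q - 1) (by linarith)
  have h2 := Real.add_one_le_exp (p - q)
  have h3 : Real.exp (p - 1) = Real.exp (q - 1) * Real.exp (p - q) := by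
    rw [← Real.exp_add]; ring_nf
  have h4 : 1 / 3 ≤ Real.exp (q - 1) := by nlinarith
  rw [h3]
  have h5 : Real.exp (q - 1) * (1 + (p - q)) ≤ Real.exp (q - 1) * Real.exp (p - q) :=
    mul_le_mul_of_nonneg_left (by linarith) (Real.exp_pos _).le
  nlinarith

theorem prod_le_mean_pow {T : ℕ} (hT : 1 ≤ T) {D : ℕ → ℝ} (hD : ∀ i, 0 ≤ D i) :
    ∏ i ∈ Finset.range T, D i ≤ ((∑ i ∈ Finset.range T, D i) / T) ^ T := by
  have hT0 : (0 : ℝ) < T := by exact_mod_cast hT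
  have h := Real.geom_mean_le_arith_mean (Finset.range T) (fun _ => 1) D (fun _ _ => zero_le_one)
    (by simpa using hT0) (fun i _ => hD i)
  simp only [Real.rpow_one, Finset.sum_const, Finset.card_range, nsmul_eq_mul, mul_one,
    one_mul] at h
  have hp : 0 ≤ ∏ i ∈ Finset.range T, D i := Finset.prod_nonneg fun i _ => hD i
  calc ∏ i ∈ Finset.range T, D i = ((∏ i ∈ Finset.range T, D i) ^ ((T : ℝ)⁻¹)) ^ T := by
        rw [← Real.rpow_natCast, ← Real.rpow_mul hp, inv_mul_cancel₀ hT0.ne', Real.rpow_one]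
    _ ≤ _ := pow_le_pow_left₀ (Real.rpow_nonneg hp _) h T

/-- Since exp D - 1 ≤ D exp D, the exponentials multiply to at most exp S and the factors D_i are
handled by the arithmetic-geometric mean inequality. -/
theorem prod_exp_sub_one_le {T : ℕ} (hT : 1 ≤ T) {D : ℕ → ℝ} (hD : ∀ i, 0 ≤ D i) {S : ℝ}
    (hS : ∑ i ∈ Finset.range T, D i ≤ S) :
    ∏ i ∈ Finset.range T, (3 * (Real.exp (D i) - 1)) ≤
      (3 * Real.exp (S / T) * (S / T)) ^ T := by
  have hT0 : (0 : ℝ) < T := by exact_mod_cast hT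
  have hs0 : 0 ≤ ∑ i ∈ Finset.range T, D i := Finset.sum_nonneg fun i _ => hD i
  have h1 : ∀ i, Real.exp (D i) - 1 ≤ Real.exp (D i) * D i := fun i => by
    have h2 := Real.add_one_le_exp (-D i)
    have h3 : Real.exp (D i) * Real.exp (-D i) = 1 := by rw [← Real.exp_add]; simp
    have h4 := Real.exp_pos (D i)
    nlinarith
  have h0 : ∀ i, 0 ≤ Real.exp (D i) - 1 := fun i => by
    linarith [Real.one_le_exp (hD i)]
  calc ∏ i ∈ Finset.range T, (3 * (Real.exp (D i) - 1))
      ≤ ∏ i ∈ Finset.range T, (3 * Real.exp (D i) * D i) :=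
        Finset.prod_le_prod (fun i _ => by linarith [h0 i]) fun i _ => by linarith [h1 i]
    _ = 3 ^ T * Real.exp (∑ i ∈ Finset.range T, D i) * ∏ i ∈ Finset.range T, D i := by
        rw [Finset.prod_mul_distrib, Finset.prod_mul_distrib, Real.exp_sum]; simp
    _ ≤ 3 ^ T * Real.exp S * (S / T) ^ T := by
        gcongr
        · exact Finset.prod_nonneg fun i _ => hD i
        · exact (prod_le_mean_pow hT hD).trans (by gcongr)
    _ = _ := by
        rw [mul_pow, mul_pow, ← Real.exp_nat_mul, mul_div_cancel₀ _ hT0.ne']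

/-! ### One quasi-Newton step -/

section step

variable {n : ℕ} {H B J : E n →L[ℝ] E n} {s g : E n}

theorem bfgsUpdate_inner_self (H : E n →L[ℝ] E n) (s g v : E n) :
    ⟪bfgsUpdate H s g v, v⟫_ℝ =
      ⟪H (v - (1 / ⟪g, s⟫_ℝ * ⟪s, v⟫_ℝ) • g), v - (1 / ⟪g, s⟫_ℝ * ⟪s, v⟫_ℝ) • g⟫_ℝ +
        ⟪s, v⟫_ℝ ^ 2 / ⟪g, s⟫_ℝ := by
  set w := v - (1 / ⟪g, s⟫_ℝ * ⟪s, v⟫_ℝ) • g with hw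
  rw [bfgsUpdate_apply, ← hw, inner_add_left, inner_sub_left, inner_smul_left, inner_smul_left]
  simp only [RCLike.conj_to_real]
  have : ⟪H w, w⟫_ℝ = ⟪H w, v⟫_ℝ - 1 / ⟪g, s⟫_ℝ * ⟪s, v⟫_ℝ * ⟪g, H w⟫_ℝ := by
    nth_rw 2 [hw]
    rw [inner_sub_right, inner_smul_right, real_inner_comm g (H w)]
  rw [this]
  ring

/-- Contraction of a quasi-Newton step with `l ≤ H ≤ x`. -/
theorem PosPair.qn_contraction (h : PosPair H B) {b x l : ℝ} (hb : 1 ≤ b) (hJ : Near b J)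
    (hx : 1 ≤ x) (hl : 0 ≤ l) (hup : ∀ v, ⟪H v, v⟫_ℝ ≤ x * ‖v‖ ^ 2)
    (hlo : ∀ v, l * ‖v‖ ^ 2 ≤ ⟪H v, v⟫_ℝ) (z : E n) :
    ‖z - H (J z)‖ ≤ b * max (x * b - 1) (1 - l / b) * ‖z‖ := by
  have hb0 : 0 < b := by linarith
  obtain ⟨P, hP⟩ := hJ.exists_pair hb0
  set c := max (x * b - 1) (1 - l / b)
  have hc : 0 ≤ c := le_max_of_le_left (by nlinarith)
  have hX : ∀ v w, ⟪(P - H) v, w⟫_ℝ = ⟪v, (P - H) w⟫_ℝ := fun v w => by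
    simp [inner_sub_left, inner_sub_right, hP.symm_inv, h.symm_inv]
  have hle : ∀ v, |⟪(P - H) v, v⟫_ℝ| ≤ c * ⟪P v, v⟫_ℝ := fun v => by
    have h1 : ⟪P v, v⟫_ℝ ≤ b * ‖v‖ ^ 2 := by
      simpa using hP.inv_le PosPair.refl_id (c := b) (by simpa using hJ.lower) v
    have h2 : ‖v‖ ^ 2 ≤ b * ⟪P v, v⟫_ℝ := by
      simpa using PosPair.refl_id.inv_le hP (c := b) (by simpa using hJ.upper) v
    have h3 := hup v
    have h4 := hlo v
    have h5 := hP.swap.nonneg v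
    have h6 : l / b * ⟪P v, v⟫_ℝ ≤ l * ‖v‖ ^ 2 := by
      rw [div_mul_eq_mul_div, div_le_iff₀ hb0]; nlinarith
    have h7 : (x * b - 1) * ⟪P v, v⟫_ℝ ≤ c * ⟪P v, v⟫_ℝ :=
      mul_le_mul_of_nonneg_right (le_max_left _ _) h5
    have h8 : (1 - l / b) * ⟪P v, v⟫_ℝ ≤ c * ⟪P v, v⟫_ℝ :=
      mul_le_mul_of_nonneg_right (le_max_right _ _) h5
    rw [sub_apply, inner_sub_left, abs_le]
    constructor <;> nlinarith
  -- With P = J⁻¹ the new error is (P - H)Jz, so |P - H| ≤ cP as forms contracts the J-norm by c.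
  -- Passing to the J-norm and back costs the factor b.
  set z' := z - H (J z) with hz'
  have h1 := symm_form_bound hP.swap hX hle (J z) (J z')
  have e1 : (P - H) (J z) = z' := by rw [sub_apply, hP.left]
  rw [e1, hP.left, hP.left, real_inner_comm (J z) z, real_inner_comm (J z') z'] at h1
  have h2 := hJ.lower z'
  have h3 := hJ.upper z
  have h4 := hP.nonneg z'
  have h5 : ⟪J z', z'⟫_ℝ ≤ c ^ 2 * ⟪J z, z⟫_ℝ := by
    rcases eq_or_lt_of_le h4 with h0 | h0
    · rw [← h0]; exact mul_nonneg (sq_nonneg c) (hP.nonneg z)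
    · have : ⟪J z', z'⟫_ℝ * ⟪J z', z'⟫_ℝ ≤ (c ^ 2 * ⟪J z, z⟫_ℝ) * ⟪J z', z'⟫_ℝ := by nlinarith
      exact le_of_mul_le_mul_right this h0
  have h6 : ‖z'‖ ^ 2 ≤ (b * c * ‖z‖) ^ 2 := by
    calc ‖z'‖ ^ 2 ≤ b * (c ^ 2 * (b * ‖z‖ ^ 2)) := by
          refine h2.trans (mul_le_mul_of_nonneg_left (h5.trans ?_) hb0.le)
          exact mul_le_mul_of_nonneg_left h3 (sq_nonneg c)
      _ = _ := by ring
  exact (abs_le_of_sq_le_sq' h6 (by positivity)).2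

/-- Decrease of `tr H - ln det H`. -/
theorem PosPair.inverse_potential_step (h : PosPair H B) {η x : ℝ} (hη : 0 ≤ η)
    (hJ : Near (1 + η) J) (hx : 0 ≤ x) (hup : ∀ v, ⟪H v, v⟫_ℝ ≤ x * ‖v‖ ^ 2) (hs : s ≠ 0) :
    ⟪J s, H (J s)⟫_ℝ / ⟪J s, s⟫_ℝ - 1 - Real.log (⟪J s, s⟫_ℝ / ⟪B s, s⟫_ℝ) ≤
      (tr H - Real.log (dt H)) -
        (tr (bfgsUpdate H s (J s)) - Real.log (dt (bfgsUpdate H s (J s)))) +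
      (3 * x * (1 + η) + 1) * η := by
  obtain ⟨Ji, hJi⟩ := hJ.exists_pair (by linarith)
  have ht := hJi.pos s hs
  rw [(h.bfgs ht).log_dt_inv, h.log_dt_inv, h.log_dt_bfgsDirect ht, h.tr_bfgsUpdate]
  set g := J s with hg
  set t := ⟪g, s⟫_ℝ with htd
  have hs0 : 0 < ‖s‖ := norm_pos_iff.2 hs
  set p := ⟪g, H g⟫_ℝ / t with hp
  set r := ‖s‖ ^ 2 / t with hr
  have hg2 : ‖g‖ ^ 2 ≤ (1 + η) * t := hJ.norm_sq_le (by linarith) s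
  have hs2 : ‖s‖ ^ 2 ≤ (1 + η) * t := hJ.lower s
  have hr1 : r ≤ 1 + η := by rw [hr, div_le_iff₀ ht]; exact hs2
  have hp0 : 0 ≤ p := div_nonneg (by rw [real_inner_comm]; exact h.swap.nonneg g) ht.le
  have hp1 : p ≤ x * (1 + η) := by
    rw [hp, div_le_iff₀ ht, real_inner_comm]
    have := hup g
    nlinarith
  have hnorm : ∀ v, ‖H v‖ ≤ x * ‖v‖ := norm_le_of_symm_form_bound h.symm_inv hx fun v => by
    rw [abs_of_nonneg (h.swap.nonneg v)]; exact hup v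
  have hgs : ‖g‖ * ‖s‖ ≤ (1 + η) * t := by nlinarith [sq_nonneg (‖g‖ - ‖s‖)]
  have hc : ⟪g, H s⟫_ℝ / t ≥ p - x * (1 + η) * η := by
    have e1 : ⟪g, H s⟫_ℝ = ⟪g, H g⟫_ℝ + ⟪g, H (s - g)⟫_ℝ := by rw [map_sub, inner_sub_right]; ring
    have h1 := (abs_le.1 (abs_real_inner_le_norm g (H (s - g)))).1
    have h2 := hnorm (s - g)
    have h3 : ‖s - g‖ ≤ η * ‖s‖ := hJ.norm_sub_le hη s
    have h4 : ‖g‖ * ‖H (s - g)‖ ≤ x * ((1 + η) * t) * η := by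
      calc ‖g‖ * ‖H (s - g)‖ ≤ ‖g‖ * (x * (η * ‖s‖)) := by gcongr; exact h2.trans (by gcongr)
        _ = x * (‖g‖ * ‖s‖) * η := by ring
        _ ≤ _ := by gcongr
    have h5 : ⟪g, H (s - g)⟫_ℝ / t ≥ -(x * (1 + η) * η) := by
      rw [ge_iff_le, le_div_iff₀ ht]
      nlinarith
    rw [e1, add_div]
    linarith
  have e1 : ⟪g, H g⟫_ℝ * ‖s‖ ^ 2 / t ^ 2 = p * r := by rw [hp, hr]; field_simp
  have e2 : 2 * ⟪g, H s⟫_ℝ / t = 2 * (⟪g, H s⟫_ℝ / t) := by ring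
  rw [e1, e2]
  have h6 : p * r ≤ p + x * (1 + η) * η := by nlinarith
  -- Replacing ⟨g, Hs⟩/t by p costs x(1 + η)η twice, pr ≤ p + x(1 + η)η costs it once more, and r ≤
  -- 1 + η adds η; this is the stated error term.
  nlinarith

/-- The size of the gradient in the metric of `H` after a quasi-Newton step. -/
theorem PosPair.gradient_step (h : PosPair H B) (hgs : 0 < ⟪g, s⟫_ℝ) :
    0 ≤ ⟪g, H g⟫_ℝ / ⟪g, s⟫_ℝ - 1 - Real.log (⟪g, s⟫_ℝ / ⟪B s, s⟫_ℝ) ∧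
    ⟪bfgsUpdate H s g (g - B s), g - B s⟫_ℝ ≤
      3 * (Real.exp (⟪g, H g⟫_ℝ / ⟪g, s⟫_ℝ - 1 - Real.log (⟪g, s⟫_ℝ / ⟪B s, s⟫_ℝ)) - 1) *
        ⟪B s, s⟫_ℝ := by
  have hs := ne_zero_of_inner_pos hgs
  have hσ := h.pos s hs
  rw [bfgsUpdate_inner_self]
  set t := ⟪g, s⟫_ℝ with ht
  set σ := ⟪B s, s⟫_ℝ with hσd
  set G := ⟪g, H g⟫_ℝ with hG
  have f1 : ⟪s, g⟫_ℝ = t := by rw [real_inner_comm]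
  have f2 : ⟪s, B s⟫_ℝ = σ := by rw [real_inner_comm]
  have f3 : ⟪H g, g⟫_ℝ = G := by rw [real_inner_comm]
  have f4 : ⟪H g, B s⟫_ℝ = t := by rw [h.symm_inv, h.left]
  have hpq : t / σ ≤ G / t := by
    have := h.cauchy_dual g s
    rw [f3] at this
    rw [div_le_div_iff₀ hσ hgs]
    linarith
  have hq : 0 < t / σ := by positivity
  constructor
  · have := Real.log_le_sub_one_of_pos hq
    linarith
  -- With p = G/t and q = t/σ the new form value is σ(p - q + (1 - q)²)/q, to which `qn_ratio_le`
  -- applies.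
  · have e1 : ⟪H (g - B s - (1 / t * ⟪s, g - B s⟫_ℝ) • g),
        g - B s - (1 / t * ⟪s, g - B s⟫_ℝ) • g⟫_ℝ + ⟪s, g - B s⟫_ℝ ^ 2 / t =
        (G / t - t / σ + (1 - t / σ) ^ 2) / (t / σ) * σ := by
      simp only [inner_sub_right, inner_sub_left, inner_smul_right, inner_smul_left, map_sub,
        map_smul, h.left, f1, f2, f3, f4, RCLike.conj_to_real]
      field_simp
      ring
    rw [e1]
    refine mul_le_mul_of_nonneg_right ?_ hσ.le
    rw [Real.exp_sub, Real.exp_log hq, div_le_iff₀ hq]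
    refine (qn_ratio_le hq hpq).trans (le_of_eq ?_)
    field_simp

end step

/-! ### Quasi-Newton sequences -/

/-- BFGS iterates `z` with unit steps and gradients `γ`, in coordinates in which the Hessian at the
solution `0` is the identity. -/
structure QNSeq {n : ℕ} (M κ : ℝ) (z γ : ℕ → E n) (H : ℕ → E n →L[ℝ] E n) : Prop where
  M_nonneg : 0 ≤ M
  one_le : 1 ≤ κ
  pair : ∃ B, PosPair (H 0) B
  lower : ∀ v, 1 / κ * ‖v‖ ^ 2 ≤ ⟪H 0 v, v⟫_ℝ
  upper : ∀ v, ⟪H 0 v, v⟫_ℝ ≤ ‖v‖ ^ 2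
  z_step : ∀ i, z (i + 1) = z i - H i (γ i)
  H_step : ∀ i, H (i + 1) = bfgsUpdate (H i) (z (i + 1) - z i) (γ (i + 1) - γ i)
  mean : ∀ i, ∃ J, Near (1 + M * ‖z i‖ / 2) J ∧ γ i = J (z i)
  secant : ∀ i, ∃ J, Near (1 + (M * ‖z i‖ + M * ‖z (i + 1)‖) / 2) J ∧
    γ (i + 1) - γ i = J (z (i + 1) - z i)

namespace QNSeq

variable {n : ℕ} {M κ : ℝ} {z γ : ℕ → E n} {H : ℕ → E n →L[ℝ] E n}

theorem bounds (h : QNSeq M κ z γ H) (i : ℕ) :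
    (∃ B, PosPair (H i) B) ∧
    (∀ v, ⟪H i v, v⟫_ℝ ≤
      Real.exp (∑ j ∈ Finset.range i, (M * ‖z j‖ + M * ‖z (j + 1)‖)) * ‖v‖ ^ 2) ∧
    (∀ v, Real.exp (-∑ j ∈ Finset.range i, (M * ‖z j‖ + M * ‖z (j + 1)‖)) / κ * ‖v‖ ^ 2 ≤
      ⟪H i v, v⟫_ℝ) := by
  obtain ⟨B₀, hB₀⟩ := h.pair
  choose J hJ hJs using h.secant
  have hM := h.M_nonneg
  have := bfgs_seq_bounds (s := fun i => z (i + 1) - z i)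
    (η := fun i => (M * ‖z i‖ + M * ‖z (i + 1)‖) / 2) h.one_le hB₀ h.lower h.upper
    (fun i => by positivity) hJ (fun i => by rw [h.H_step, hJs]) i
  rwa [← Finset.sum_div, mul_div_cancel₀ _ (two_ne_zero)] at this

theorem sum_nonneg (h : QNSeq M κ z γ H) (i : ℕ) :
    0 ≤ ∑ j ∈ Finset.range i, (M * ‖z j‖ + M * ‖z (j + 1)‖) :=
  Finset.sum_nonneg fun j _ => by have := h.M_nonneg; positivity

theorem contraction (h : QNSeq M κ z γ H) (i : ℕ) {x : ℝ}
    (hx : Real.exp (∑ j ∈ Finset.range i, (M * ‖z j‖ + M * ‖z (j + 1)‖)) ≤ x) :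
    M * ‖z (i + 1)‖ ≤ (1 + M * ‖z i‖ / 2) * max (x * (1 + M * ‖z i‖ / 2) - 1)
      (1 - 1 / (x * (1 + M * ‖z i‖ / 2) * κ)) * (M * ‖z i‖) := by
  obtain ⟨⟨B, hB⟩, hu, hl⟩ := h.bounds i
  obtain ⟨J, hJ, hγ⟩ := h.mean i
  have hM := h.M_nonneg
  have hκ : 0 < κ := by linarith [h.one_le]
  have hx1 := (Real.one_le_exp (h.sum_nonneg i)).trans hx
  have hσ : 0 ≤ M * ‖z i‖ := by positivity
  set σ := M * ‖z i‖
  have h1 := hB.qn_contraction (b := 1 + σ / 2) (x := x) (l := 1 / (x * κ))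
    (by linarith) hJ hx1 (by positivity)
    (fun v => (hu v).trans (mul_le_mul_of_nonneg_right hx (sq_nonneg _)))
    (fun v => le_trans (by
      refine mul_le_mul_of_nonneg_right ?_ (sq_nonneg _)
      rw [Real.exp_neg, inv_eq_one_div, div_div]
      gcongr) (hl v)) (z i)
  rw [h.z_step, hγ]
  have h2 := mul_le_mul_of_nonneg_left h1 hM
  rw [div_div, mul_right_comm x κ] at h2
  calc _ ≤ _ := h2
    _ = _ := by simp only [σ]; ring

/-- One number D bounds the gradient ratio and is itself paid for by the potential. A product of
ratios is thus governed by a telescoping sum. -/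
theorem step_estimate (h : QNSeq M κ z γ H) (i : ℕ) {x a : ℝ}
    (hx : Real.exp (∑ j ∈ Finset.range i, (M * ‖z j‖ + M * ‖z (j + 1)‖)) ≤ x)
    (ha : (M * ‖z i‖ + M * ‖z (i + 1)‖) / 2 ≤ a) :
    ∃ D, 0 ≤ D ∧ D ≤ (tr (H i) - Real.log (dt (H i))) -
        (tr (H (i + 1)) - Real.log (dt (H (i + 1)))) +
        (3 * x * (1 + a) + 1) * ((M * ‖z i‖ + M * ‖z (i + 1)‖) / 2) ∧
      ⟪H (i + 1) (γ (i + 1)), γ (i + 1)⟫_ℝ ≤ 3 * (Real.exp D - 1) * ⟪H i (γ i), γ i⟫_ℝ := by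
  obtain ⟨⟨B, hB⟩, hu, -⟩ := h.bounds i
  obtain ⟨J, hJ, hγ⟩ := h.secant i
  have hM := h.M_nonneg
  have hx1 := (Real.one_le_exp (h.sum_nonneg i)).trans hx
  have hη : 0 ≤ (M * ‖z i‖ + M * ‖z (i + 1)‖) / 2 := by positivity
  set η := (M * ‖z i‖ + M * ‖z (i + 1)‖) / 2
  have hs : z (i + 1) - z i = -H i (γ i) := by rw [h.z_step]; abel
  have hBs : B (z (i + 1) - z i) = -γ i := by rw [hs, map_neg, hB.right]
  have hgr : (3 * x * (1 + η) + 1) * η ≤ (3 * x * (1 + a) + 1) * η := by gcongr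
  -- A vanishing step means that the gradient is already zero; then H does not change and D = 0
  -- serves.
  by_cases hs0 : z (i + 1) - z i = 0
  · have hγ0 : γ i = 0 := by rw [← neg_eq_zero, ← hBs, hs0, map_zero]
    have hγ1 : γ (i + 1) = 0 := by rwa [hs0, map_zero, hγ0, sub_zero] at hγ
    have hH : H (i + 1) = H i := by rw [h.H_step, hs0, bfgsUpdate_zero]
    refine ⟨0, le_refl 0, ?_, by simp [hγ1, hγ0]⟩
    rw [hH, sub_self, zero_add]
    exact mul_nonneg (by nlinarith) hη
  · obtain ⟨Ji, hJi⟩ := hJ.exists_pair (by linarith)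
    have ht := hJi.pos _ hs0
    have h1 := hB.inverse_potential_step hη hJ (by linarith : 0 ≤ x)
      (fun v => (hu v).trans (mul_le_mul_of_nonneg_right hx (sq_nonneg _))) hs0
    obtain ⟨h2, h3⟩ := hB.gradient_step ht
    rw [← hγ, ← h.H_step] at h1
    rw [← hγ, ← h.H_step] at h3
    rw [← hγ] at h2
    refine ⟨_, h2, h1.trans (by linarith), ?_⟩
    have e1 : γ (i + 1) - γ i - B (z (i + 1) - z i) = γ (i + 1) := by rw [hBs]; abel
    have e2 : ⟪B (z (i + 1) - z i), z (i + 1) - z i⟫_ℝ = ⟪H i (γ i), γ i⟫_ℝ := by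
      rw [hBs, hs, inner_neg_neg, real_inner_comm]
    rw [e1] at h3
    rw [e2] at h3 ⊢
    exact h3

/-- Superlinear convergence, as long as the sum of the errors stays bounded. -/
theorem superlinear (h : QNSeq M κ z γ H) {T : ℕ} (hT : 1 ≤ T)
    (hΛ : ∑ j ∈ Finset.range T, (M * ‖z j‖ + M * ‖z (j + 1)‖) ≤ Real.log (3 / 2))
    (hl : Real.log (3 / 2) ≤ 0.4055) {S : ℝ} (hS : n * Real.log κ + 1.35 ≤ S) :
    ‖z T‖ ^ 2 ≤ (1 + M * ‖z T‖ / 2) ^ 2 * (1 + M * ‖z 0‖ / 2) ^ 2 * (3 / 2 * κ) *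
      (3 * Real.exp (S / T) * (S / T)) ^ T * ‖z 0‖ ^ 2 := by
  have hM := h.M_nonneg
  have hκ : 0 < κ := by linarith [h.one_le]
  set Λ : ℕ → ℝ := fun i => ∑ j ∈ Finset.range i, (M * ‖z j‖ + M * ‖z (j + 1)‖) with hΛd
  have hmono : ∀ i ≤ T, Λ i ≤ Real.log (3 / 2) := fun i hi => by
    refine le_trans ?_ hΛ
    exact Finset.sum_le_sum_of_subset_of_nonneg (Finset.range_mono hi)
      fun j _ _ => by positivity
  have hexp : ∀ i ≤ T, Real.exp (Λ i) ≤ 3 / 2 := fun i hi => by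
    rw [← Real.exp_log (show (0 : ℝ) < 3 / 2 by norm_num)]
    exact Real.exp_le_exp.2 (hmono i hi)
  -- Half of 0.4055, rounded up.
  have hηle : ∀ i < T, (M * ‖z i‖ + M * ‖z (i + 1)‖) / 2 ≤ 0.203 := fun i hi => by
    have h1 := hmono (i + 1) hi
    simp only [hΛd] at h1
    rw [Finset.sum_range_succ] at h1
    linarith [h.sum_nonneg i]
  have hex : ∀ i, ∃ D, 0 ≤ D ∧ (i < T → D ≤ (tr (H i) - Real.log (dt (H i))) -
        (tr (H (i + 1)) - Real.log (dt (H (i + 1)))) +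
        (3 * (3 / 2) * (1 + 0.203) + 1) * ((M * ‖z i‖ + M * ‖z (i + 1)‖) / 2) ∧
      ⟪H (i + 1) (γ (i + 1)), γ (i + 1)⟫_ℝ ≤ 3 * (Real.exp D - 1) * ⟪H i (γ i), γ i⟫_ℝ) := by
    intro i
    by_cases hi : i < T
    · obtain ⟨D, h1, h2⟩ := h.step_estimate i (hexp i hi.le) (hηle i hi)
      exact ⟨D, h1, fun _ => h2⟩
    · exact ⟨0, le_refl 0, fun h => absurd h hi⟩
  choose D hD0 hD using hex
  obtain ⟨B₀, hB₀⟩ := h.pair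
  -- The potential starts at no more than n + n ln κ and ends at no less than n. The perturbations
  -- add at most (4.5 · 1.203 + 1)/2 · 0.4055 < 1.35.
  have hsum : ∑ i ∈ Finset.range T, D i ≤ S := by
    have h1 : ∑ i ∈ Finset.range T, D i ≤ ∑ i ∈ Finset.range T,
        (((tr (H i) - Real.log (dt (H i))) - (tr (H (i + 1)) - Real.log (dt (H (i + 1))))) +
        (3 * (3 / 2) * (1 + 0.203) + 1) / 2 * (M * ‖z i‖ + M * ‖z (i + 1)‖)) :=
      Finset.sum_le_sum fun i hi => by linarith [(hD i (Finset.mem_range.1 hi)).1]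
    rw [Finset.sum_add_distrib,
      Finset.sum_range_sub' (fun i => tr (H i) - Real.log (dt (H i))), ← Finset.mul_sum] at h1
    obtain ⟨BT, hBT⟩ := (h.bounds T).1
    have h2 := hBT.swap.log_dt_le
    have h3 : tr (H 0) ≤ n * 1 := tr_le (by simpa using h.upper)
    have h4 : -(n * Real.log κ) ≤ Real.log (dt (H 0)) := by
      have h5 := pow_le_dt hB₀.swap.symm (by positivity) h.lower
      have h6 := Real.log_le_log (by positivity) h5
      rw [one_div, inv_pow, Real.log_inv, Real.log_pow] at h6
      exact h6
    nlinarith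
  have hprod : ∀ i ≤ T, ⟪H i (γ i), γ i⟫_ℝ ≤
      (∏ j ∈ Finset.range i, (3 * (Real.exp (D j) - 1))) * ⟪H 0 (γ 0), γ 0⟫_ℝ := by
    intro i
    induction i with
    | zero => intro; simp
    | succ i ih =>
      intro hi
      refine ((hD i hi).2).trans ?_
      rw [Finset.prod_range_succ, mul_comm (∏ j ∈ Finset.range i, _),
        mul_assoc (3 * (Real.exp (D i) - 1))]
      refine mul_le_mul_of_nonneg_left (ih (by omega)) ?_
      linarith [Real.one_le_exp (hD0 i)]
  have h1 := hprod T le_rfl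
  have h2 := prod_exp_sub_one_le hT hD0 hsum
  obtain ⟨J0, hJ0, hγ0⟩ := h.mean 0
  obtain ⟨JT, hJT, hγT⟩ := h.mean T
  have hb0 : 0 < 1 + M * ‖z 0‖ / 2 := by positivity
  have hbT : 0 < 1 + M * ‖z T‖ / 2 := by positivity
  have h3 : ⟪H 0 (γ 0), γ 0⟫_ℝ ≤ (1 + M * ‖z 0‖ / 2) ^ 2 * ‖z 0‖ ^ 2 := by
    refine (h.upper _).trans ?_
    rw [hγ0, ← mul_pow]
    exact pow_le_pow_left₀ (norm_nonneg _) (hJ0.norm_le hb0 _) 2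
  have h4 : ‖z T‖ ^ 2 ≤ (1 + M * ‖z T‖ / 2) ^ 2 * ‖γ T‖ ^ 2 := by
    have := hJT.le_norm (z T) hbT
    rw [← hγT] at this
    rw [← mul_pow]
    exact pow_le_pow_left₀ (norm_nonneg _) this 2
  have h5 : ‖γ T‖ ^ 2 ≤ 3 / 2 * κ * ⟪H T (γ T), γ T⟫_ℝ := by
    have h6 := (h.bounds T).2.2 (γ T)
    have h7 := hexp T le_rfl
    rw [Real.exp_neg, inv_eq_one_div, div_div, div_mul_eq_mul_div, one_mul,
      div_le_iff₀ (by positivity)] at h6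
    refine h6.trans ?_
    rw [mul_comm]
    refine mul_le_mul_of_nonneg_right (mul_le_mul_of_nonneg_right h7 hκ.le) ?_
    obtain ⟨BT, hBT⟩ := (h.bounds T).1
    exact hBT.swap.nonneg _
  have hS0 : 0 ≤ S := (Finset.sum_nonneg fun i _ => hD0 i).trans hsum
  have hm0 : 0 ≤ ⟪H 0 (γ 0), γ 0⟫_ℝ := hB₀.swap.nonneg _
  calc ‖z T‖ ^ 2 ≤ (1 + M * ‖z T‖ / 2) ^ 2 * (3 / 2 * κ *
        ((3 * Real.exp (S / T) * (S / T)) ^ T * ((1 + M * ‖z 0‖ / 2) ^ 2 * ‖z 0‖ ^ 2))) := by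
        refine h4.trans (mul_le_mul_of_nonneg_left (h5.trans ?_) (by positivity))
        refine mul_le_mul_of_nonneg_left (h1.trans ?_) (by positivity)
        exact mul_le_mul h2 h3 hm0 (by positivity)
    _ = _ := by ring

end QNSeq

/-! ### Local convergence: the scalar recursion -/

theorem log_three_halves_ge : (0.4 : ℝ) ≤ Real.log (3 / 2) := by
  have h := Real.le_log_one_add_of_nonneg (x := 1 / 2) (by norm_num)
  norm_num at h ⊢
  exact h

theorem log_three_halves_le : Real.log (3 / 2) ≤ 0.4055 := by
  rw [Real.log_le_iff_le_exp (by norm_num)]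
  refine le_trans ?_ (Real.sum_le_exp_of_nonneg (x := 0.4055) (by norm_num) 6)
  norm_num [Finset.sum_range_succ, Nat.factorial]

theorem exp_le_of_le {x c : ℝ} (hx : x ≤ c) (h0 : 0 ≤ c) (h1 : c < 1) : Real.exp x ≤ 1 / (1 - c) :=
  (Real.exp_le_exp.2 hx).trans (Real.exp_bound_div_one_sub_of_interval h0 h1)

theorem exp_le_three_halves {x : ℝ} (hx : x ≤ 0.4) : Real.exp x ≤ 3 / 2 := by
  rw [← Real.le_log_iff_exp_le (by norm_num)]
  exact hx.trans log_three_halves_ge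

/-- Here u = κ^(-1/2), and 1 - 0.8774u² will bound the contraction of the first step. The hints of
the form (u - a)²(u + 2a) ≥ 0 are tangent lines to u³ near the critical points. -/
theorem linear_phase_poly {u : ℝ} (hu : 0 ≤ u) :
    u ^ 3 * (1 - 0.8774 * u ^ 2) ≤ 0.2275 ∧ u * (1 - 0.8774 * u ^ 2) ≤ 0.412 ∧
    0.22075 * u ^ 3 + 0.986 * (u ^ 3 * (1 - 0.8774 * u ^ 2)) ≤ 0.4 ∧
    0.22075 * u ^ 3 + 0.711 * (u * (1 - 0.8774 * u ^ 2)) ≤ 0.4 := by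
  have hpoly : 0 ≤ u * (u ^ 2 - 0.684) ^ 2 := by positivity
  refine ⟨?_, ?_, ?_, ?_⟩
  · nlinarith [mul_nonneg (sq_nonneg (u - 0.827)) (show 0 ≤ u + 1.654 by linarith)]
  · nlinarith [mul_nonneg (sq_nonneg (u - 0.616)) (show 0 ≤ u + 1.232 by linarith)]
  · nlinarith [mul_nonneg (sq_nonneg (u - 0.915)) (show 0 ≤ u + 1.83 by linarith),
      mul_nonneg hu (sq_nonneg (u ^ 2 - 0.837))]
  · nlinarith [mul_nonneg (sq_nonneg (u - 0.767)) (show 0 ≤ u + 1.534 by linarith)]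

theorem contraction_factor_le {s : ℝ} (h0 : 0 ≤ s) (hs : s ≤ 0.0503) :
    (1 + s / 2) * (3 / 2 * (1 + s / 2) - 1) ≤ 0.552 := by nlinarith

/-- One step of the geometric phase, in terms of constants. -/
theorem superlinear_constants {κ b a : ℝ} (hκ : 25 ≤ 2 * κ) (hb0 : 0 ≤ b) (hb : b ≤ 0.4)
    (ha0 : 0 ≤ a) (ha : a ≤ 0.004) :
    (1 + b / 2) ^ 2 * (1 + a / 2) ^ 2 * (3 / 2 * κ) * (1 / (2 * κ) ^ 4) ≤ 0.0001 := by
  have h5 : (1 + b / 2) ^ 2 ≤ 1.44 := by nlinarith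
  have h6 : (1 + a / 2) ^ 2 ≤ 1.01 := by nlinarith
  have h7 : (1 + b / 2) ^ 2 * (1 + a / 2) ^ 2 ≤ 1.44 * 1.01 :=
    mul_le_mul h5 h6 (sq_nonneg _) (by norm_num)
  have h8 : (2 * κ) ^ 3 ≥ 25 ^ 3 := pow_le_pow_left₀ (by norm_num) hκ 3
  have h9 : (1 + b / 2) ^ 2 * (1 + a / 2) ^ 2 * (3 / 2 * κ) ≤ 1.44 * 1.01 * (3 / 2 * κ) :=
    mul_le_mul_of_nonneg_right h7 (by linarith)
  have h10 : 0 < (2 * κ) ^ 4 := pow_pos (by linarith) 4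
  rw [mul_one_div, div_le_iff₀ h10]
  have : (2 * κ) ^ 4 = (2 * κ) ^ 3 * (2 * κ) := by ring
  rw [this]
  have h11 : 25 ^ 3 * (2 * κ) ≤ (2 * κ) ^ 3 * (2 * κ) :=
    mul_le_mul_of_nonneg_right h8 (by linarith)
  linarith

/-- From 8nl steps on, S/i ≤ 1.22/8 = 0.1525, so the base of the superlinear rate is safely below 1.
-/
theorem superlinear_factor_le {l nl S i x : ℝ} (hl3 : 3 ≤ l) (hnl : nl ≥ l) (hi : 8 * nl ≤ i)
    (hS0 : 0 ≤ S) (hS : S ≤ 1.22 * nl) (hx : x = 3 * Real.exp (S / i) * (S / i)) :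
    0 ≤ x ∧ x ≤ 0.55 := by
  have hi0 : 0 < i := by linarith
  have hSi : S / i ≤ 0.1525 := by
    rw [div_le_iff₀ hi0]
    linarith
  have h2 := exp_le_of_le hSi (by norm_num) (by norm_num)
  have h3 : Real.exp (S / i) ≤ 1.18 := h2.trans (by norm_num)
  have h4 : 0 ≤ S / i := by positivity
  have h5 := Real.exp_pos (S / i)
  rw [hx]
  refine ⟨by positivity, ?_⟩
  have h6 : Real.exp (S / i) * (S / i) ≤ 1.18 * 0.1525 := mul_le_mul h3 hSi h4 (by norm_num)
  linarith

/-- Because 0.55 ≤ exp(-1/2) and N ≥ 8l, the first N factors yield exp(-4l) = (2κ)⁻⁴. The others use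
0.55 ≤ 0.75². -/
theorem geometric_tail {l nl x κ : ℝ} {N i : ℕ} (hκ : 0 < κ) (hl : l = Real.log (2 * κ))
    (hnl : nl ≥ l) (hN : 8 * nl ≤ N) (hi : N ≤ i) (hx0 : 0 ≤ x) (hx : x ≤ 0.55) :
    x ^ i ≤ (1 / (2 * κ) ^ 4) * (0.75 ^ (i - N)) ^ 2 := by
  calc x ^ i ≤ 0.55 ^ i := pow_le_pow_left₀ hx0 hx i
    _ = 0.55 ^ N * 0.55 ^ (i - N) := by rw [← pow_add]; congr 1; omega
    _ ≤ (1 / (2 * κ) ^ 4) * (0.75 ^ (i - N)) ^ 2 := by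
      refine mul_le_mul ?_ ?_ (by positivity) (by positivity)
      · have h5 : (0.55 : ℝ) ≤ Real.exp (-(1 / 2)) := by
          have := one_third_sq_le_exp (x := -(1 / 2)) (by norm_num)
          norm_num at this ⊢
          linarith
        calc (0.55 : ℝ) ^ N ≤ Real.exp (-(1 / 2)) ^ N := pow_le_pow_left₀ (by norm_num) h5 N
          _ = Real.exp (-(N / 2)) := by rw [← Real.exp_nat_mul]; ring_nf
          _ ≤ Real.exp (-(4 * l)) := Real.exp_le_exp.2 (by linarith)
          _ = 1 / (2 * κ) ^ 4 := by
            rw [Real.exp_neg, one_div]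
            congr 1
            rw [show 4 * l = ((4 : ℕ) : ℝ) * l by norm_num, Real.exp_nat_mul, hl,
              Real.exp_log (by linarith)]
      · rw [← pow_mul, mul_comm, pow_mul]
        exact pow_le_pow_left₀ (by norm_num) (by norm_num) _

/-- Before the superlinear estimate becomes effective no decrease is available. Each step multiplies
s by at most 1 + s/2 ≤ exp(0.55 s₀), and s₀N ≤ 1/8 keeps the total growth below 1.1. -/
theorem early_growth {s : ℕ → ℝ} (hs : ∀ i, 0 ≤ s i) {N : ℕ} (hN : s 0 * N ≤ 0.125)
    (h0 : s 0 ≤ 0.004)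
    (hstep : ∀ i, ∑ j ∈ Finset.range i, (s j + s (j + 1)) ≤ 0.4 → s i ≤ 0.2 →
      s (i + 1) ≤ (1 + s i / 2) * s i) (i : ℕ) (hi : i ≤ N) :
    s i ≤ 1.1 * s 0 ∧ ∑ j ∈ Finset.range i, (s j + s (j + 1)) ≤ 2.2 * (s 0 * i) := by
  have hiN : ∀ i : ℕ, i ≤ N → s 0 * i ≤ 0.125 := fun i hi =>
    (mul_le_mul_of_nonneg_left (by exact_mod_cast hi) (hs 0)).trans hN
  have hexp : ∀ i : ℕ, i ≤ N → Real.exp (0.55 * (s 0 * i)) * s 0 ≤ 1.1 * s 0 := fun i hi => by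
    refine mul_le_mul_of_nonneg_right ?_ (hs 0)
    have := hiN i hi
    refine (exp_le_of_le (c := 0.06875) (by linarith) (by norm_num) (by norm_num)).trans ?_
    norm_num
  suffices s i ≤ Real.exp (0.55 * (s 0 * i)) * s 0 ∧
      ∑ j ∈ Finset.range i, (s j + s (j + 1)) ≤ 2.2 * (s 0 * i) from
    ⟨this.1.trans (hexp i hi), this.2⟩
  induction i with
  | zero => simp
  | succ i ih =>
    obtain ⟨h1, h2⟩ := ih (by omega)
    have h4 := h1.trans (hexp i (by omega))
    have h5 := hstep i (by linarith [hiN i (by omega)]) (by linarith)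
    have h6 : 1 + s i / 2 ≤ Real.exp (0.55 * s 0) := by
      have := Real.add_one_le_exp (0.55 * s 0)
      linarith
    have h7 : s (i + 1) ≤ Real.exp (0.55 * (s 0 * (i + 1 : ℕ))) * s 0 := by
      calc s (i + 1) ≤ Real.exp (0.55 * s 0) * (Real.exp (0.55 * (s 0 * i)) * s 0) :=
            h5.trans (mul_le_mul h6 h1 (hs i) (Real.exp_pos _).le)
        _ = _ := by
          rw [← mul_assoc, ← Real.exp_add]; push_cast; ring_nf
    refine ⟨h7, ?_⟩
    have h8 := h7.trans (hexp (i + 1) hi)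
    rw [Finset.sum_range_succ]
    push_cast
    linarith

/-- The decay `hsup` is available only while the sum is at most 0.4, so sum and decay are
bootstrapped together. The reserve 0.09 s₀ 0.75^k loses 0.0225 s₀ 0.75^k per step, exactly the bound
2.25 · 0.01 s₀ 0.75^k for the new summand. -/
theorem late_sum {s : ℕ → ℝ} (hs : ∀ i, 0 ≤ s i) {N : ℕ} (hN : s 0 * N ≤ 0.125)
    (h0 : s 0 ≤ 0.004)
    (hstep : ∀ i, ∑ j ∈ Finset.range i, (s j + s (j + 1)) ≤ 0.4 → s i ≤ 0.2 →
      s (i + 1) ≤ (1 + s i / 2) * s i)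
    (hfirst : ∀ i ≤ N, s i ≤ 1.1 * s 0 ∧
      ∑ j ∈ Finset.range i, (s j + s (j + 1)) ≤ 2.2 * (s 0 * i))
    (hsup : ∀ i, N ≤ i → ∑ j ∈ Finset.range i, (s j + s (j + 1)) ≤ 0.4 →
      s i ≤ 0.01 * s 0 * 0.75 ^ (i - N)) (i : ℕ) :
    ∑ j ∈ Finset.range i, (s j + s (j + 1)) ≤ 0.4 ∧ s i ≤ 0.221 := by
  have hpw : ∀ k : ℕ, s 0 * (0.75 : ℝ) ^ k ≤ s 0 := fun k =>
    mul_le_of_le_one_right (hs 0) (pow_le_one₀ (by norm_num) (by norm_num))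
  have hpw0 : ∀ k : ℕ, 0 ≤ s 0 * (0.75 : ℝ) ^ k := fun k => mul_nonneg (hs 0) (by positivity)
  have hsecond : ∀ k : ℕ, ∑ j ∈ Finset.range (N + k), (s j + s (j + 1)) +
      0.09 * (s 0 * 0.75 ^ k) ≤ 0.3 := by
    intro k
    induction k with
    | zero =>
      have h1 := (hfirst N le_rfl).2
      simp only [add_zero, pow_zero]
      linarith
    | succ k ih =>
      have h1 : ∑ j ∈ Finset.range (N + k), (s j + s (j + 1)) ≤ 0.4 := by linarith [hpw0 k]
      have h2 := hsup (N + k) (by omega) h1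
      rw [Nat.add_sub_cancel_left, mul_assoc] at h2
      have h3 : s (N + k) ≤ 0.2 := by linarith [hpw k]
      have h4 := hstep (N + k) h1 h3
      have h5 : s (N + k + 1) ≤ 1.25 * s (N + k) :=
        h4.trans (mul_le_mul_of_nonneg_right (by linarith) (hs _))
      rw [← add_assoc, Finset.sum_range_succ, pow_succ]
      linarith
  rcases le_total i N with hi | hi
  · obtain ⟨h1, h2⟩ := hfirst i hi
    have hiN : s 0 * i ≤ s 0 * N := mul_le_mul_of_nonneg_left (by exact_mod_cast hi) (hs 0)
    exact ⟨by linarith, by linarith⟩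
  · obtain ⟨k, rfl⟩ := Nat.exists_eq_add_of_le hi
    have h1 : ∑ j ∈ Finset.range (N + k), (s j + s (j + 1)) ≤ 0.4 := by
      linarith [hsecond k, hpw0 k]
    have h2 := hsup _ hi h1
    rw [mul_assoc] at h2
    exact ⟨h1, by linarith [hpw (N + k - N)]⟩

/-! ### Basin of attraction and rate of quasi-Newton sequences -/

namespace QNSeq

variable {n : ℕ} {M κ : ℝ} {z γ : ℕ → E n} {H : ℕ → E n →L[ℝ] E n}

/-- `contraction` with a bound `w` for `κ⁻¹`. -/
theorem contraction_le (h : QNSeq M κ z γ H) (i : ℕ) {x σ w : ℝ}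
    (hx : Real.exp (∑ j ∈ Finset.range i, (M * ‖z j‖ + M * ‖z (j + 1)‖)) ≤ x)
    (hσ : M * ‖z i‖ ≤ σ) (hw : w = 1 / κ) :
    M * ‖z (i + 1)‖ ≤ max ((1 + σ / 2) * (x * (1 + σ / 2) - 1)) (1 + σ / 2 - w / x) *
      (M * ‖z i‖) := by
  have hM := h.M_nonneg
  have hκ : 0 < κ := by linarith [h.one_le]
  have hx1 := (Real.one_le_exp (h.sum_nonneg i)).trans hx
  have h0 : 0 ≤ M * ‖z i‖ := by positivity
  refine (h.contraction i hx).trans (mul_le_mul_of_nonneg_right ?_ h0)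
  set s := M * ‖z i‖
  have hb : 0 < 1 + s / 2 := by positivity
  rw [mul_max_of_nonneg _ _ hb.le]
  refine max_le_max ?_ ?_
  · have h1 : x * (1 + s / 2) - 1 ≤ x * (1 + σ / 2) - 1 := by gcongr
    have h2 : 0 ≤ x * (1 + s / 2) - 1 := by nlinarith
    exact mul_le_mul (by linarith) h1 h2 (by linarith)
  · have : (1 + s / 2) * (1 - 1 / (x * (1 + s / 2) * κ)) = 1 + s / 2 - w / x := by
      rw [hw]; field_simp
    rw [this]
    linarith

/-- As long as the sum is at most 0.4 ≤ ln(3/2), the bounds on H deteriorate by at most 3/2 and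
every step contracts by 1 - δ. The geometric series then keeps the sum below 0.4. The first step is
treated separately because H₀ is still undistorted. -/
theorem linear_phase (h : QNSeq M κ z γ H) {u : ℝ} (hu0 : 0 < u) (hu1 : u ≤ 1)
    (hu : u ^ 2 = 1 / κ) (hσ0 : M * ‖z 0‖ ≤ 0.22075 * u ^ 3) (i : ℕ) :
    ∑ j ∈ Finset.range i, (M * ‖z j‖ + M * ‖z (j + 1)‖) ≤ 0.4 ∧ M * ‖z i‖ ≤ 0.221 := by
  have hM := h.M_nonneg
  have hnn : ∀ i, 0 ≤ M * ‖z i‖ := fun i => by positivity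
  have hu3 : u ^ 3 ≤ u ^ 2 := by nlinarith [sq_nonneg u]
  have hu2 : u ^ 2 ≤ 1 := by nlinarith
  have hu30 : 0 < u ^ 3 := by positivity
  set Θ := 1 - 0.8774 * u ^ 2 with hΘ
  have hΘ0 : 0 < Θ := by rw [hΘ]; nlinarith
  have hσ1 : M * ‖z 1‖ ≤ Θ * (M * ‖z 0‖) := by
    refine (h.contraction_le 0 (x := 1) (by simp) hσ0 hu).trans
      (mul_le_mul_of_nonneg_right (max_le ?_ ?_) (hnn 0))
    · rw [hΘ]; nlinarith
    · rw [hΘ]; nlinarith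
  have hσ1' : M * ‖z 1‖ ≤ 0.22075 * u ^ 3 * Θ := by
    refine hσ1.trans ?_
    rw [mul_comm]
    exact mul_le_mul_of_nonneg_right hσ0 hΘ0.le
  obtain ⟨P1, P2, P3, P4⟩ := linear_phase_poly hu0.le
  rw [← hΘ] at P1 P2 P3 P4
  -- The two branches of the contraction factor: 0.448 = 1 - 0.552 when H overshoots, and 0.621 <
  -- 2/3 - 0.045475 when H is too small.
  set δ := min 0.448 (0.621 * u ^ 2) with hδ
  have hδ0 : 0 < δ := lt_min (by norm_num) (by positivity)
  have hδ1 : δ ≤ 0.448 := min_le_left _ _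
  have hb1 : M * ‖z 1‖ ≤ 0.0503 := by linarith
  have hθ : ∀ i, Real.exp (∑ j ∈ Finset.range i, (M * ‖z j‖ + M * ‖z (j + 1)‖)) ≤ 3 / 2 →
      M * ‖z i‖ ≤ M * ‖z 1‖ → M * ‖z (i + 1)‖ ≤ (1 - δ) * (M * ‖z i‖) := fun i hx hi => by
    refine (h.contraction_le i hx hi hu).trans
      (mul_le_mul_of_nonneg_right (max_le ?_ ?_) (hnn i))
    · linarith [contraction_factor_le (hnn 1) hb1]
    · have h1 : δ ≤ 0.621 * u ^ 2 := min_le_right _ _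
      have h2 : M * ‖z 1‖ / 2 ≤ 0.045475 * u ^ 2 := by
        have : u ^ 3 * Θ ≤ 0.412 * u ^ 2 := by nlinarith [sq_nonneg u]
        linarith
      have h3 : u ^ 2 / (3 / 2) = 2 / 3 * u ^ 2 := by ring
      rw [h3]
      linarith
  have hstart : M * ‖z 0‖ + 2 / δ * (M * ‖z 1‖) ≤ 0.4 := by
    rcases min_choice (0.448 : ℝ) (0.621 * u ^ 2) with hc | hc
    · rw [hδ, hc]
      norm_num
      nlinarith
    · rw [hδ, hc]
      have e : 2 / (0.621 * u ^ 2) * (M * ‖z 1‖) ≤ 0.711 * (u * Θ) := by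
        rw [div_mul_eq_mul_div, div_le_iff₀ (by positivity)]
        have : 0.711 * (u * Θ) * (0.621 * u ^ 2) = 0.441531 * (u ^ 3 * Θ) := by ring
        rw [this]
        nlinarith
      linarith
  -- The reserve (2/δ - 1)σ is the value of all remaining pairs σ_j + σ_{j+1} under contraction by 1
  -- - δ.
  have key : ∀ i, M * ‖z (i + 1)‖ ≤ M * ‖z 1‖ ∧
      ∑ j ∈ Finset.range (i + 1), (M * ‖z j‖ + M * ‖z (j + 1)‖) +
        (2 / δ - 1) * (M * ‖z (i + 1)‖) ≤ 0.4 := by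
    intro i
    induction i with
    | zero =>
      refine ⟨le_rfl, ?_⟩
      rw [Finset.sum_range_one]
      simp only [zero_add]
      linarith
    | succ i ih =>
      have hc0 : 0 ≤ 2 / δ - 1 := by
        rw [sub_nonneg, le_div_iff₀ hδ0]; linarith
      have hpos : 0 ≤ (2 / δ - 1) * (M * ‖z (i + 1)‖) := mul_nonneg hc0 (hnn _)
      have h1 := hθ (i + 1) (exp_le_three_halves (by linarith [ih.2])) ih.1
      have h2 : M * ‖z (i + 1 + 1)‖ ≤ M * ‖z (i + 1)‖ := by nlinarith [hnn (i + 1)]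
      refine ⟨h2.trans ih.1, ?_⟩
      rw [Finset.sum_range_succ]
      have h3 : 2 / δ * (M * ‖z (i + 1 + 1)‖) ≤ 2 / δ * ((1 - δ) * (M * ‖z (i + 1)‖)) :=
        mul_le_mul_of_nonneg_left h1 (by positivity)
      have h4 : 2 / δ * ((1 - δ) * (M * ‖z (i + 1)‖)) =
          (2 / δ - 2) * (M * ‖z (i + 1)‖) := by field_simp
      have h5 := ih.2
      linarith
  have hσ00 : M * ‖z 0‖ ≤ 0.221 := by nlinarith
  cases i with
  | zero => exact ⟨by norm_num, hσ00⟩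
  | succ i =>
    obtain ⟨h1, h2⟩ := key i
    have hc0 : 0 ≤ 2 / δ - 1 := by rw [sub_nonneg, le_div_iff₀ hδ0]; linarith
    exact ⟨by linarith [mul_nonneg hc0 (hnn (i + 1))], by linarith⟩

theorem tail_estimate (h : QNSeq M κ z γ H) (hn : 1 ≤ n) {l : ℝ} (hl : l = Real.log (2 * κ))
    (hl3 : 3 ≤ l) (hκ25 : 25 ≤ 2 * κ) (hσs : M * ‖z 0‖ ≤ 0.004) {N i : ℕ} (hN1 : 1 ≤ N)
    (hNK : 8 * (n * l) ≤ N) (hi : N ≤ i)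
    (hΛ : ∑ j ∈ Finset.range i, (M * ‖z j‖ + M * ‖z (j + 1)‖) ≤ 0.4) :
    M * ‖z i‖ ≤ 0.01 * (M * ‖z 0‖) * 0.75 ^ (i - N) := by
  have hM := h.M_nonneg
  have hnn : ∀ i, 0 ≤ M * ‖z i‖ := fun i => by positivity
  have hn1 : (1 : ℝ) ≤ n := by exact_mod_cast hn
  have hκ0 : 0 < κ := by linarith
  have hnl : l ≤ n * l := le_mul_of_one_le_left (by linarith) hn1
  set σ := M * ‖z 0‖ with hσ
  have hσnn : 0 ≤ σ := hnn 0
  have hi1 : 1 ≤ i := hN1.trans hi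
  have hiN : (N : ℝ) ≤ i := by exact_mod_cast hi
  have hi0 : (0 : ℝ) < i := by exact_mod_cast hi1
  have hσi : M * ‖z i‖ ≤ 0.4 := by
    obtain ⟨j, rfl⟩ : ∃ j, i = j + 1 := ⟨i - 1, by omega⟩
    rw [Finset.sum_range_succ] at hΛ
    linarith [h.sum_nonneg j, hnn j]
  have h1 := h.superlinear hi1 (hΛ.trans log_three_halves_ge) log_three_halves_le le_rfl
  set S := n * Real.log κ + 1.35 with hS
  have hlκ : Real.log κ = l - Real.log 2 := by
    rw [hl, Real.log_mul two_ne_zero hκ0.ne']; ring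
  have hS0 : 0 ≤ S := by
    have := Real.log_nonneg h.one_le
    positivity
  -- S = nl - n ln 2 + 1.35 ≤ nl + 0.657, and nl ≥ 3.
  have hSl : S ≤ 1.22 * (n * l) := by
    have h2 := Real.log_two_gt_d9
    have h3 : 0.693 ≤ n * Real.log 2 := by nlinarith only [h2, hn1]
    rw [hS, hlκ, mul_sub]
    linarith
  obtain ⟨hf0, hf⟩ := superlinear_factor_le hl3 hnl
    (show 8 * (n * l) ≤ i by linarith) hS0 hSl rfl
  have hpow := geometric_tail hκ0 hl hnl (hNK) hi hf0 hf
  have hcst := superlinear_constants hκ25 (hnn i) hσi hσnn hσs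
  rw [← hσ] at h1
  clear_value S σ
  have hsq : (M * ‖z i‖) ^ 2 ≤ (0.01 * σ * 0.75 ^ (i - N)) ^ 2 := by
    calc (M * ‖z i‖) ^ 2 = M ^ 2 * ‖z i‖ ^ 2 := by ring
      _ ≤ M ^ 2 * ((1 + M * ‖z i‖ / 2) ^ 2 * (1 + σ / 2) ^ 2 * (3 / 2 * κ) *
        (3 * Real.exp (S / i) * (S / i)) ^ i * ‖z 0‖ ^ 2) :=
        mul_le_mul_of_nonneg_left h1 (sq_nonneg _)
      _ ≤ M ^ 2 * ((1 + M * ‖z i‖ / 2) ^ 2 * (1 + σ / 2) ^ 2 * (3 / 2 * κ) *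
        ((1 / (2 * κ) ^ 4) * (0.75 ^ (i - N)) ^ 2) * ‖z 0‖ ^ 2) := by
        gcongr
      _ = ((1 + M * ‖z i‖ / 2) ^ 2 * (1 + σ / 2) ^ 2 * (3 / 2 * κ) * (1 / (2 * κ) ^ 4)) *
        ((0.75 ^ (i - N)) ^ 2 * σ ^ 2) := by rw [hσ]; ring
      _ ≤ 0.0001 * ((0.75 ^ (i - N)) ^ 2 * σ ^ 2) :=
        mul_le_mul_of_nonneg_right hcst (by positivity)
      _ = _ := by ring
  exact (abs_le_of_sq_le_sq' hsq (by positivity)).2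

theorem superlinear_phase (h : QNSeq M κ z γ H) (hn : 1 ≤ n) {u : ℝ} (hu0 : 0 < u)
    (hu : u ^ 2 = 1 / κ)
    (hκ : 8 * n * Real.log (2 * κ) + 9 ≤ 2 * κ)
    (hσ0 : M * ‖z 0‖ * (8 * n * Real.log (2 * κ) + 9) ≤ 0.4415 * u) (i : ℕ) :
    ∑ j ∈ Finset.range i, (M * ‖z j‖ + M * ‖z (j + 1)‖) ≤ 0.4 ∧ M * ‖z i‖ ≤ 0.221 := by
  have hM := h.M_nonneg
  have hnn : ∀ i, 0 ≤ M * ‖z i‖ := fun i => by positivity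
  have hn1 : (1 : ℝ) ≤ n := by exact_mod_cast hn
  have hκ0 : 0 < κ := by linarith [h.one_le]
  set l := Real.log (2 * κ) with hl
  have hl0 : 0 ≤ l := Real.log_nonneg (by linarith [h.one_le])
  have hnl : l ≤ n * l := by nlinarith
  -- The hypothesis improves itself: 2κ ≥ 9 > e² gives l ≥ 2, then 2κ ≥ 8 · 2 + 9 = 25 > e³ gives l
  -- ≥ 3, and so K ≥ 24.
  have hl2 : 2 ≤ l := by
    rw [hl, Real.le_log_iff_exp_le (by linarith)]
    have h1 : Real.exp 2 = Real.exp 1 * Real.exp 1 := by rw [← Real.exp_add]; norm_num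
    rw [h1]
    nlinarith [Real.exp_one_lt_d9, Real.exp_pos 1]
  have hκ25 : 25 ≤ 2 * κ := by nlinarith
  have hl3 : 3 ≤ l := by
    rw [hl, Real.le_log_iff_exp_le (by linarith)]
    have h1 : Real.exp 3 = Real.exp 1 * Real.exp 1 * Real.exp 1 := by
      rw [← Real.exp_add, ← Real.exp_add]; norm_num
    have h2 : Real.exp 1 * Real.exp 1 ≤ 7.5 := by nlinarith [Real.exp_one_lt_d9, Real.exp_pos 1]
    rw [h1]
    nlinarith [Real.exp_one_lt_d9, Real.exp_pos 1]
  have hu1 : u ≤ 0.283 := by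
    have : u ^ 2 ≤ 0.08 := by rw [hu, div_le_iff₀ hκ0]; linarith
    nlinarith
  set σ := M * ‖z 0‖ with hσ
  have hσnn : 0 ≤ σ := hnn 0
  set K := 8 * n * l with hK
  have hK24 : 24 ≤ K := by rw [hK]; nlinarith
  have hσK : σ * (K + 9) ≤ 0.125 := by linarith
  have hσs : σ ≤ 0.004 := by nlinarith
  set N := ⌈K⌉₊ with hN
  have hNK : K ≤ N := Nat.le_ceil K
  have hNK1 : (N : ℝ) ≤ K + 1 := (Nat.ceil_lt_add_one (by linarith)).le
  have hσN : σ * N ≤ 0.125 := by nlinarith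
  have hstep : ∀ i, ∑ j ∈ Finset.range i, (M * ‖z j‖ + M * ‖z (j + 1)‖) ≤ 0.4 →
      M * ‖z i‖ ≤ 0.2 → M * ‖z (i + 1)‖ ≤ (1 + M * ‖z i‖ / 2) * (M * ‖z i‖) := by
    intro i hi hi2
    refine (h.contraction_le i (exp_le_three_halves hi) le_rfl hu).trans
      (mul_le_mul_of_nonneg_right (max_le ?_ ?_) (hnn i))
    · nlinarith [hnn i]
    · have : 0 ≤ u ^ 2 / (3 / 2) := by positivity
      linarith
  have hfirst := early_growth hnn hσN hσs hstep
  have hN1 : 1 ≤ N := by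
    have : (1 : ℝ) ≤ N := by linarith
    exact_mod_cast this
  -- superlinear estimate
  have hsup : ∀ i, N ≤ i → ∑ j ∈ Finset.range i, (M * ‖z j‖ + M * ‖z (j + 1)‖) ≤ 0.4 →
      M * ‖z i‖ ≤ 0.01 * σ * 0.75 ^ (i - N) := by
    intro i hi hΛ
    exact h.tail_estimate hn hl hl3 hκ25 hσs hN1 (by linarith) hi hΛ
  exact late_sum hnn hσN hσs hstep hfirst hsup i

/-- Local superlinear convergence of BFGS with explicit constants. -/
theorem local_convergence (h : QNSeq M κ z γ H) (hn : 1 ≤ n)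
    (hσ0 : M * ‖z 0‖ ≤ 0.4415 * Real.sqrt (1 / κ) *
      max (1 / (2 * κ)) (1 / (8 * n * Real.log (2 * κ) + 9))) (i : ℕ) :
    ∑ j ∈ Finset.range i, (M * ‖z j‖ + M * ‖z (j + 1)‖) ≤ 0.4 ∧ M * ‖z i‖ ≤ 0.221 := by
  have hκ1 := h.one_le
  have hκ0 : 0 < κ := by linarith
  set u := Real.sqrt (1 / κ) with hu
  have hu2 : u ^ 2 = 1 / κ := Real.sq_sqrt (by positivity)
  have hu0 : 0 < u := Real.sqrt_pos.2 (by positivity)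
  have hl : 0 ≤ Real.log (2 * κ) := Real.log_nonneg (by linarith)
  have hK : 0 < 8 * n * Real.log (2 * κ) + 9 := by positivity
  rcases le_total (1 / (8 * n * Real.log (2 * κ) + 9)) (1 / (2 * κ)) with hc | hc
  · rw [max_eq_left hc] at hσ0
    refine h.linear_phase hu0 ?_ hu2 (hσ0.trans (le_of_eq ?_)) i
    · have : u ^ 2 ≤ 1 := by rw [hu2, div_le_one hκ0]; exact hκ1
      nlinarith
    · rw [show 1 / (2 * κ) = 1 / 2 * (1 / κ) by field_simp, ← hu2]; ring
  · rw [max_eq_right hc, mul_one_div, le_div_iff₀ hK] at hσ0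
    exact h.superlinear_phase hn hu0 hu2 ((one_div_le_one_div (by linarith) hK).1 hc) hσ0 i

theorem local_rate (h : QNSeq M κ z γ H) (hn : 1 ≤ n)
    (hσ0 : M * ‖z 0‖ ≤ 0.4415 * Real.sqrt (1 / κ) *
      max (1 / (2 * κ)) (1 / (8 * n * Real.log (2 * κ) + 9)))
    {T : ℕ} (hT : 8 * n * Real.log (2 * κ) ≤ T) :
    ‖z T‖ ^ 2 ≤ 4 * κ * (9 * n * Real.log (2 * κ) / T) ^ T * ‖z 0‖ ^ 2 := by
  have hκ1 := h.one_le
  have hκ0 : 0 < κ := by linarith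
  have hn1 : (1 : ℝ) ≤ n := by exact_mod_cast hn
  obtain ⟨hΛ, hσT⟩ := h.local_convergence hn hσ0 T
  have hσ00 := (h.local_convergence hn hσ0 0).2
  have hl2 := Real.log_two_gt_d9
  have hlκ : Real.log (2 * κ) = Real.log 2 + Real.log κ := Real.log_mul two_ne_zero hκ0.ne'
  have hlκ0 := Real.log_nonneg hκ1
  set l := Real.log (2 * κ) with hl
  have hnl : 0 < n * l := by rw [hlκ]; positivity
  have hT0 : (0 : ℝ) < T := by linarith
  have hT1 : 1 ≤ T := by exact_mod_cast hT0
  have h1 := h.superlinear hT1 (hΛ.trans log_three_halves_ge) log_three_halves_le le_rfl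
  set S := n * Real.log κ + 1.35 with hS
  have hS0 : 0 ≤ S := by positivity
  -- The constant 1.35 is absorbed by 1.95 n ln 2. Then S/T ≤ 1.95/8, and 3 · 1.33 · 1.95 < 9.
  have hSl : S ≤ 1.95 * (n * l) := by rw [hS, hlκ]; nlinarith
  have hST : S / T ≤ 0.24375 := by rw [div_le_iff₀ hT0]; linarith
  have hf : 3 * Real.exp (S / T) * (S / T) ≤ 9 * n * l / T := by
    have h2 := exp_le_of_le hST (by norm_num) (by norm_num)
    have h3 : Real.exp (S / T) ≤ 1.33 := h2.trans (by norm_num)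
    rw [← mul_div_assoc]
    refine div_le_div_of_nonneg_right ?_ hT0.le
    nlinarith
  have hM := h.M_nonneg
  have hnn : ∀ i, 0 ≤ M * ‖z i‖ := fun i => by positivity
  have hb : (1 + M * ‖z T‖ / 2) ^ 2 * (1 + M * ‖z 0‖ / 2) ^ 2 * (3 / 2 * κ) ≤ 4 * κ := by
    have h5 : (1 + M * ‖z T‖ / 2) ^ 2 ≤ 1.25 := by nlinarith [hnn T]
    have h6 : (1 + M * ‖z 0‖ / 2) ^ 2 ≤ 1.25 := by nlinarith [hnn 0]
    have h7 : (1 + M * ‖z T‖ / 2) ^ 2 * (1 + M * ‖z 0‖ / 2) ^ 2 ≤ 1.25 * 1.25 :=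
      mul_le_mul h5 h6 (sq_nonneg _) (by norm_num)
    nlinarith
  refine h1.trans (mul_le_mul_of_nonneg_right ?_ (sq_nonneg _))
  exact mul_le_mul hb (pow_le_pow_left₀ (by positivity) hf T) (by positivity) (by positivity)

end QNSeq

/-! ### Calculus of the lower-level function -/

section calculus

variable {m n : ℕ}

theorem hasFDerivAt_snd_of_contDiff {f : E m → E n → ℝ} {k : WithTop ℕ∞} (hk : k ≠ 0)
    (hf : ContDiff ℝ k fun p : E m × E n => f p.1 p.2) (x : E m) (y : E n) :
    HasFDerivAt (f x) ((fderiv ℝ (fun p : E m × E n => f p.1 p.2) (x, y)).comp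
      (ContinuousLinearMap.inr ℝ (E m) (E n))) y := by
  have h1 : HasFDerivAt (fun p : E m × E n => f p.1 p.2)
      (fderiv ℝ (fun p : E m × E n => f p.1 p.2) (x, y)) (x, y) :=
    (hf.differentiable hk).differentiableAt.hasFDerivAt
  exact h1.comp y (hasFDerivAt_prodMk_right x y)

/-- The operator taking the joint derivative to the partial gradient in `y`. -/
def partialGradY (m n : ℕ) : (E m × E n →L[ℝ] ℝ) →L[ℝ] E n :=
  LinearMap.toContinuousLinearMap
    { toFun := fun l => (InnerProductSpace.toDual ℝ (E n)).symm
        (l.comp (ContinuousLinearMap.inr ℝ (E m) (E n)))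
      map_add' := fun l l' => by rw [ContinuousLinearMap.add_comp, map_add]
      map_smul' := fun a l => by
        rw [ContinuousLinearMap.smul_comp, LinearIsometryEquiv.map_smulₛₗ]; rfl }

theorem gradY_eq {f : E m → E n → ℝ} {k : WithTop ℕ∞} (hk : k ≠ 0)
    (hf : ContDiff ℝ k fun p : E m × E n => f p.1 p.2) (x : E m) (y : E n) :
    gradY f x y = partialGradY m n (fderiv ℝ (fun p : E m × E n => f p.1 p.2) (x, y)) := by
  rw [gradY, gradient, (hasFDerivAt_snd_of_contDiff hk hf x y).fderiv]
  rfl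

namespace LowerAssumption

variable {f : E m → E n → ℝ} {c : Consts} (hf : LowerAssumption f c)

include hf

theorem contDiff_gradY : ContDiff ℝ 1 fun p : E m × E n => gradY f p.1 p.2 := by
  have h1 : ContDiff ℝ 1 (fderiv ℝ fun p : E m × E n => f p.1 p.2) :=
    hf.contDiff.fderiv_right (by norm_num)
  have h2 := (partialGradY m n).contDiff.comp h1
  convert! h2 using 1
  ext1 p
  exact gradY_eq two_ne_zero hf.contDiff p.1 p.2

theorem hasFDerivAt_gradY (x : E m) (y : E n) :
    HasFDerivAt (gradY f x) (hessYY f x y) y := by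
  have h1 : DifferentiableAt ℝ (fun p : E m × E n => gradY f p.1 p.2) (x, y) :=
    (hf.contDiff_gradY.differentiable one_ne_zero).differentiableAt
  exact (h1.comp y (hasFDerivAt_prodMk_right x y).differentiableAt).hasFDerivAt

theorem hasStrictFDerivAt_gradY_joint (x : E m) (y : E n) :
    HasStrictFDerivAt (fun p : E m × E n => gradY f p.1 p.2)
      ((hessXY f x y).coprod (hessYY f x y)) (x, y) := by
  have h1 : HasStrictFDerivAt (fun p : E m × E n => gradY f p.1 p.2)
      (fderiv ℝ (fun p : E m × E n => gradY f p.1 p.2) (x, y)) (x, y) :=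
    hf.contDiff_gradY.contDiffAt.hasStrictFDerivAt one_ne_zero
  have h2 := h1.hasFDerivAt.comp y (hasFDerivAt_prodMk_right x y)
  have h3 := HasFDerivAt.comp (f := fun e => (e, y)) x h1.hasFDerivAt
    (hasFDerivAt_prodMk_left x y)
  have e : (hessXY f x y).coprod (hessYY f x y) =
      fderiv ℝ (fun p : E m × E n => gradY f p.1 p.2) (x, y) := by
    have e2 : hessYY f x y = _ := h2.fderiv
    have e3 : hessXY f x y = _ := h3.fderiv
    rw [e2, e3]
    refine ContinuousLinearMap.ext fun p => ?_
    simp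
  rw [e]
  exact h1

/-- Carries the symmetry of second derivatives over to the Hessian operator. -/
theorem inner_hessYY_eq (x : E m) (y v w : E n) :
    ⟪hessYY f x y v, w⟫_ℝ = fderiv ℝ (fderiv ℝ (f x)) y v w := by
  have hc : ContDiff ℝ 2 (f x) := hf.contDiff.comp (contDiff_prodMk_right x)
  have h1 : HasFDerivAt (fderiv ℝ (f x)) (fderiv ℝ (fderiv ℝ (f x)) y) y :=
    ((hc.fderiv_right (m := 1) (by norm_num)).differentiable one_ne_zero).differentiableAt.hasFDerivAt
  have h2 : HasFDerivAt (fun y => fderiv ℝ (f x) y w) ((fderiv ℝ (fderiv ℝ (f x)) y).flip w) y := by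
    simpa using h1.clm_apply (hasFDerivAt_const w y)
  have h3 : HasFDerivAt (fun y => ⟪gradY f x y, w⟫_ℝ)
      ((innerSL ℝ w).comp (hessYY f x y)) y := by
    have := (innerSL ℝ w).hasFDerivAt.comp y (hf.hasFDerivAt_gradY x y)
    convert! this using 1
    ext1 z
    simp [real_inner_comm]
  have e : (fun y => ⟪gradY f x y, w⟫_ℝ) = fun y => fderiv ℝ (f x) y w := by
    ext1 z
    rw [gradY, ← InnerProductSpace.toDual_apply_apply, toDual_gradient]
  rw [e] at h3
  have := congrArg (fun A => A v) (h3.unique h2)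
  simp only [ContinuousLinearMap.comp_apply, ContinuousLinearMap.flip_apply,
    innerSL_apply_apply] at this
  rw [← this, real_inner_comm]

theorem hessYY_symm (x : E m) (y v w : E n) :
    ⟪hessYY f x y v, w⟫_ℝ = ⟪v, hessYY f x y w⟫_ℝ := by
  have hc : ContDiff ℝ 2 (f x) := hf.contDiff.comp (contDiff_prodMk_right x)
  have hs : IsSymmSndFDerivAt ℝ (f x) y :=
    hc.contDiffAt.isSymmSndFDerivAt (by simp)
  rw [← real_inner_comm v, hf.inner_hessYY_eq, hf.inner_hessYY_eq]
  exact hs.eq v w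

theorem hasDerivAt_line (x : E m) (y v : E n) (t : ℝ) :
    HasDerivAt (fun t : ℝ => f x (y + t • v)) ⟪gradY f x (y + t • v), v⟫_ℝ t := by
  have h1 := hasFDerivAt_snd_of_contDiff two_ne_zero hf.contDiff x (y + t • v)
  have h2 : HasDerivAt (fun t : ℝ => y + t • v) v t := by
    simpa using ((hasDerivAt_id t).smul_const v).const_add y
  have h3 := h1.comp_hasDerivAt t h2
  convert! h3 using 1
  rw [gradY, ← InnerProductSpace.toDual_apply_apply, toDual_gradient, h1.fderiv]

theorem hasDerivAt_shifted (x : E m) (y v : E n) (t : ℝ) :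
    HasDerivAt (fun t : ℝ => f x (y + t • v) - c.μ / 2 * ‖y + t • v‖ ^ 2)
      (⟪gradY f x (y + t • v), v⟫_ℝ - c.μ * ⟪y + t • v, v⟫_ℝ) t := by
  have h2 : HasDerivAt (fun t : ℝ => y + t • v) v t := by
    simpa using ((hasDerivAt_id t).smul_const v).const_add y
  have h3 := (h2.norm_sq).const_mul (c.μ / 2)
  convert! (hf.hasDerivAt_line x y v t).sub h3 using 1
  ring

theorem convexOn_line (x : E m) (y v : E n) :
    ConvexOn ℝ Set.univ (fun t : ℝ => f x (y + t • v) - c.μ / 2 * ‖y + t • v‖ ^ 2) := by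
  have h1 := strongConvexOn_iff_convex.1 (hf.strongConvex x)
  have h2 := h1.comp_affineMap (AffineMap.lineMap y (y + v))
  simp only [Set.preimage_univ] at h2
  convert! h2 using 1
  ext1 t
  simp [AffineMap.lineMap_apply, add_comm]

theorem gradY_monotone (x : E m) (y₁ y₂ : E n) :
    c.μ * ‖y₂ - y₁‖ ^ 2 ≤ ⟪gradY f x y₂ - gradY f x y₁, y₂ - y₁⟫_ℝ := by
  have hc := hf.convexOn_line x y₁ (y₂ - y₁)
  have h1 := hc.le_slope_of_hasDerivAt (Set.mem_univ 0) (Set.mem_univ 1) one_pos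
    (hf.hasDerivAt_shifted x y₁ (y₂ - y₁) 0)
  have h2 := hc.slope_le_of_hasDerivAt (Set.mem_univ 0) (Set.mem_univ 1) one_pos
    (hf.hasDerivAt_shifted x y₁ (y₂ - y₁) 1)
  have h3 := h1.trans h2
  simp only [zero_smul, add_zero, one_smul, add_sub_cancel] at h3
  rw [inner_sub_left, ← real_inner_self_eq_norm_sq, inner_sub_left]
  linarith

theorem hessYY_ge (x : E m) (y v : E n) : c.μ * ‖v‖ ^ 2 ≤ ⟪hessYY f x y v, v⟫_ℝ := by
  have h2 : HasDerivAt (fun t : ℝ => y + t • v) v 0 := by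
    simpa using ((hasDerivAt_id (0 : ℝ)).smul_const v).const_add y
  have h3 : HasDerivAt (fun t : ℝ => gradY f x (y + t • v)) (hessYY f x y v) 0 := by
    have h1 := hf.hasFDerivAt_gradY x (y + (0 : ℝ) • v)
    have := h1.comp_hasDerivAt (0 : ℝ) h2
    convert! this using 1
    simp
  have h4 : HasDerivAt (fun t : ℝ => ⟪gradY f x (y + t • v), v⟫_ℝ) ⟪hessYY f x y v, v⟫_ℝ 0 := by
    simpa using h3.inner ℝ (hasDerivAt_const (0 : ℝ) v)
  have h5 := h4.hasDerivWithinAt (s := Set.Ioi 0)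
  rw [hasDerivWithinAt_iff_tendsto_slope' (by simp)] at h5
  refine ge_of_tendsto h5 ?_
  filter_upwards [self_mem_nhdsWithin] with t ht
  have ht' : 0 < t := ht
  have h6 := hf.gradY_monotone x y (y + t • v)
  rw [add_sub_cancel_left, norm_smul, inner_smul_right, Real.norm_eq_abs, mul_pow, sq_abs,
    inner_sub_left] at h6
  rw [slope_def_field, sub_zero, zero_smul, add_zero, le_div_iff₀ ht']
  nlinarith

theorem L_nonneg_of_ne {v : E n} (hv : v ≠ 0) (x : E m) : 0 ≤ c.L := by
  have h := (norm_nonneg _).trans (hf.gradY_lip_y x v 0)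
  have h2 : 0 < ‖v - 0‖ := by simpa using norm_pos_iff.2 hv
  exact nonneg_of_mul_nonneg_left h h2

theorem norm_hessYY_apply_le (x : E m) (y v : E n) : ‖hessYY f x y v‖ ≤ c.L * ‖v‖ := by
  by_cases hv : v = 0
  · simp [hv]
  · have h1 : ‖hessYY f x y‖ ≤ c.L := (hf.hasFDerivAt_gradY x y).le_of_lip'
      (hf.L_nonneg_of_ne hv x) (Filter.Eventually.of_forall fun z => hf.gradY_lip_y x z y)
    exact (hessYY f x y).le_of_opNorm_le h1 v

theorem hessYY_le (x : E m) (y v : E n) : ⟪hessYY f x y v, v⟫_ℝ ≤ c.L * ‖v‖ ^ 2 := by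
  have h1 := real_inner_le_norm (hessYY f x y v) v
  have h2 := hf.norm_hessYY_apply_le x y v
  nlinarith [norm_nonneg v]

theorem μ_le_L (hn : 1 ≤ n) : c.μ ≤ c.L := by
  have hv : EuclideanSpace.basisFun (Fin n) ℝ ⟨0, hn⟩ ≠ 0 := fun h => by
    have := OrthonormalBasis.norm_eq_one (EuclideanSpace.basisFun (Fin n) ℝ) ⟨0, hn⟩
    rw [h] at this
    simp at this
  have h1 := hf.hessYY_ge 0 0 (EuclideanSpace.basisFun (Fin n) ℝ ⟨0, hn⟩)
  have h2 := hf.hessYY_le 0 0 (EuclideanSpace.basisFun (Fin n) ℝ ⟨0, hn⟩)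
  rw [OrthonormalBasis.norm_eq_one] at h1 h2
  linarith

theorem exists_hess_pair (x : E m) (y : E n) : ∃ H, PosPair H (hessYY f x y) :=
  PosPair.of_symm_of_lower hf.μ_pos (hf.hessYY_symm x y) (hf.hessYY_ge x y)

theorem hessYY_form_lip (x : E m) (y y' v : E n) :
    |⟪hessYY f x y v, v⟫_ℝ - ⟪hessYY f x y' v, v⟫_ℝ| ≤ c.Lfyy * ‖y - y'‖ * ‖v‖ ^ 2 := by
  rw [← inner_sub_left, ← sub_apply]
  refine (abs_real_inner_le_norm _ _).trans ?_
  have h1 := (hessYY f x y - hessYY f x y').le_of_opNorm_le (hf.hessYY_lip_y x y y') v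
  nlinarith [norm_nonneg v]

theorem continuous_hessYY (x : E m) : Continuous (hessYY f x) := by
  have : LipschitzWith ⟨c.Lfyy, hf.Lfyy_nonneg⟩ (hessYY f x) :=
    LipschitzWith.of_dist_le_mul fun y y' => by
      rw [dist_eq_norm, dist_eq_norm]; exact hf.hessYY_lip_y x y y'
  exact this.continuous

/-- The mean of the Hessian over a segment. -/
theorem exists_mean_hess (x : E m) (y₁ y₂ : E n) :
    ∃ J : E n →L[ℝ] E n, (∀ v w, ⟪J v, w⟫_ℝ = ⟪v, J w⟫_ℝ) ∧
      gradY f x y₂ - gradY f x y₁ = J (y₂ - y₁) ∧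
      (∀ v, c.μ * ‖v‖ ^ 2 ≤ ⟪J v, v⟫_ℝ) ∧ (∀ v, ⟪J v, v⟫_ℝ ≤ c.L * ‖v‖ ^ 2) ∧
      ∀ y₀ v, |⟪J v, v⟫_ℝ - ⟪hessYY f x y₀ v, v⟫_ℝ| ≤
        c.Lfyy * ((‖y₁ - y₀‖ + ‖y₂ - y₀‖) / 2) * ‖v‖ ^ 2 := by
  set d := y₂ - y₁ with hd
  set A : ℝ → E n →L[ℝ] E n := fun t => hessYY f x (y₁ + t • d) with hA
  have hAc : Continuous A := (hf.continuous_hessYY x).comp (by fun_prop)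
  have hint : IntervalIntegrable A MeasureTheory.volume 0 1 := hAc.intervalIntegrable 0 1
  have hform : ∀ v w, ⟪(∫ t in (0 : ℝ)..1, A t) v, w⟫_ℝ = ∫ t in (0 : ℝ)..1, ⟪A t v, w⟫_ℝ := by
    intro v w
    have := ((innerSL ℝ w).comp (ContinuousLinearMap.apply ℝ (E n) v)).intervalIntegral_comp_comm
      hint
    simp only [ContinuousLinearMap.comp_apply, ContinuousLinearMap.apply_apply,
      innerSL_apply_apply] at this
    rw [real_inner_comm, ← this]
    simp only [real_inner_comm]
  have hcont : ∀ v w, Continuous fun t => ⟪A t v, w⟫_ℝ := fun v w => by fun_prop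
  refine ⟨∫ t in (0 : ℝ)..1, A t, ?_, ?_, ?_, ?_, ?_⟩
  · intro v w
    rw [hform, real_inner_comm, hform]
    refine intervalIntegral.integral_congr fun t _ => ?_
    rw [hf.hessYY_symm, real_inner_comm]
  · have h1 := ContinuousLinearMap.intervalIntegral_comp_comm (ContinuousLinearMap.apply ℝ (E n) d)
      hint
    simp only [ContinuousLinearMap.apply_apply] at h1
    rw [← h1]
    have h2 : ∀ t ∈ Set.uIcc (0 : ℝ) 1,
        HasDerivAt (fun t : ℝ => gradY f x (y₁ + t • d)) (A t d) t := fun t _ => by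
      have h3 : HasDerivAt (fun t : ℝ => y₁ + t • d) d t := by
        simpa using ((hasDerivAt_id t).smul_const d).const_add y₁
      exact (hf.hasFDerivAt_gradY x (y₁ + t • d)).comp_hasDerivAt t h3
    have hc2 : Continuous fun t => A t d := by fun_prop
    rw [intervalIntegral.integral_eq_sub_of_hasDerivAt h2 (hc2.intervalIntegrable 0 1)]
    simp [hd]
  · intro v
    rw [hform]
    calc c.μ * ‖v‖ ^ 2 = ∫ t in (0 : ℝ)..1, c.μ * ‖v‖ ^ 2 := by simp
      _ ≤ _ := intervalIntegral.integral_mono_on zero_le_one (by simp)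
        ((hcont v v).intervalIntegrable 0 1) fun t _ => hf.hessYY_ge x _ v
  · intro v
    rw [hform]
    calc _ ≤ ∫ t in (0 : ℝ)..1, c.L * ‖v‖ ^ 2 :=
        intervalIntegral.integral_mono_on zero_le_one ((hcont v v).intervalIntegrable 0 1)
          (by simp) fun t _ => hf.hessYY_le x _ v
      _ = _ := by simp
  · intro y₀ v
    rw [hform]
    have e1 : ⟪hessYY f x y₀ v, v⟫_ℝ = ∫ t in (0 : ℝ)..1, ⟪hessYY f x y₀ v, v⟫_ℝ := by simp
    rw [e1, ← intervalIntegral.integral_sub ((hcont v v).intervalIntegrable 0 1) (by simp)]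
    refine (intervalIntegral.abs_integral_le_integral_abs zero_le_one).trans ?_
    -- The distance to y₀ along the segment is bounded by interpolating the endpoint distances; the
    -- integral is their mean.
    have hbd : ∀ t ∈ Set.Icc (0 : ℝ) 1, |⟪A t v, v⟫_ℝ - ⟪hessYY f x y₀ v, v⟫_ℝ| ≤
        c.Lfyy * ‖v‖ ^ 2 * (‖y₁ - y₀‖ + t * (‖y₂ - y₀‖ - ‖y₁ - y₀‖)) := by
      intro t ht
      refine (hf.hessYY_form_lip x _ y₀ v).trans ?_
      have h1 : ‖y₁ + t • d - y₀‖ ≤ ‖y₁ - y₀‖ + t * (‖y₂ - y₀‖ - ‖y₁ - y₀‖) := by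
        have e : y₁ + t • d - y₀ = (1 - t) • (y₁ - y₀) + t • (y₂ - y₀) := by
          rw [hd]; module
        rw [e]
        refine (norm_add_le _ _).trans ?_
        rw [norm_smul, norm_smul, Real.norm_of_nonneg ht.1,
          Real.norm_of_nonneg (by linarith [ht.2])]
        linarith
      rw [mul_right_comm]
      exact mul_le_mul_of_nonneg_left h1 (mul_nonneg hf.Lfyy_nonneg (sq_nonneg _))
    refine (intervalIntegral.integral_mono_on zero_le_one
      (((hcont v v).sub continuous_const).abs.intervalIntegrable 0 1)
      ((by fun_prop : Continuous fun t : ℝ => c.Lfyy * ‖v‖ ^ 2 *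
        (‖y₁ - y₀‖ + t * (‖y₂ - y₀‖ - ‖y₁ - y₀‖))).intervalIntegrable 0 1) hbd).trans
      (le_of_eq ?_)
    rw [intervalIntegral.integral_const_mul, intervalIntegral.integral_add (by simp)
      ((by fun_prop : Continuous fun t : ℝ => t * (‖y₂ - y₀‖ - ‖y₁ - y₀‖)).intervalIntegrable 0 1),
      intervalIntegral.integral_mul_const, integral_id]
    simp
    ring

/-- Gradient descent contracts towards a critical point. -/
theorem gd_contract {β : ℝ} (hβ : 0 ≤ β) (hβL : β ≤ 2 / (c.L + c.μ)) (hL : c.μ ≤ c.L) (x : E m)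
    (y₁ y₂ : E n) :
    ‖(y₂ - β • gradY f x y₂) - (y₁ - β • gradY f x y₁)‖ ≤ (1 - β * c.μ) * ‖y₂ - y₁‖ := by
  obtain ⟨J, hJs, hJ, hlo, hup, -⟩ := hf.exists_mean_hess x y₁ y₂
  have hμ := hf.μ_pos
  rw [le_div_iff₀ (by linarith)] at hβL
  have hc : 0 ≤ 1 - β * c.μ := by nlinarith
  have h := norm_le_of_symm_form_bound (X := ContinuousLinearMap.id ℝ (E n) - β • J) ?_ hc ?_
    (y₂ - y₁)
  · convert! h using 2
    simp only [sub_apply, ContinuousLinearMap.id_apply, FunLike.coe_smul, Pi.smul_apply, ← hJ,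
      smul_sub]
    abel
  · intro v w
    simp [inner_sub_left, inner_sub_right, inner_smul_left, inner_smul_right, hJs]
  · intro v
    simp only [sub_apply, ContinuousLinearMap.id_apply, FunLike.coe_smul, Pi.smul_apply,
      inner_sub_left, inner_smul_left, real_inner_self_eq_norm_sq, RCLike.conj_to_real]
    have h1 := mul_le_mul_of_nonneg_left (hlo v) hβ
    have h2 := mul_le_mul_of_nonneg_left (hup v) hβ
    -- The condition β(L + μ) ≤ 2 means βL - 1 ≤ 1 - βμ, so 1 - βμ bounds I - βJ from both sides.
    have h3 : β * (c.L * ‖v‖ ^ 2) ≤ (2 - β * c.μ) * ‖v‖ ^ 2 := by nlinarith [sq_nonneg ‖v‖]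
    rw [abs_le]
    constructor <;> nlinarith

/-- A gradient step is a contraction, and its Banach fixed point is critical; no coercivity argument
is needed. -/
theorem exists_critical (hL : c.μ ≤ c.L) (x : E m) : ∃ y, gradY f x y = 0 := by
  have hμ := hf.μ_pos
  set β := 2 / (c.L + c.μ) with hβ
  have hβ0 : 0 < β := div_pos two_pos (by linarith)
  have hβμ : β * c.μ ≤ 1 := by
    rw [hβ, div_mul_eq_mul_div, div_le_one (by linarith)]; linarith
  have hK : ContractingWith (Real.toNNReal (1 - β * c.μ)) fun y => y - β • gradY f x y := by
    refine ⟨?_, LipschitzWith.of_dist_le_mul fun y₁ y₂ => ?_⟩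
    · rw [Real.toNNReal_lt_one]
      nlinarith
    · rw [dist_eq_norm, dist_eq_norm, Real.coe_toNNReal _ (by linarith)]
      exact hf.gd_contract hβ0.le le_rfl hL x y₂ y₁
  have hfix := hK.fixedPoint_isFixedPt
  refine ⟨hK.fixedPoint, ?_⟩
  have h1 : hK.fixedPoint - β • gradY f x hK.fixedPoint = hK.fixedPoint := hfix
  rw [sub_eq_self] at h1
  exact (smul_eq_zero.1 h1).resolve_left hβ0.ne'

theorem isMin_of_critical {x : E m} {y : E n} (hy : gradY f x y = 0) (y' : E n) :
    f x y ≤ f x y' := by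
  have hc := hf.convexOn_line x y (y' - y)
  have h1 := hc.le_slope_of_hasDerivAt (Set.mem_univ 0) (Set.mem_univ 1) one_pos
    (hf.hasDerivAt_shifted x y (y' - y) 0)
  simp only [zero_smul, add_zero, hy, inner_zero_left, slope_def_field, one_smul,
    add_sub_cancel, sub_zero, div_one] at h1
  have h2 : ‖y'‖ ^ 2 = ‖y' - y‖ ^ 2 + 2 * ⟪y, y' - y⟫_ℝ + ‖y‖ ^ 2 := by
    have := norm_add_sq_real (y' - y) y
    rw [sub_add_cancel] at this
    rw [this, real_inner_comm]
  have h3 := mul_nonneg hf.μ_pos.le (sq_nonneg ‖y' - y‖)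
  rw [h2] at h1
  linarith

theorem gradY_yStar (hL : c.μ ≤ c.L) (x : E m) : gradY f x (yStar f x) = 0 := by
  obtain ⟨y, hy⟩ := hf.exists_critical hL x
  have hmin : ∀ y', f x (yStar f x) ≤ f x y' :=
    Classical.epsilon_spec (p := fun y => ∀ y', f x y ≤ f x y') ⟨y, hf.isMin_of_critical hy⟩
  have h1 : IsLocalMin (f x) (yStar f x) := Filter.Eventually.of_forall hmin
  rw [gradY, gradient, h1.fderiv_eq_zero, map_zero]

theorem gdIter_le {β : ℝ} (hβ : 0 ≤ β) (hβL : β ≤ 2 / (c.L + c.μ)) (hL : c.μ ≤ c.L) (x : E m)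
    (y : E n) (j : ℕ) :
    ‖gdIter f β x y j - yStar f x‖ ≤ (1 - β * c.μ) ^ j * ‖y - yStar f x‖ := by
  have hμ := hf.μ_pos
  have hc : 0 ≤ 1 - β * c.μ := by
    rw [le_div_iff₀ (by linarith)] at hβL
    nlinarith
  induction j with
  | zero => simp [gdIter]
  | succ j ih =>
    have h1 := hf.gd_contract hβ hβL hL x (yStar f x) (gdIter f β x y j)
    rw [hf.gradY_yStar hL, smul_zero, sub_zero] at h1
    rw [gdIter, pow_succ, mul_comm _ (1 - β * c.μ), mul_assoc]
    exact h1.trans (mul_le_mul_of_nonneg_left ih hc)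

end LowerAssumption

end calculus

/-! ### The iterations in the coordinates of a reference Hessian -/

section link

variable {m n : ℕ}

theorem PosPair.norm_sqrt_sq {S R A : E n →L[ℝ] E n} (hR : PosPair S R) (hA : ∀ v, R (R v) = A v)
    (v : E n) : ‖R v‖ ^ 2 = ⟪A v, v⟫_ℝ := by
  rw [← hA, hR.symm, real_inner_self_eq_norm_sq]

theorem PosPair.inverse_sqrt {S R A : E n →L[ℝ] E n} (hR : PosPair S R) (hA : ∀ v, R (R v) = A v)
    (hs : ∀ v w, ⟪A v, w⟫_ℝ = ⟪v, A w⟫_ℝ) : PosPair (S ∘L S) A where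
  left v := by simp [← hA, hR.left]
  right v := by simp [← hA, hR.right]
  symm := hs
  pos v hv := by
    rw [← hR.norm_sqrt_sq hA]
    have : R v ≠ 0 := fun h => hv (by rw [← hR.left v, h, map_zero])
    positivity

/-- The error of a solution of a linear system, in the coordinates of its matrix. -/
theorem PosPair.solve_error {S R A : E n →L[ℝ] E n} (hR : PosPair S R) (hA : ∀ v, R (R v) = A v)
    (hs : ∀ v w, ⟪A v, w⟫_ℝ = ⟪v, A w⟫_ℝ) {μ : ℝ} (hlo : ∀ v, μ * ‖v‖ ^ 2 ≤ ⟪A v, v⟫_ℝ)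
    (H : E n →L[ℝ] E n) (d : E n) :
    μ * ‖A.inverse d - H d‖ ^ 2 ≤ ‖(R ∘L H ∘L R) (S d) - S d‖ ^ 2 := by
  rw [(hR.inverse_sqrt hA hs).inverse_eq]
  refine (hlo _).trans (le_of_eq ?_)
  rw [← hR.norm_sqrt_sq hA, ← norm_neg]
  congr 2
  simp [hR.right]

theorem PosPair.norm_inv_sqrt_le {S R A : E n →L[ℝ] E n} (hR : PosPair S R)
    (hA : ∀ v, R (R v) = A v) {μ : ℝ} (hlo : ∀ v, μ * ‖v‖ ^ 2 ≤ ⟪A v, v⟫_ℝ) (v : E n) :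
    μ * ‖S v‖ ^ 2 ≤ ‖v‖ ^ 2 := by
  have := hlo (S v)
  rwa [← hR.norm_sqrt_sq hA, hR.right] at this

theorem localNorm_eq {f : E m → E n → ℝ} {x : E m} {y : E n} {S R : E n →L[ℝ] E n} (hR : PosPair S R)
    (hA : ∀ v, R (R v) = hessYY f x y v) (v : E n) : localNorm f x y v = ‖R v‖ := by
  rw [localNorm, ← hR.norm_sqrt_sq hA, Real.sqrt_sq (norm_nonneg _)]

namespace Consts

theorem M_mul (c : Consts) (hμ : 0 < c.μ) : c.M * (c.μ * √c.μ) = c.Lfyy := by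
  have h : c.μ ^ (3 / 2 : ℝ) = c.μ * √c.μ := by
    rw [show (3 / 2 : ℝ) = 1 + 1 / 2 by norm_num, Real.rpow_add hμ, Real.rpow_one,
      Real.sqrt_eq_rpow]
  have : 0 < √c.μ := Real.sqrt_pos.2 hμ
  rw [M, h, div_mul_cancel₀ _ (by positivity)]

end Consts

namespace LowerAssumption

variable {f : E m → E n → ℝ} {c : Consts} (hf : LowerAssumption f c)

include hf

theorem M_nonneg : 0 ≤ c.M := div_nonneg hf.Lfyy_nonneg (Real.rpow_nonneg hf.μ_pos.le _)

/-- An operator close to a reference Hessian is close to the identity in its coordinates. -/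
theorem conj_near {x : E m} {y₀ : E n} {S R : E n →L[ℝ] E n} (hR : PosPair S R)
    (hA : ∀ v, R (R v) = hessYY f x y₀ v) {J : E n →L[ℝ] E n}
    (hJs : ∀ v w, ⟪J v, w⟫_ℝ = ⟪v, J w⟫_ℝ) (hlo : ∀ v, c.μ * ‖v‖ ^ 2 ≤ ⟪J v, v⟫_ℝ) {y₁ y₂ : E n}
    (hJ : ∀ v, |⟪J v, v⟫_ℝ - ⟪hessYY f x y₀ v, v⟫_ℝ| ≤
      c.Lfyy * ((‖y₁ - y₀‖ + ‖y₂ - y₀‖) / 2) * ‖v‖ ^ 2) :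
    Near (1 + (c.M * ‖R (y₁ - y₀)‖ + c.M * ‖R (y₂ - y₀)‖) / 2) (S ∘L J ∘L S) := by
  have hμ := hf.μ_pos
  have hM := hf.M_nonneg
  have hsq : 0 < √c.μ := Real.sqrt_pos.2 hμ
  have hsq2 : √c.μ ^ 2 = c.μ := Real.sq_sqrt hμ.le
  have hn : ∀ v : E n, √c.μ * ‖v‖ ≤ ‖R v‖ := fun v => by
    have := hf.hessYY_ge x y₀ v
    rw [← hR.norm_sqrt_sq hA] at this
    refine le_of_sq_le_sq ?_ (norm_nonneg _)
    rwa [mul_pow, hsq2]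
  -- The power μ^(3/2) in M consists of √μ, which converts Euclidean distances to local ones, and μ,
  -- which normalizes the form.
  have hkey : c.Lfyy * ((‖y₁ - y₀‖ + ‖y₂ - y₀‖) / 2) ≤
      c.μ * ((c.M * ‖R (y₁ - y₀)‖ + c.M * ‖R (y₂ - y₀)‖) / 2) := by
    rw [← c.M_mul hμ]
    have h1 := mul_le_mul_of_nonneg_left (hn (y₁ - y₀)) (mul_nonneg hM hμ.le)
    have h2 := mul_le_mul_of_nonneg_left (hn (y₂ - y₀)) (mul_nonneg hM hμ.le)
    linarith
  set η := (c.M * ‖R (y₁ - y₀)‖ + c.M * ‖R (y₂ - y₀)‖) / 2 with hη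
  have hη0 : 0 ≤ η := by positivity
  have hS : ∀ v, ‖v‖ ^ 2 = ⟪hessYY f x y₀ (S v), S v⟫_ℝ := fun v => by
    rw [← hR.norm_sqrt_sq hA, hR.right]
  have hbd : ∀ v, |⟪J (S v), S v⟫_ℝ - ‖v‖ ^ 2| ≤ c.μ * η * ‖S v‖ ^ 2 := fun v => by
    rw [hS]
    exact (hJ (S v)).trans (mul_le_mul_of_nonneg_right hkey (sq_nonneg _))
  refine ⟨fun v w => by simp [hR.symm_inv, hJs], fun v => ?_, fun v => ?_⟩
  · have h1 := (abs_le.1 (hbd v)).1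
    -- Measuring the deviation by J itself gives I ≤ (1 + η)J, where the reference Hessian would
    -- give only (1 - η)I ≤ J. The upper bound uses the reference Hessian.
    have h2 := mul_le_mul_of_nonneg_left (hlo (S v)) hη0
    simp only [ContinuousLinearMap.comp_apply, hR.symm_inv] at h1 ⊢
    linarith
  · have h1 := (abs_le.1 (hbd v)).2
    have h2 := mul_le_mul_of_nonneg_left
      (hR.norm_inv_sqrt_le hA (hf.hessYY_ge x y₀) v) hη0
    simp only [ContinuousLinearMap.comp_apply, hR.symm_inv] at h1 ⊢
    linarith

theorem exists_conj_mean {x : E m} {y₀ : E n} {S R : E n →L[ℝ] E n} (hR : PosPair S R)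
    (hA : ∀ v, R (R v) = hessYY f x y₀ v) (y₁ y₂ : E n) :
    ∃ J, Near (1 + (c.M * ‖R (y₁ - y₀)‖ + c.M * ‖R (y₂ - y₀)‖) / 2) J ∧
      S (gradY f x y₂) - S (gradY f x y₁) = J (R (y₂ - y₁)) := by
  obtain ⟨J, hJs, hJ, hlo, -, hJd⟩ := hf.exists_mean_hess x y₁ y₂
  refine ⟨_, hf.conj_near hR hA hJs hlo (hJd y₀), ?_⟩
  simp [hR.left, ← hJ]

theorem exists_hess_sqrt (x : E m) (y : E n) :
    ∃ S R : E n →L[ℝ] E n, PosPair S R ∧ ∀ v, R (R v) = hessYY f x y v := by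
  obtain ⟨H, hH⟩ := hf.exists_hess_pair x y
  exact hH.exists_sqrt

theorem one_le_κ (hL : c.μ ≤ c.L) : 1 ≤ c.κ := (one_le_div hf.μ_pos).2 hL

/-- The initial matrix `L⁻¹ I` in the coordinates of a reference Hessian. -/
theorem conj_init (hL : c.μ ≤ c.L) {x : E m} {y : E n} {S R : E n →L[ℝ] E n} (hR : PosPair S R)
    (hA : ∀ v, R (R v) = hessYY f x y v) :
    (∃ B, PosPair (R ∘L ((1 / c.L) • ContinuousLinearMap.id ℝ (E n)) ∘L R) B) ∧
    (∀ v, 1 / c.κ * ‖v‖ ^ 2 ≤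
      ⟪(R ∘L ((1 / c.L) • ContinuousLinearMap.id ℝ (E n)) ∘L R) v, v⟫_ℝ) ∧
    (∀ v, ⟪(R ∘L ((1 / c.L) • ContinuousLinearMap.id ℝ (E n)) ∘L R) v, v⟫_ℝ ≤ ‖v‖ ^ 2) := by
  have hμ := hf.μ_pos
  have hL0 : 0 < c.L := hμ.trans_le hL
  have hform : ∀ v, ⟪(R ∘L ((1 / c.L) • ContinuousLinearMap.id ℝ (E n)) ∘L R) v, v⟫_ℝ =
      ⟪hessYY f x y v, v⟫_ℝ / c.L := fun v => by
    simp [inner_smul_left, hA]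
    ring
  refine ⟨⟨_, hR.conj (B := c.L • ContinuousLinearMap.id ℝ (E n)) ?_⟩, fun v => ?_, fun v => ?_⟩
  · refine ⟨fun v => ?_, fun v => ?_, fun v w => ?_, fun v hv => ?_⟩
    · simp [smul_smul, hL0.ne']
    · simp [smul_smul, hL0.ne']
    · simp [inner_smul_left, inner_smul_right]
    · have := real_inner_self_pos.2 hv
      simp only [FunLike.coe_smul, Pi.smul_apply, ContinuousLinearMap.id_apply, inner_smul_left,
        RCLike.conj_to_real]
      positivity
  · rw [hform, le_div_iff₀ hL0, Consts.κ]
    refine le_trans (le_of_eq ?_) (hf.hessYY_ge x y v)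
    field_simp
  · rw [hform, div_le_iff₀ hL0, mul_comm]
    exact hf.hessYY_le x y v

/-! #### The quasi-Newton phase of subroutine `𝒜` -/

theorem qnSeq (hL : c.μ ≤ c.L) (x : E m) (y : E n) {S R : E n →L[ℝ] E n} (hR : PosPair S R)
    (hA : ∀ v, R (R v) = hessYY f x (yStar f x) v) :
    let p := qnIter f ((1 / c.L) • ContinuousLinearMap.id ℝ (E n)) 1 x y
    QNSeq c.M c.κ (fun t => R ((p t).1 - yStar f x)) (fun t => S (gradY f x (p t).1))
      (fun t => R ∘L (p t).2 ∘L R) := by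
  intro p
  obtain ⟨h1, h2, h3⟩ := hf.conj_init hL hR hA
  have hgs : gradY f x (yStar f x) = 0 := hf.gradY_yStar hL x
  have hps : ∀ t, (p (t + 1)).1 = (p t).1 - (p t).2 (gradY f x (p t).1) := fun t => by
    simp only [p, qnIter, one_smul]
  refine ⟨hf.M_nonneg, hf.one_le_κ hL, h1, h2, h3, fun i => ?_, fun i => ?_, fun i => ?_,
    fun i => ?_⟩
  · simp only [hps, ContinuousLinearMap.comp_apply, hR.right]
    rw [← map_sub]
    congr 1
    abel
  · rw [← map_sub, ← map_sub, ← bfgsUpdate_conj hR, sub_sub_sub_cancel_right]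
    rfl
  · obtain ⟨J, hJ, hJ2⟩ := hf.exists_conj_mean hR hA (yStar f x) (p i).1
    refine ⟨J, ?_, ?_⟩
    · simpa using hJ
    · simpa [hgs] using hJ2
  · obtain ⟨J, hJ, hJ2⟩ := hf.exists_conj_mean hR hA (p i).1 (p (i + 1)).1
    refine ⟨J, hJ, ?_⟩
    rw [hJ2, ← map_sub, sub_sub_sub_cancel_right]

/-- Local distances are at most √L times Euclidean ones, which turns √μ/L in K₁ into √(1/κ). The
number 0.4415 is 2 ln(3/2)/(3/2)^(3/2) rounded up. -/
theorem warm_start (hn : 1 ≤ n) {x : E m} {y : E n} (hw : c.Lfyy = 0 ∨ ‖y - yStar f x‖ ≤ c.K₁ n)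
    {S R : E n →L[ℝ] E n} (hR : PosPair S R) (hA : ∀ v, R (R v) = hessYY f x (yStar f x) v) :
    c.M * ‖R (y - yStar f x)‖ ≤ 0.4415 * √(1 / c.κ) *
      max (1 / (2 * c.κ)) (1 / (8 * n * Real.log (2 * c.κ) + 9)) := by
  have hL := hf.μ_le_L hn
  have hμ := hf.μ_pos
  have hL0 : 0 < c.L := hμ.trans_le hL
  have hκ := hf.one_le_κ hL
  have hκ0 : 0 < c.κ := by linarith
  have hmax : 0 ≤ max (1 / (2 * c.κ)) (1 / (8 * n * Real.log (2 * c.κ) + 9)) :=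
    le_max_of_le_left (by positivity)
  -- Then M = 0 and any start is admissible; division by zero gives K₁ the value 0 instead of ∞,
  -- whence the alternative in `hw`.
  by_cases h0 : c.Lfyy = 0
  · have : c.M = 0 := by rw [Consts.M, h0, zero_div]
    rw [this, zero_mul]
    positivity
  · have hM : 0 < c.M := div_pos (lt_of_le_of_ne hf.Lfyy_nonneg (Ne.symm h0))
      (Real.rpow_pos_of_pos hμ _)
    have hw := hw.resolve_left h0
    have hsL : 0 < √c.L := Real.sqrt_pos.2 hL0
    have hsL2 : √c.L * √c.L = c.L := Real.mul_self_sqrt hL0.le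
    have h1 : ‖R (y - yStar f x)‖ ≤ √c.L * ‖y - yStar f x‖ := by
      have := hf.hessYY_le x (yStar f x) (y - yStar f x)
      rw [← hR.norm_sqrt_sq hA] at this
      refine le_of_sq_le_sq ?_ (by positivity)
      rwa [mul_pow, Real.sq_sqrt hL0.le]
    have hr : (1.8371 : ℝ) ≤ (3 / 2 : ℝ) ^ (3 / 2 : ℝ) := by
      have e : (3 / 2 : ℝ) ^ (3 / 2 : ℝ) = 3 / 2 * √(3 / 2) := by
        rw [show (3 / 2 : ℝ) = 1 + 1 / 2 by norm_num, Real.rpow_add (by norm_num), Real.rpow_one,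
          Real.sqrt_eq_rpow]
      have : (1.22474 : ℝ) ≤ √(3 / 2) := Real.le_sqrt_of_sq_le (by norm_num)
      rw [e]
      linarith
    have hlog := log_three_halves_le
    have h2 : 2 * Real.log (3 / 2) / (3 / 2 : ℝ) ^ (3 / 2 : ℝ) ≤ 0.4415 := by
      rw [div_le_iff₀ (by linarith)]
      linarith
    have e1 : c.M * (√c.L * c.K₁ n) = 2 * Real.log (3 / 2) / (3 / 2 : ℝ) ^ (3 / 2 : ℝ) *
        √(1 / c.κ) * max (1 / (2 * c.κ)) (1 / (8 * n * Real.log (2 * c.κ) + 9)) := by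
      have e2 : √(1 / c.κ) = √c.μ / √c.L := by
        rw [Consts.κ, one_div_div, Real.sqrt_div hμ.le]
      have e3 : 1 / (2 * c.κ) = c.μ / (2 * c.L) := by rw [Consts.κ]; field_simp
      have e4 : 2 * c.κ = 2 * c.L / c.μ := by rw [Consts.κ, mul_div_assoc]
      rw [e2, e3, e4, Consts.K₁, Consts.K₀]
      have : (0 : ℝ) < (3 / 2 : ℝ) ^ (3 / 2 : ℝ) := by linarith
      nth_rewrite 2 [← hsL2]
      field_simp
    calc c.M * ‖R (y - yStar f x)‖ ≤ c.M * (√c.L * c.K₁ n) :=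
        mul_le_mul_of_nonneg_left (h1.trans (mul_le_mul_of_nonneg_left hw hsL.le)) hM.le
      _ ≤ _ := by
        rw [e1]
        gcongr

/-- The rate in local coordinates carries one κ, and the return to Euclidean norms a second one. -/
theorem qnIter_rate (hn : 1 ≤ n) {x : E m} {y : E n}
    (hw : c.Lfyy = 0 ∨ ‖y - yStar f x‖ ≤ c.K₁ n) {T : ℕ} (hT : c.K₀ n ≤ T) :
    ‖(qnIter f ((1 / c.L) • ContinuousLinearMap.id ℝ (E n)) 1 x y T).1 - yStar f x‖ ^ 2 ≤
      4 * c.κ ^ 2 * (c.tc n / T) ^ T * ‖y - yStar f x‖ ^ 2 := by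
  obtain ⟨S, R, hR, hA⟩ := hf.exists_hess_sqrt x (yStar f x)
  have hL := hf.μ_le_L hn
  have hμ := hf.μ_pos
  have hL0 : 0 < c.L := hμ.trans_le hL
  have hκ := hf.one_le_κ hL
  have e4 : 2 * c.κ = 2 * c.L / c.μ := by rw [Consts.κ, mul_div_assoc]
  have h := (hf.qnSeq hL x y hR hA).local_rate hn (hf.warm_start hn hw hR hA) (T := T)
    (by rw [e4]; exact hT)
  have e5 : 9 * n * Real.log (2 * c.κ) = c.tc n := by rw [Consts.tc, Consts.K₀, e4]; ring
  rw [e5] at h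
  rw [hR.norm_sqrt_sq hA, hR.norm_sqrt_sq hA] at h
  have h1 := (hf.hessYY_ge _ _ _).trans h
  have h2 := hf.hessYY_le x (yStar f x) (y - yStar f x)
  have hlog : 0 ≤ Real.log (2 * c.κ) := Real.log_nonneg (by linarith)
  have h3 : 0 ≤ (c.tc n / T) ^ T := by rw [← e5]; positivity
  have h4 := h1.trans (mul_le_mul_of_nonneg_left h2 (by positivity))
  have e6 : c.L = c.κ * c.μ := by rw [Consts.κ, div_mul_cancel₀ _ hμ.ne']
  refine le_of_mul_le_mul_left (h4.trans (le_of_eq ?_)) hμ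
  rw [e6]
  ring

theorem one_sub_nonneg (hL : c.μ ≤ c.L) {β : ℝ} (hβL : β ≤ 2 / (c.L + c.μ)) (hβ : 0 ≤ β) :
    0 ≤ 1 - β * c.μ := by
  have hμ := hf.μ_pos
  rw [le_div_iff₀ (by linarith)] at hβL
  nlinarith

theorem contr_nonneg (hn : 1 ≤ n) {β : ℝ} (hβL : β ≤ 2 / (c.L + c.μ)) (hβ : 0 ≤ β) (T P : ℕ) :
    0 ≤ c.contr n T P β := by
  have hL := hf.μ_le_L hn
  have h1 := hf.one_sub_nonneg hL hβL hβ
  have h2 := hf.one_le_κ hL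
  rw [Consts.contr]
  positivity

/-- Subroutine `𝒜` contracts the squared distance to `y^*`. -/
theorem subA_contr (hn : 1 ≤ n) {β : ℝ} (hβ : 0 ≤ β) (hβL : β ≤ 2 / (c.L + c.μ)) {x : E m}
    {y : E n} {P T : ℕ} (hw : c.Lfyy = 0 ∨ (1 - β * c.μ) ^ P * ‖y - yStar f x‖ ≤ c.K₁ n)
    (hT : c.K₀ n ≤ T) :
    ‖(subA f ((1 / c.L) • ContinuousLinearMap.id ℝ (E n)) β 1 P T x y).1 - yStar f x‖ ^ 2 ≤
      c.contr n T P β * ‖y - yStar f x‖ ^ 2 := by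
  have hL := hf.μ_le_L hn
  have hμ := hf.μ_pos
  have hκ := hf.one_le_κ hL
  have hgd := hf.gdIter_le hβ hβL hL x y P
  have hq := hf.one_sub_nonneg hL hβL hβ
  have hq1 : (1 - β * c.μ) ^ P ≤ 1 := pow_le_one₀ hq (by nlinarith)
  have h1 := hf.qnIter_rate hn (hw.imp id hgd.trans) hT
  have htc : 0 ≤ c.tc n := by
    have : 0 ≤ Real.log (2 * c.L / c.μ) := Real.log_nonneg (by rw [le_div_iff₀ hμ]; linarith)
    rw [Consts.tc, Consts.K₀]
    positivity
  have hcl : c.cl n T ^ 2 = 4 * c.tc n ^ T := by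
    rw [Consts.cl, mul_pow, ← Real.rpow_natCast (c.tc n ^ _), ← Real.rpow_mul htc]
    norm_num
  have h2 : ‖gdIter f β x y P - yStar f x‖ ^ 2 ≤ (1 - β * c.μ) ^ P * ‖y - yStar f x‖ ^ 2 := by
    have h3 := pow_le_pow_left₀ (norm_nonneg _) hgd 2
    rw [mul_pow] at h3
    refine h3.trans (mul_le_mul_of_nonneg_right ?_ (sq_nonneg _))
    have : 0 ≤ (1 - β * c.μ) ^ P := by positivity
    nlinarith
  refine h1.trans ((mul_le_mul_of_nonneg_left h2 (by positivity)).trans ?_)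
  rw [← mul_assoc]
  refine mul_le_mul_of_nonneg_right ?_ (sq_nonneg _)
  rw [Consts.contr, hcl, div_pow, one_div, inv_pow, div_eq_mul_inv]
  have h4 : 0 ≤ 4 * c.tc n ^ T * ((T : ℝ) ^ T)⁻¹ * (1 - β * c.μ) ^ P := by positivity
  have h5 : c.κ ^ 2 ≤ c.κ ^ 3 := pow_le_pow_right₀ hκ (by norm_num)
  calc _ = 4 * c.tc n ^ T * ((T : ℝ) ^ T)⁻¹ * (1 - β * c.μ) ^ P * c.κ ^ 2 := by ring
    _ ≤ 4 * c.tc n ^ T * ((T : ℝ) ^ T)⁻¹ * (1 - β * c.μ) ^ P * c.κ ^ 3 :=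
      mul_le_mul_of_nonneg_left h5 h4
    _ = _ := by ring

/-- The last matrix of the quasi-Newton phase approximately solves the linear system. -/
theorem qnIter_solve (hn : 1 ≤ n) {x : E m} {y : E n}
    (hw : c.Lfyy = 0 ∨ ‖y - yStar f x‖ ≤ c.K₁ n) (T : ℕ) (d : E n) :
    let p := qnIter f ((1 / c.L) • ContinuousLinearMap.id ℝ (E n)) 1 x y T
    ‖(hessYY f x p.1).inverse d - p.2 d‖ ^ 2 ≤ 0.75 * c.κ / c.μ ^ 2 * ‖d‖ ^ 2 := by
  intro p
  obtain ⟨S, R, hR, hA⟩ := hf.exists_hess_sqrt x (yStar f x)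
  -- The bounds on the matrix refer to the Hessian at y*, the linear system to the Hessian at the
  -- last iterate. By M‖z_T‖ ≤ 0.221 these two forms agree up to a factor 1.221.
  obtain ⟨S', R', hR', hA'⟩ := hf.exists_hess_sqrt x p.1
  have hL := hf.μ_le_L hn
  have hμ := hf.μ_pos
  have hκ := hf.one_le_κ hL
  have hseq := hf.qnSeq hL x y hR hA
  have hconv := hseq.local_convergence hn (hf.warm_start hn hw hR hA) T
  obtain ⟨⟨B, hB⟩, hup, hlo⟩ := hseq.bounds T
  simp only at hconv hup hlo hB
  change _ ∧ c.M * ‖R (p.1 - yStar f x)‖ ≤ _ at hconv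
  change PosPair (R ∘L p.2 ∘L R) B at hB
  set Λ := ∑ j ∈ Finset.range T,
    (c.M * ‖R ((qnIter f ((1 / c.L) • ContinuousLinearMap.id ℝ (E n)) 1 x y j).1 - yStar f x)‖ +
      c.M * ‖R ((qnIter f ((1 / c.L) • ContinuousLinearMap.id ℝ (E n)) 1 x y (j + 1)).1 -
        yStar f x)‖)
  have hΛ : Real.exp Λ ≤ 3 / 2 := exp_le_three_halves hconv.1
  have hΛ' : 2 / 3 ≤ Real.exp (-Λ) := by
    rw [Real.exp_neg, show (2 / 3 : ℝ) = (3 / 2)⁻¹ by norm_num]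
    exact inv_anti₀ (Real.exp_pos _) hΛ
  have hnear : Near (1.221 : ℝ) (S ∘L hessYY f x p.1 ∘L S) := by
    have h := hf.conj_near hR hA (J := hessYY f x p.1) (hf.hessYY_symm x _) (hf.hessYY_ge x _)
      (y₁ := p.1) (y₂ := p.1) (fun v => by
        rw [add_self_div_two]; exact hf.hessYY_form_lip x _ _ v)
    rw [add_self_div_two] at h
    refine ⟨h.symm, fun v => ?_, fun v => ?_⟩
    · have h1 := h.lower v
      have h2 : 0 ≤ ⟪(S ∘L hessYY f x p.1 ∘L S) v, v⟫_ℝ := by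
        simp only [ContinuousLinearMap.comp_apply, hR.symm_inv]
        exact le_trans (by positivity) (hf.hessYY_ge x _ _)
      nlinarith [hconv.2]
    · have h1 := h.upper v
      nlinarith [hconv.2, sq_nonneg ‖v‖]
  have hAp : PosPair (S ∘L S) (hessYY f x (yStar f x)) := hR.inverse_sqrt hA (hf.hessYY_symm x _)
  have hAp' : PosPair (S' ∘L S') (hessYY f x p.1) := hR'.inverse_sqrt hA' (hf.hessYY_symm x _)
  have hcmp1 : ∀ v, ⟪hessYY f x (yStar f x) v, v⟫_ℝ ≤ 1.221 * ⟪hessYY f x p.1 v, v⟫_ℝ := fun v => by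
    have := hnear.lower (R v)
    rw [hR.norm_sqrt_sq hA] at this
    simpa [hR.left, hR.symm_inv] using this
  have hcmp2 : ∀ v, ⟪hessYY f x p.1 v, v⟫_ℝ ≤ 1.221 * ⟪hessYY f x (yStar f x) v, v⟫_ℝ := fun v => by
    have := hnear.upper (R v)
    rw [hR.norm_sqrt_sq hA] at this
    simpa [hR.left, hR.symm_inv] using this
  have hS1 : ∀ v, ‖S (R' v)‖ ^ 2 ≤ 1.221 * ‖v‖ ^ 2 := fun v => by
    have := hAp.inv_le hAp' hcmp2 (R' v)
    simpa [hR.symm_inv, hR'.symm_inv, hR'.left] using this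
  have hS2 : ∀ v, ‖v‖ ^ 2 ≤ 1.221 * ‖S (R' v)‖ ^ 2 := fun v => by
    have := hAp'.inv_le hAp hcmp1 (R' v)
    simpa [hR.symm_inv, hR'.symm_inv, hR'.left] using this
  have hform : ∀ v, ⟪(R' ∘L p.2 ∘L R') v, v⟫_ℝ = ⟪(R ∘L p.2 ∘L R) (S (R' v)), S (R' v)⟫_ℝ :=
    fun v => by simp [hR.right, hR.symm, hR'.symm]
  have hsymm : ∀ v w, ⟪p.2 v, w⟫_ℝ = ⟪v, p.2 w⟫_ℝ := fun v w => by
    have := hB.symm_inv (S v) (S w)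
    simpa [hR.left, hR.right, hR.symm, hR.symm_inv] using this
  have hcκ : 1 ≤ 1.8315 * c.κ := by linarith
  -- In the new coordinates the matrix lies between 1/(1.8315κ) and 1.8315 = 1.5 · 1.221, so q must
  -- dominate 0.8315 and 1 - 1/(1.8315κ).
  set q := √(0.75 * c.κ) with hq
  have hq2 : q ^ 2 = 0.75 * c.κ := Real.sq_sqrt (by positivity)
  have hX := norm_le_of_symm_form_bound
    (X := R' ∘L p.2 ∘L R' - ContinuousLinearMap.id ℝ (E n)) (c := q) ?_ (Real.sqrt_nonneg _) ?_
    (S' d)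
  · have h1 := hR'.solve_error hA' (hf.hessYY_symm x _) (hf.hessYY_ge x _) p.2 d
    have h2 := pow_le_pow_left₀ (norm_nonneg _) hX 2
    rw [mul_pow, hq2] at h2
    have h3 := hR'.norm_inv_sqrt_le hA' (hf.hessYY_ge x _) d
    have h4 := mul_le_mul_of_nonneg_left (h1.trans h2) hμ.le
    have h5 := mul_le_mul_of_nonneg_left h3 (by positivity : 0 ≤ 0.75 * c.κ)
    rw [div_mul_eq_mul_div, le_div_iff₀ (by positivity)]
    linarith
  · intro v w
    simp [inner_sub_left, inner_sub_right, hR'.symm, hsymm]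
  · intro v
    have h1 := hup (S (R' v))
    have h2 := hlo (S (R' v))
    rw [sub_apply, inner_sub_left, hform, ContinuousLinearMap.id_apply, real_inner_self_eq_norm_sq]
    have h3 := hS1 v
    have h4 := hS2 v
    have h5 : 0 ≤ ‖S (R' v)‖ ^ 2 := sq_nonneg _
    have h6 : 0 ≤ ‖v‖ ^ 2 := sq_nonneg _
    set N := ‖S (R' v)‖ ^ 2
    set V := ‖v‖ ^ 2
    have h7 : Real.exp Λ * N ≤ 1.8315 * V := by nlinarith
    have h8 : 1 / (1.8315 * c.κ) * V ≤ Real.exp (-Λ) / c.κ * N := by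
      have : V / 1.8315 ≤ Real.exp (-Λ) * N := by
        have := mul_le_mul_of_nonneg_right hΛ' h5
        rw [div_le_iff₀ (by norm_num)]
        linarith
      have h9 := div_le_div_of_nonneg_right this (by linarith : 0 ≤ c.κ)
      refine le_trans (le_of_eq ?_) (h9.trans (le_of_eq ?_))
      · field_simp
      · ring
    have hq_ge : 0.8315 ≤ q := Real.le_sqrt_of_sq_le (by nlinarith)
    have hq_ge' : 1 - 1 / (1.8315 * c.κ) ≤ q := by
      refine Real.le_sqrt_of_sq_le ?_
      set t := 1.8315 * c.κ with ht
      have ht1 : 1.8315 ≤ t := by linarith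
      have h10 : (1 - 1 / t) ^ 2 ≤ t / 4 := by
        have : (1 - 1 / t) ^ 2 = (t - 1) ^ 2 / t ^ 2 := by field_simp
        rw [this, div_le_div_iff₀ (by positivity) (by norm_num)]
        nlinarith [mul_nonneg (by linarith : 0 ≤ t - 1.8315) (sq_nonneg (t - 1.8315))]
      linarith
    rw [abs_le]
    constructor
    · change _ ≤ ⟪(R ∘L p.2 ∘L R) _, _⟫_ℝ at h2
      nlinarith
    · change ⟪(R ∘L p.2 ∘L R) _, _⟫_ℝ ≤ _ at h1
      nlinarith

/-! #### Subroutine `ℬ` -/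

/-- All secants start at the point whose Hessian is the reference, so the mean Hessian deviates by
only M‖s_i‖/2 in local norm. The factor μ⁻² comes from converting the solution and d to Euclidean
norms. -/
theorem subB_solve (hn : 1 ≤ n) {ζ : ℕ → ℝ} (hζ : ∀ i, 0 < ζ i) (x : E m) (y d : E n) {Q : ℕ}
    (hQ : 1 ≤ Q) {ξ : ℝ} (hξ : ξ = Real.exp (c.M * ∑ j ∈ Finset.range Q, localNorm f x y
      (ζ j • subB f ((1 / c.L) • ContinuousLinearMap.id ℝ (E n)) ζ x y d j))) :
    ∃ i < Q, Q * ‖(hessYY f x y).inverse d -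
        subB f ((1 / c.L) • ContinuousLinearMap.id ℝ (E n)) ζ x y d i‖ ^ 2 ≤
      2 * n * c.κ * (ξ ^ 2 + ξ) / c.μ ^ 2 * ‖d‖ ^ 2 := by
  obtain ⟨S, R, hR, hA⟩ := hf.exists_hess_sqrt x y
  have hL := hf.μ_le_L hn
  have hμ := hf.μ_pos
  have hκ := hf.one_le_κ hL
  obtain ⟨⟨B, hB⟩, hlo, hup⟩ := hf.conj_init hL hR hA
  set H := subBMat f ((1 / c.L) • ContinuousLinearMap.id ℝ (E n)) ζ x y d with hH
  have hHd : ∀ i, (R ∘L H i ∘L R) (S d) = R (H i d) := fun i => by simp [hR.right]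
  have hmean := fun i => hf.exists_conj_mean hR hA y (y + ζ i • H i d)
  choose J hJ hJ2 using hmean
  obtain ⟨i, hi, h⟩ := exists_direction_error_le hn hf.M_nonneg hκ (d := S d)
    (H := fun i => R ∘L H i ∘L R) (J := J) hζ hB hlo hup
    (fun i => by
      have := hJ i
      rw [hHd, ← map_smul]
      simpa using this)
    (fun i => by
      have := hJ2 i
      rw [add_sub_cancel_left, ← map_sub] at this
      rw [hHd, ← map_smul, ← this, ← bfgsUpdate_conj hR]
      rfl) hQ (ξ := ξ)
    (by
      rw [hξ]
      congr 2
      refine Finset.sum_congr rfl fun j _ => ?_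
      rw [hHd, ← map_smul, localNorm_eq hR hA]
      rfl)
  refine ⟨i, hi, ?_⟩
  have h1 := hR.solve_error hA (hf.hessYY_symm x _) (hf.hessYY_ge x _) (H i) d
  have h3 := hR.norm_inv_sqrt_le hA (hf.hessYY_ge x _) d
  have hξ0 : 0 < ξ := hξ ▸ Real.exp_pos _
  have h4 := mul_le_mul_of_nonneg_left h1 (Nat.cast_nonneg Q : (0 : ℝ) ≤ Q)
  have h5 := mul_le_mul_of_nonneg_left (h4.trans h) hμ.le
  have h6 := mul_le_mul_of_nonneg_left h3 (by positivity : 0 ≤ 2 * n * c.κ * (ξ ^ 2 + ξ))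
  rw [div_mul_eq_mul_div, le_div_iff₀ (by positivity)]
  change Q * ‖(hessYY f x y).inverse d - H i d‖ ^ 2 * c.μ ^ 2 ≤ _
  linarith

end LowerAssumption

end link

open scoped Topology

/-! ### The hypergradient -/

section hypergradient

variable {m n : ℕ} {F f : E m → E n → ℝ} {c : Consts}

theorem inner_gradient_eq {d : ℕ} (g : E d → ℝ) (z v : E d) :
    ⟪gradient g z, v⟫_ℝ = fderiv ℝ g z v := by
  rw [← InnerProductSpace.toDual_apply_apply, toDual_gradient]

theorem UpperAssumption.fderiv_eq (hF : UpperAssumption F c) (x : E m) (y : E n)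
    (p : E m × E n) : fderiv ℝ (fun p : E m × E n => F p.1 p.2) (x, y) p =
      ⟪gradX F x y, p.1⟫_ℝ + ⟪gradY F x y, p.2⟫_ℝ := by
  have h := (hF.differentiable (x, y)).hasFDerivAt
  have h2 := HasFDerivAt.comp (f := fun e => (e, y)) x h (hasFDerivAt_prodMk_left x y)
  have h3 := HasFDerivAt.comp y h (hasFDerivAt_prodMk_right x y)
  have e2 : fderiv ℝ (fun x' => F x' y) x = _ := h2.fderiv
  have e3 : fderiv ℝ (fun y' => F x y') y = _ := h3.fderiv
  rw [gradX, gradY, inner_gradient_eq, inner_gradient_eq, e2, e3]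
  simp [← map_add]

theorem UpperAssumption.CFy_nonneg (hF : UpperAssumption F c) : 0 ≤ c.CFy :=
  (norm_nonneg _).trans (hF.gradY_bound 0 0)

/-- The direction `∇_x F - (∇²_{xy} f)ᵀ (∇²_{yy} f)⁻¹ ∇_y F`. -/
def hyperGrad (F f : E m → E n → ℝ) (x : E m) (y : E n) : E m :=
  gradX F x y - (hessXY f x y).adjoint ((hessYY f x y).inverse (gradY F x y))

namespace LowerAssumption

variable (hf : LowerAssumption f c)

include hf

theorem Mfxy_nonneg : 0 ≤ c.Mfxy := (norm_nonneg _).trans (hf.hessXY_bound 0 0)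

theorem hasFDerivAt_gradY_left (x : E m) (y : E n) :
    HasFDerivAt (fun x => gradY f x y) (hessXY f x y) x := by
  have h := HasFDerivAt.comp (f := fun e => (e, y)) x
    (hf.hasStrictFDerivAt_gradY_joint x y).hasFDerivAt (hasFDerivAt_prodMk_left x y)
  exact h.differentiableAt.hasFDerivAt

theorem gradY_lip_left (x₁ x₂ : E m) (y : E n) :
    ‖gradY f x₁ y - gradY f x₂ y‖ ≤ c.Mfxy * ‖x₁ - x₂‖ :=
  Convex.norm_image_sub_le_of_norm_hasFDerivWithin_le
    (fun x _ => (hf.hasFDerivAt_gradY_left x y).hasFDerivWithinAt)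
    (fun x _ => hf.hessXY_bound x y) convex_univ (Set.mem_univ _) (Set.mem_univ _)

theorem Ly_nonneg : 0 ≤ c.Ly := div_nonneg hf.Mfxy_nonneg hf.μ_pos.le

/-- Strong monotonicity of ∇_y f(x₁, ·) between the two minimizers is compared with the change of
∇_y f(·, y₂) from x₂, where it vanishes, to x₁. -/
theorem yStar_lip (hL : c.μ ≤ c.L) (x₁ x₂ : E m) :
    ‖yStar f x₁ - yStar f x₂‖ ≤ c.Ly * ‖x₁ - x₂‖ := by
  have hμ := hf.μ_pos
  set y₁ := yStar f x₁ with hy₁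
  set y₂ := yStar f x₂ with hy₂
  have g₁ : gradY f x₁ y₁ = 0 := hf.gradY_yStar hL x₁
  have g₂ : gradY f x₂ y₂ = 0 := hf.gradY_yStar hL x₂
  have h1 := hf.gradY_monotone x₁ y₂ y₁
  have h2 := hf.gradY_lip_left x₁ x₂ y₂
  rw [g₂, sub_zero] at h2
  rw [g₁, zero_sub] at h1
  have h3 := real_inner_le_norm (-gradY f x₁ y₂) (y₁ - y₂)
  rw [norm_neg] at h3
  by_cases h0 : ‖y₁ - y₂‖ = 0
  · rw [h0]
    exact mul_nonneg hf.Ly_nonneg (norm_nonneg _)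
  · have hpos : 0 < ‖y₁ - y₂‖ := lt_of_le_of_ne (norm_nonneg _) (Ne.symm h0)
    have h4 : c.μ * ‖y₁ - y₂‖ ≤ c.Mfxy * ‖x₁ - x₂‖ := by
      refine le_of_mul_le_mul_right ?_ hpos
      nlinarith
    rw [Consts.Ly, div_mul_eq_mul_div, le_div_iff₀ hμ]
    linarith

theorem inverse_pair (x : E m) (y : E n) : PosPair (hessYY f x y).inverse (hessYY f x y) := by
  obtain ⟨H, hH⟩ := hf.exists_hess_pair x y
  rwa [hH.inverse_eq]

theorem le_norm_hessYY (x : E m) (y v : E n) : c.μ * ‖v‖ ≤ ‖hessYY f x y v‖ := by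
  by_cases h0 : ‖v‖ = 0
  · rw [h0, mul_zero]; exact norm_nonneg _
  · have hpos : 0 < ‖v‖ := lt_of_le_of_ne (norm_nonneg _) (Ne.symm h0)
    have h1 := hf.hessYY_ge x y v
    have h2 := real_inner_le_norm (hessYY f x y v) v
    refine le_of_mul_le_mul_right ?_ hpos
    nlinarith

theorem norm_inverse_le (x : E m) (y v : E n) : ‖(hessYY f x y).inverse v‖ ≤ ‖v‖ / c.μ := by
  have h := hf.le_norm_hessYY x y ((hessYY f x y).inverse v)
  rw [(hf.inverse_pair x y).right] at h
  rwa [le_div_iff₀' hf.μ_pos]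

/-- The equation ∇_y f(x', y*(x')) = 0 is linearized at x and solved for the increment of y*. Since
y* is Lipschitz, the joint remainder is o(‖x' - x‖), which replaces an appeal to the implicit
function theorem. -/
theorem hasFDerivAt_yStar (hL : c.μ ≤ c.L) (x : E m) :
    HasFDerivAt (yStar f)
      (-((hessYY f x (yStar f x)).inverse ∘L hessXY f x (yStar f x))) x := by
  set A := hessYY f x (yStar f x) with hA
  set B := hessXY f x (yStar f x) with hB
  have hlip : LipschitzWith ⟨c.Ly, hf.Ly_nonneg⟩ (yStar f) :=
    LipschitzWith.of_dist_le_mul fun x₁ x₂ => by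
      rw [dist_eq_norm, dist_eq_norm]; exact hf.yStar_lip hL x₁ x₂
  have htend : Filter.Tendsto (fun x' => (x', yStar f x')) (𝓝 x) (𝓝 (x, yStar f x)) :=
    (continuous_id.prodMk hlip.continuous).continuousAt
  have h1 := (hasFDerivAt_iff_isLittleO.1
    (hf.hasStrictFDerivAt_gradY_joint x (yStar f x)).hasFDerivAt).comp_tendsto htend
  have h2 : (fun x' => ((x', yStar f x') - (x, yStar f x) : E m × E n)) =O[𝓝 x]
      fun x' => x' - x := by
    refine Asymptotics.IsBigO.of_bound (max 1 c.Ly) (Filter.Eventually.of_forall fun x' => ?_)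
    rw [Prod.mk_sub_mk, Prod.norm_mk]
    refine max_le ?_ ((hf.yStar_lip hL x' x).trans ?_)
    · exact le_mul_of_one_le_left (norm_nonneg _) (le_max_left _ _)
    · exact mul_le_mul_of_nonneg_right (le_max_right _ _) (norm_nonneg _)
  have h3 := h1.trans_isBigO h2
  have h4 := (A.inverse.isBigO_comp _ (𝓝 x)).trans_isLittleO h3
  rw [hasFDerivAt_iff_isLittleO]
  refine (h4.neg_left).congr_left fun x' => ?_
  have hp := hf.inverse_pair x (yStar f x)
  simp only [Function.comp_apply, hf.gradY_yStar hL, Prod.mk_sub_mk,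
    ContinuousLinearMap.coprod_apply, sub_zero, zero_sub, map_neg, map_add, ← hA, ← hB,
    neg_neg, neg_apply, ContinuousLinearMap.comp_apply]
  rw [hp.left]
  abel

theorem hasGradientAt_Phi (hF : UpperAssumption F c) (hL : c.μ ≤ c.L) (x : E m) :
    HasGradientAt (Phi F f) (hyperGrad F f x (yStar f x)) x := by
  have h1 := (hF.differentiable (x, yStar f x)).hasFDerivAt
  have h2 : HasFDerivAt (fun x' => (x', yStar f x')) _ x :=
    (hasFDerivAt_id x).prodMk (hf.hasFDerivAt_yStar hL x)
  have h3 := HasFDerivAt.comp x h1 h2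
  rw [hasGradientAt_iff_hasFDerivAt]
  convert! h3 using 1
  refine ContinuousLinearMap.ext fun v => ?_
  simp only [ContinuousLinearMap.comp_apply, hF.fderiv_eq, hyperGrad, map_sub, sub_apply,
    InnerProductSpace.toDual_apply_apply, ContinuousLinearMap.adjoint_inner_left,
    ContinuousLinearMap.prod_apply, ContinuousLinearMap.id_apply, neg_apply, inner_neg_right,
    (hf.inverse_pair _ _).symm_inv]
  ring

/-- Perturbation of the hypergradient. -/
theorem hyperGrad_sub_le (hF : UpperAssumption F c) {x₁ x₂ : E m} {y₁ y₂ : E n}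
    {a b e g : ℝ} (ha : ‖hessYY f x₁ y₁ - hessYY f x₂ y₂‖ ≤ a)
    (hb : ‖hessXY f x₁ y₁ - hessXY f x₂ y₂‖ ≤ b) (he : ‖gradY F x₁ y₁ - gradY F x₂ y₂‖ ≤ e)
    (hg : ‖gradX F x₁ y₁ - gradX F x₂ y₂‖ ≤ g) :
    ‖hyperGrad F f x₁ y₁ - hyperGrad F f x₂ y₂‖ ≤
      g + e * c.Mfxy / c.μ + c.CFy * (b / c.μ + a * c.Mfxy / c.μ ^ 2) := by
  have hμ := hf.μ_pos
  have hM := hf.Mfxy_nonneg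
  set u₁ := (hessYY f x₁ y₁).inverse (gradY F x₁ y₁) with hu₁
  set u₂ := (hessYY f x₂ y₂).inverse (gradY F x₂ y₂) with hu₂
  have hb0 : 0 ≤ b := (norm_nonneg _).trans hb
  have ha0 : 0 ≤ a := (norm_nonneg _).trans ha
  have h1 : ‖u₁‖ ≤ c.CFy / c.μ := (hf.norm_inverse_le _ _ _).trans
    (div_le_div_of_nonneg_right (hF.gradY_bound _ _) hμ.le)
  have h2 : c.μ * ‖u₁ - u₂‖ ≤ e + a * (c.CFy / c.μ) := by
    refine (hf.le_norm_hessYY x₂ y₂ _).trans ?_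
    -- Comparing the two linear systems through the second matrix avoids any bound on a difference
    -- of inverses.
    have e1 : hessYY f x₂ y₂ (u₁ - u₂) = (gradY F x₁ y₁ - gradY F x₂ y₂) -
        (hessYY f x₁ y₁ - hessYY f x₂ y₂) u₁ := by
      rw [map_sub, hu₂, (hf.inverse_pair x₂ y₂).right, sub_apply, hu₁,
        (hf.inverse_pair x₁ y₁).right]
      abel
    rw [e1]
    refine (norm_sub_le _ _).trans (add_le_add he ?_)
    exact (ContinuousLinearMap.le_of_opNorm_le _ ha u₁).trans
      (mul_le_mul_of_nonneg_left h1 ha0)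
  have h3 : ‖(hessXY f x₁ y₁).adjoint u₁ - (hessXY f x₂ y₂).adjoint u₂‖ ≤
      b * (c.CFy / c.μ) + c.Mfxy * ‖u₁ - u₂‖ := by
    have e1 : (hessXY f x₁ y₁).adjoint u₁ - (hessXY f x₂ y₂).adjoint u₂ =
        (hessXY f x₁ y₁ - hessXY f x₂ y₂).adjoint u₁ + (hessXY f x₂ y₂).adjoint (u₁ - u₂) := by
      rw [map_sub, map_sub, sub_apply]
      abel
    rw [e1]
    refine (norm_add_le _ _).trans (add_le_add ?_ ?_)
    · refine (ContinuousLinearMap.le_of_opNorm_le _ ?_ u₁).trans (mul_le_mul_of_nonneg_left h1 hb0)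
      rwa [LinearIsometryEquiv.norm_map]
    · refine ContinuousLinearMap.le_of_opNorm_le _ ?_ _
      rw [LinearIsometryEquiv.norm_map]
      exact hf.hessXY_bound _ _
  have h4 : c.Mfxy * ‖u₁ - u₂‖ ≤ c.Mfxy * ((e + a * (c.CFy / c.μ)) / c.μ) :=
    mul_le_mul_of_nonneg_left ((le_div_iff₀' hμ).2 h2) hM
  have e2 : hyperGrad F f x₁ y₁ - hyperGrad F f x₂ y₂ = (gradX F x₁ y₁ - gradX F x₂ y₂) -
      ((hessXY f x₁ y₁).adjoint u₁ - (hessXY f x₂ y₂).adjoint u₂) := by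
    rw [hyperGrad, hyperGrad]
    abel
  rw [e2]
  refine (norm_sub_le _ _).trans ((add_le_add hg (h3.trans (add_le_add le_rfl h4))).trans
    (le_of_eq ?_))
  field_simp
  ring

theorem hyperGrad_lip_y (hF : UpperAssumption F c) (x : E m) (y₁ y₂ : E n) :
    ‖hyperGrad F f x y₁ - hyperGrad F f x y₂‖ ≤ c.C * ‖y₁ - y₂‖ := by
  refine (hf.hyperGrad_sub_le hF (hf.hessYY_lip_y x y₁ y₂) (hf.hessXY_lip_y x y₁ y₂)
    (hF.gradY_lip_y x y₁ y₂) (hF.gradX_lip_y x y₁ y₂)).trans (le_of_eq ?_)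
  rw [Consts.C]
  ring

theorem gradient_Phi_lip (hF : UpperAssumption F c) (hL : c.μ ≤ c.L) (x₁ x₂ : E m) :
    ‖gradient (Phi F f) x₁ - gradient (Phi F f) x₂‖ ≤ c.LPhi * ‖x₁ - x₂‖ := by
  rw [(hf.hasGradientAt_Phi hF hL x₁).gradient, (hf.hasGradientAt_Phi hF hL x₂).gradient]
  have h1 := hf.hyperGrad_lip_y hF x₁ (yStar f x₁) (yStar f x₂)
  have h2 := hf.hyperGrad_sub_le hF (hf.hessYY_lip_x x₁ x₂ (yStar f x₂))
    (hf.hessXY_lip_x x₁ x₂ (yStar f x₂)) (hF.gradY_lip_x x₁ x₂ (yStar f x₂))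
    (hF.gradX_lip_x x₁ x₂ (yStar f x₂))
  have hC : 0 ≤ c.C := by
    have := hF.LFx_nonneg
    have := hF.LFy_nonneg
    have := hF.CFy_nonneg
    have := hf.Lfxy_nonneg
    have := hf.Lfyy_nonneg
    have := hf.Mfxy_nonneg
    have := hf.μ_pos
    rw [Consts.C]
    positivity
  have h3 := mul_le_mul_of_nonneg_left (hf.yStar_lip hL x₁ x₂) hC
  rw [← sub_add_sub_cancel _ (hyperGrad F f x₁ (yStar f x₂))]
  refine (norm_add_le _ _).trans ((add_le_add (h1.trans h3) h2).trans (le_of_eq ?_))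
  rw [Consts.LPhi, Consts.Ly]
  ring

end LowerAssumption

/-- Weighted Cauchy–Schwarz: the weights 1, 1, 4, 4 of D have reciprocals with sum 5/2. -/
theorem Consts.C_sq_le (c : Consts) : c.C ^ 2 ≤ 5 / 2 * c.D := by
  have key : ∀ p q r s : ℝ,
      (p + q + (r + s)) ^ 2 ≤ 5 / 2 * (p ^ 2 + r ^ 2 + 4 * q ^ 2 + 4 * s ^ 2) := fun p q r s => by
    nlinarith [sq_nonneg (p - r), sq_nonneg (p - 4 * q), sq_nonneg (p - 4 * s),
      sq_nonneg (r - 4 * q), sq_nonneg (r - 4 * s), sq_nonneg (q - s)]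
  have h := key c.LFx (c.LFy * c.Mfxy / c.μ) (c.CFy * (c.Lfxy / c.μ))
    (c.CFy * (c.Lfyy * c.Mfxy / c.μ ^ 2))
  convert! h using 1
  · rw [Consts.C]; ring
  · rw [Consts.D]; ring

theorem Consts.D_nonneg (c : Consts) : 0 ≤ c.D := by
  rw [Consts.D]
  have : 0 ≤ c.μ ^ 4 := by positivity
  positivity

theorem LowerAssumption.hyperGrad_error (hf : LowerAssumption f c) (hF : UpperAssumption F c)
    (hL : c.μ ≤ c.L) (x : E m) (y u : E n) :
    ‖gradX F x y - (hessXY f x y).adjoint u - gradient (Phi F f) x‖ ^ 2 ≤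
      3 * c.D * ‖y - yStar f x‖ ^ 2 +
      6 * c.Mfxy ^ 2 * ‖(hessYY f x y).inverse (gradY F x y) - u‖ ^ 2 := by
  rw [(hf.hasGradientAt_Phi hF hL x).gradient]
  set w := (hessYY f x y).inverse (gradY F x y) - u with hw
  have e1 : gradX F x y - (hessXY f x y).adjoint u - hyperGrad F f x (yStar f x) =
      (hyperGrad F f x y - hyperGrad F f x (yStar f x)) + (hessXY f x y).adjoint w := by
    rw [hw, map_sub]
    nth_rewrite 2 [hyperGrad]
    abel
  have h1 := hf.hyperGrad_lip_y hF x y (yStar f x)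
  have h2 : ‖(hessXY f x y).adjoint w‖ ≤ c.Mfxy * ‖w‖ := by
    refine ContinuousLinearMap.le_of_opNorm_le _ ?_ _
    rw [LinearIsometryEquiv.norm_map]
    exact hf.hessXY_bound _ _
  rw [e1]
  have h3 := pow_le_pow_left₀ (norm_nonneg _) ((norm_add_le _ _).trans (add_le_add h1 h2)) 2
  have h4 := mul_le_mul_of_nonneg_right c.C_sq_le (sq_nonneg ‖y - yStar f x‖)
  -- Young's inequality with weights 6/5 and 6, chosen so that (6/5)(5/2) = 3.
  nlinarith [sq_nonneg (c.C * ‖y - yStar f x‖ - 5 * (c.Mfxy * ‖w‖))]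

/-- The descent lemma. -/
theorem descent_lemma {d : ℕ} {g : E d → ℝ} {l : ℝ} (hg : Differentiable ℝ g)
    (hl : ∀ x₁ x₂, ‖gradient g x₁ - gradient g x₂‖ ≤ l * ‖x₁ - x₂‖) (x v : E d) :
    g (x + v) ≤ g x + ⟪gradient g x, v⟫_ℝ + l / 2 * ‖v‖ ^ 2 := by
  have hd : ∀ t : ℝ, HasDerivAt
      (fun t : ℝ => g (x + t • v) - (t * ⟪gradient g x, v⟫_ℝ + t ^ 2 * (l / 2 * ‖v‖ ^ 2)))
      (⟪gradient g (x + t • v), v⟫_ℝ - (⟪gradient g x, v⟫_ℝ + 2 * t * (l / 2 * ‖v‖ ^ 2))) t := by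
    intro t
    have h2 : HasDerivAt (fun t : ℝ => x + t • v) v t := by
      simpa using ((hasDerivAt_id t).smul_const v).const_add x
    have h3 := (hg (x + t • v)).hasFDerivAt.comp_hasDerivAt t h2
    rw [← inner_gradient_eq] at h3
    have h4 : HasDerivAt (fun t : ℝ => t * ⟪gradient g x, v⟫_ℝ + t ^ 2 * (l / 2 * ‖v‖ ^ 2))
        (⟪gradient g x, v⟫_ℝ + 2 * t * (l / 2 * ‖v‖ ^ 2)) t := by
      convert! ((hasDerivAt_id t).mul_const ⟪gradient g x, v⟫_ℝ).add
        (((hasDerivAt_id t).pow 2).mul_const (l / 2 * ‖v‖ ^ 2)) using 1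
      simp
    exact h3.sub h4
  have hanti : AntitoneOn (fun t : ℝ => g (x + t • v) -
      (t * ⟪gradient g x, v⟫_ℝ + t ^ 2 * (l / 2 * ‖v‖ ^ 2))) (Set.Icc 0 1) := by
    refine antitoneOn_of_deriv_nonpos (convex_Icc 0 1)
      (fun t _ => (hd t).continuousAt.continuousWithinAt)
      (fun t _ => (hd t).differentiableAt.differentiableWithinAt) fun t ht => ?_
    rw [interior_Icc] at ht
    rw [(hd t).deriv]
    have h1 := real_inner_le_norm (gradient g (x + t • v) - gradient g x) v
    have h2 := hl (x + t • v) x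
    rw [add_sub_cancel_left, norm_smul, Real.norm_of_nonneg ht.1.le] at h2
    rw [inner_sub_left] at h1
    nlinarith [norm_nonneg v]
  have := hanti (Set.left_mem_Icc.2 zero_le_one) (Set.right_mem_Icc.2 zero_le_one) zero_le_one
  simp only [one_smul, zero_smul, add_zero, one_mul, one_pow, zero_mul, ne_eq, OfNat.ofNat_ne_zero,
    not_false_eq_true, zero_pow, sub_zero] at this
  linarith

end hypergradient

/-! ### The rate -/

section rate

/-- Combination of a descent inequality with a linear recursion for the errors. -/
theorem sum_le_of_descent {φ G r b : ℕ → ℝ} {K : ℕ} {α l τ θ δ φmin : ℝ} (hα : 0 < α)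
    (hl : 0 ≤ l) (hτ : τ < 1) (hτ0 : 0 ≤ τ) (hθ : 0 ≤ θ) (hδ : 0 ≤ δ)
    (hG : ∀ k, 0 ≤ G k) (hr : ∀ k, 0 ≤ r k) (hb : ∀ k, 0 ≤ b k)
    (hstep : l + θ * (1 / 2 + l) * (1 / (1 - τ)) ≤ 1 / 4)
    (hdesc : ∀ k < K, φ (k + 1) ≤ φ k - α * (1 / 2 - l) * G k + α * (1 / 2 + l) * (r k + b k))
    (hr0 : 1 ≤ K → r 0 ≤ δ) (hrec : ∀ k, k + 1 < K → r (k + 1) ≤ τ * r k + θ * (G k + b k))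
    (hmin : φmin ≤ φ K) :
    ∑ k ∈ Finset.range K, G k ≤
      4 * (φ 0 - φmin) / α + 3 * δ / (1 - τ) + 3 * ∑ k ∈ Finset.range K, b k := by
  set SG := ∑ k ∈ Finset.range K, G k with hSG
  set Sr := ∑ k ∈ Finset.range K, r k with hSr
  set Sb := ∑ k ∈ Finset.range K, b k with hSb
  have hSG0 : 0 ≤ SG := Finset.sum_nonneg fun k _ => hG k
  have hSb0 : 0 ≤ Sb := Finset.sum_nonneg fun k _ => hb k
  have hτ1 : 0 < 1 - τ := by linarith
  have h1 : Sr ≤ δ + τ * Sr + θ * (SG + Sb) := by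
    rcases K with _ | K
    · simpa [hSr, hSG, hSb] using hδ
    · have h2 : ∑ k ∈ Finset.range K, r (k + 1) ≤
          ∑ k ∈ Finset.range (K + 1), (τ * r k + θ * (G k + b k)) := by
        refine (Finset.sum_le_sum fun k hk => hrec k ?_).trans
          (Finset.sum_le_sum_of_subset_of_nonneg (Finset.range_mono (Nat.le_succ K)) fun k _ _ => ?_)
        · simpa using hk
        · have := hG k
          have := hr k
          have := hb k
          positivity
      rw [Finset.sum_add_distrib, ← Finset.mul_sum, ← Finset.mul_sum, Finset.sum_add_distrib] at h2
      have h3 := hr0 (by simp)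
      have h4 : Sr = ∑ k ∈ Finset.range K, r (k + 1) + r 0 := Finset.sum_range_succ' r K
      linarith
  have h2 : ∀ j ≤ K, φ j ≤ φ 0 - α * (1 / 2 - l) * ∑ k ∈ Finset.range j, G k +
      α * (1 / 2 + l) * (∑ k ∈ Finset.range j, r k + ∑ k ∈ Finset.range j, b k) := by
    intro j hj
    induction j with
    | zero => simp
    | succ j ih =>
      have h3 := ih (by omega)
      have h4 := hdesc j (by omega)
      rw [Finset.sum_range_succ, Finset.sum_range_succ, Finset.sum_range_succ]
      linarith
  have h3 := hmin.trans (h2 K le_rfl)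
  rw [← hSG, ← hSr, ← hSb] at h3
  have hΔ : φ 0 - φmin = α * ((φ 0 - φmin) / α) := by field_simp
  set Δ := (φ 0 - φmin) / α with hΔd
  have h4 : (1 / 2 - l) * SG ≤ Δ + (1 / 2 + l) * (Sr + Sb) := by
    refine le_of_mul_le_mul_left ?_ hα
    linarith
  set t := θ / (1 - τ) with ht
  have ht0 : 0 ≤ t := by positivity
  have h5 : Sr ≤ δ / (1 - τ) + t * (SG + Sb) := by
    rw [ht, div_mul_eq_mul_div, ← add_div, le_div_iff₀ hτ1]
    linarith
  have hst : l + t * (1 / 2 + l) ≤ 1 / 4 := by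
    refine le_trans (le_of_eq ?_) hstep
    rw [ht]
    ring
  have hl4 : l ≤ 1 / 4 := by nlinarith
  set e := δ / (1 - τ) with he
  have he0 : 0 ≤ e := by positivity
  have h6 := mul_le_mul_of_nonneg_left h5 (by linarith : 0 ≤ 1 / 2 + l)
  have h7 := mul_le_mul_of_nonneg_right hst hSG0
  have h8 := mul_le_mul_of_nonneg_right hst hSb0
  have h9 := mul_le_mul_of_nonneg_right hl4 he0
  rw [mul_div_assoc, mul_div_assoc, ← he, ← hΔd]
  -- Inserting `h5` in `h4`, the step condition leaves 1/4 as coefficient of SG on the left and at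
  -- most 3/4 for e and Sb on the right.
  nlinarith

/-- The full harmonic sum exceeds ln K. The smaller first term repairs this: 0.1875 + 1/2 < ln 2,
and afterwards 1/(K + 1) ≤ ln(K + 1) - ln K. -/
theorem harmonic_le_log {b : ℝ} (hb : 0 ≤ b) {a : ℕ → ℝ} (h0 : a 0 ≤ 0.1875 * b)
    {K : ℕ} (hK : 2 ≤ K) (ha : ∀ k < K, a k ≤ b / (k + 1 : ℕ)) :
    ∑ k ∈ Finset.range K, a k ≤ b * Real.log K := by
  induction K, hK using Nat.le_induction with
  | base =>
    have h1 := ha 1 (by norm_num)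
    have h2 := Real.log_two_gt_d9
    rw [Finset.sum_range_succ, Finset.sum_range_one]
    norm_num at h1 ⊢
    nlinarith
  | succ K hK ih =>
    have h1 := ih fun k hk => ha k (by omega)
    have h2 := ha K (by omega)
    have hK0 : (0 : ℝ) < K := by exact_mod_cast (by omega : 0 < K)
    have h3 : 1 / ((K : ℝ) + 1) ≤ Real.log (K + 1) - Real.log K := by
      have h4 := Real.one_sub_inv_le_log_of_pos (x := ((K : ℝ) + 1) / K) (by positivity)
      rw [Real.log_div (by positivity) hK0.ne'] at h4
      refine le_trans (le_of_eq ?_) h4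
      field_simp
      ring
    have h5 := mul_le_mul_of_nonneg_left h3 hb
    rw [Finset.sum_range_succ]
    push_cast at h2 ⊢
    rw [mul_one_div] at h5
    linarith

variable {m n : ℕ} {F f : E m → E n → ℝ} {c : Consts}

theorem LowerAssumption.LPhi_nonneg (hf : LowerAssumption f c) (hF : UpperAssumption F c) :
    0 ≤ c.LPhi := by
  have := hF.LFx_nonneg
  have := hF.LFy_nonneg
  have := hF.LFx'_nonneg
  have := hF.LFy'_nonneg
  have := hF.CFy_nonneg
  have := hf.Lfxy_nonneg
  have := hf.Lfyy_nonneg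
  have := hf.Lfxy'_nonneg
  have := hf.Lfyy'_nonneg
  have := hf.Mfxy_nonneg
  have := hf.μ_pos
  rw [Consts.LPhi, Consts.C]
  positivity

theorem LowerAssumption.differentiable_Phi (hf : LowerAssumption f c) (hF : UpperAssumption F c)
    (hL : c.μ ≤ c.L) : Differentiable ℝ (Phi F f) := fun x =>
  (hf.hasGradientAt_Phi hF hL x).hasFDerivAt.differentiableAt

/-- One inexact gradient step. -/
theorem inexact_descent {d : ℕ} {g : E d → ℝ} {l α : ℝ} (hg : Differentiable ℝ g) (hl0 : 0 ≤ l)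
    (hl : ∀ x₁ x₂, ‖gradient g x₁ - gradient g x₂‖ ≤ l * ‖x₁ - x₂‖) (hα : 0 < α) (x h : E d) :
    g (x - α • h) ≤ g x - α * (1 / 2 - α * l) * ‖gradient g x‖ ^ 2 +
      α * (1 / 2 + α * l) * ‖h - gradient g x‖ ^ 2 := by
  have h1 := descent_lemma hg hl x (-(α • h))
  rw [← sub_eq_add_neg, inner_neg_right, inner_smul_right, norm_neg, norm_smul,
    Real.norm_of_nonneg hα.le] at h1
  -- Polarization of ⟨∇g, h⟩ produces the two halves; ‖h‖² in the quadratic term is split by the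
  -- parallelogram law.
  have h2 := norm_sub_sq_real h (gradient g x)
  have h3 := parallelogram_law_with_norm ℝ (h - gradient g x) (gradient g x)
  rw [sub_add_cancel] at h3
  have h4 : ‖h‖ ^ 2 ≤ 2 * (‖h - gradient g x‖ ^ 2 + ‖gradient g x‖ ^ 2) := by
    nlinarith [mul_self_nonneg ‖h - gradient g x - gradient g x‖]
  rw [real_inner_comm] at h2
  have h5 := mul_le_mul_of_nonneg_left h4 (by positivity : 0 ≤ l / 2 * α ^ 2)
  have h6 : 0 ≤ α * ‖h‖ ^ 2 := by positivity
  nlinarith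

theorem LowerAssumption.run_sum_le (hn : 1 ≤ n) (hF : UpperAssumption F c)
    (hf : LowerAssumption f c) (hΦ : BddBelow (Set.range (Phi F f))) {α β ε : ℝ} (hα : 0 < α)
    (hβ : 0 < β) (hβL : β ≤ 2 / (c.L + c.μ)) (hε : 0 < ε) {P T K : ℕ} (hT : c.K₀ n ≤ T)
    {Q : ℕ → ℕ} {ζ : ℕ → ℕ → ℝ} {x : ℕ → E m} {y u : ℕ → E n}
    (hrun : IsRun F f ((1 / c.L) • ContinuousLinearMap.id ℝ (E n)) α β 1 P T K Q ζ x y u)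
    (hwarm : ∀ k < K, c.Lfyy = 0 ∨ (1 - β * c.μ) ^ P * ‖y k - yStar f (x k)‖ ≤ c.K₁ n)
    (hτ : c.τ n T P α β ε < 1)
    (hstep : α * c.LPhi + c.ω n T P β ε * α ^ 2 * (1 / 2 + α * c.LPhi) *
      (1 / (1 - c.τ n T P α β ε)) ≤ 1 / 4) :
    ∑ k ∈ Finset.range K, ‖gradient (Phi F f) (x k)‖ ^ 2 ≤
      4 * (Phi F f (x 0) - ⨅ z, Phi F f z) / α +
      3 * c.δ₀ n T P β ‖yStar f (x 0) - y 0‖ / (1 - c.τ n T P α β ε) +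
      18 * c.Mfxy ^ 2 * ∑ k ∈ Finset.range K,
        ‖(hessYY f (x k) (y (k + 1))).inverse (gradY F (x k) (y (k + 1))) - u (k + 1)‖ ^ 2 := by
  have hL := hf.μ_le_L hn
  have hD := c.D_nonneg
  have hlp := hf.LPhi_nonneg hF
  have hct := hf.contr_nonneg hn hβL hβ.le T P
  have hdiff := hf.differentiable_Phi hF hL
  have hlip := hf.gradient_Phi_lip hF hL
  set q := c.contr n T P β with hq
  set G : ℕ → ℝ := fun k => ‖gradient (Phi F f) (x k)‖ ^ 2 with hG
  set r : ℕ → ℝ := fun k => 3 * c.D * ‖y (k + 1) - yStar f (x k)‖ ^ 2 with hr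
  set b : ℕ → ℝ := fun k => 6 * c.Mfxy ^ 2 *
    ‖(hessYY f (x k) (y (k + 1))).inverse (gradY F (x k) (y (k + 1))) - u (k + 1)‖ ^ 2 with hb
  set h : ℕ → E m := fun k =>
    gradX F (x k) (y (k + 1)) - (hessXY f (x k) (y (k + 1))).adjoint (u (k + 1)) with hh
  have herr : ∀ k, ‖h k - gradient (Phi F f) (x k)‖ ^ 2 ≤ r k + b k := fun k =>
    hf.hyperGrad_error hF hL (x k) (y (k + 1)) (u (k + 1))
  have hrk : ∀ k < K, r k ≤ 3 * c.D * (q * ‖y k - yStar f (x k)‖ ^ 2) := fun k hk => by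
    refine mul_le_mul_of_nonneg_left ?_ (by positivity)
    rw [hrun.y_step k hk]
    exact hf.subA_contr hn hβ.le hβL (hwarm k hk) hT
  have hω0 : 0 ≤ c.ω n T P β ε := by rw [Consts.ω]; positivity
  have key := sum_le_of_descent (φ := fun k => Phi F f (x k)) (G := G) (r := r) (b := b) (K := K)
    (l := α * c.LPhi) (τ := c.τ n T P α β ε) (θ := c.ω n T P β ε * α ^ 2)
    (δ := c.δ₀ n T P β ‖yStar f (x 0) - y 0‖) (φmin := ⨅ z, Phi F f z) hα (by positivity) hτ
    (by rw [Consts.τ]; positivity) (by positivity) (by rw [Consts.δ₀]; positivity)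
    (fun k => by positivity) (fun k => by positivity) (fun k => by positivity) hstep
    (fun k hk => by
      have h1 := inexact_descent hdiff hlp hlip hα (x k) (h k)
      have h2 := mul_le_mul_of_nonneg_left (herr k) (by positivity : 0 ≤ α * (1 / 2 + α * c.LPhi))
      rw [← hrun.x_step k hk] at h1
      linarith)
    (fun hK => (hrk 0 hK).trans (le_of_eq (by rw [Consts.δ₀, norm_sub_rev, ← hq]; ring)))
    (fun k hk => by
      refine (hrk (k + 1) hk).trans ?_
      -- Young's inequality with ε separates the old error from the drift of y*. The drift is at
      -- most L_y²‖x_{k+1} - x_k‖² ≤ 2α²L_y²(G_k + r_k + b_k), and 3 · 2 is the 6 in τ and ω.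
      have h1 : ‖y (k + 1) - yStar f (x (k + 1))‖ ^ 2 ≤
          (1 + ε) * ‖y (k + 1) - yStar f (x k)‖ ^ 2 +
          (1 + 1 / ε) * ‖yStar f (x k) - yStar f (x (k + 1))‖ ^ 2 := by
        have h2 := norm_add_le (y (k + 1) - yStar f (x k)) (yStar f (x k) - yStar f (x (k + 1)))
        rw [sub_add_sub_cancel] at h2
        refine (pow_le_pow_left₀ (norm_nonneg _) h2 2).trans ?_
        set p := ‖y (k + 1) - yStar f (x k)‖
        set s := ‖yStar f (x k) - yStar f (x (k + 1))‖
        have h3 : 0 ≤ (ε * p - s) ^ 2 / ε := by positivity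
        have h4 : (ε * p - s) ^ 2 / ε = ε * p ^ 2 - 2 * p * s + 1 / ε * s ^ 2 := by
          field_simp
          ring
        linarith
      have h2 := pow_le_pow_left₀ (norm_nonneg _) (hf.yStar_lip hL (x k) (x (k + 1))) 2
      have h3 : ‖x k - x (k + 1)‖ ^ 2 ≤ 2 * α ^ 2 * (G k + (r k + b k)) := by
        rw [hrun.x_step k (by omega), sub_sub_cancel, norm_smul, Real.norm_of_nonneg hα.le, mul_pow,
          mul_comm 2, mul_assoc]
        refine mul_le_mul_of_nonneg_left ?_ (sq_nonneg α)
        change ‖h k‖ ^ 2 ≤ _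
        have h5 := norm_add_le (h k - gradient (Phi F f) (x k)) (gradient (Phi F f) (x k))
        rw [sub_add_cancel] at h5
        have h6 := pow_le_pow_left₀ (norm_nonneg _) h5 2
        have h7 := herr k
        have h8 : G k = ‖gradient (Phi F f) (x k)‖ ^ 2 := rfl
        nlinarith [sq_nonneg (‖h k - gradient (Phi F f) (x k)‖ - ‖gradient (Phi F f) (x k)‖)]
      rw [mul_pow] at h2
      have h4 := h2.trans (mul_le_mul_of_nonneg_left h3 (sq_nonneg _))
      have h5 := h1.trans (add_le_add le_rfl (mul_le_mul_of_nonneg_left h4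
        (by positivity : 0 ≤ 1 + 1 / ε)))
      have h6 := mul_le_mul_of_nonneg_left h5 (by positivity : 0 ≤ 3 * c.D * q)
      have h7 : r k = 3 * c.D * ‖y (k + 1) - yStar f (x k)‖ ^ 2 := rfl
      rw [← mul_assoc]
      refine h6.trans (le_of_eq ?_)
      rw [Consts.τ, Consts.ω, ← hq, mul_add (3 * c.D * q)]
      rw [show 3 * c.D * q * ((1 + ε) * ‖y (k + 1) - yStar f (x k)‖ ^ 2) = q * (1 + ε) * r k by
        rw [h7]; ring]
      ring)
    (ciInf_le hΦ _)
  refine key.trans (le_of_eq ?_)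
  rw [hb, ← Finset.mul_sum]
  ring

/-! ### The constant ξ̃ and the error of the linear system along a run -/

theorem xi_pos (H₀ : E n →L[ℝ] E n) (ζ : ℕ → ℕ → ℝ) (x : ℕ → E m) (y : ℕ → E n) (k i : ℕ) :
    0 < xi F f c H₀ ζ x y k i := Real.exp_pos _

theorem xiTildeAt_pos (H₀ : E n →L[ℝ] E n) (Q : ℕ → ℕ) (ζ : ℕ → ℕ → ℝ) (x : ℕ → E m)
    (y : ℕ → E n) (k : ℕ) : 0 < xiTildeAt F f c H₀ Q ζ x y k := by
  rw [xiTildeAt]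
  split_ifs with h
  · have : Nonempty (Fin (Q k)) := ⟨⟨0, by omega⟩⟩
    obtain ⟨i, hi⟩ := exists_eq_ciInf_of_finite (f := fun i : Fin (Q k) =>
      1 / (2 * (xi F f c H₀ ζ x y k (i + 1) ^ 2 + xi F f c H₀ ζ x y k (i + 1))))
    rw [← hi]
    have := xi_pos (F := F) (f := f) (c := c) H₀ ζ x y k (i + 1)
    positivity
  · norm_num

theorem xiTilde_pos (H₀ : E n →L[ℝ] E n) (Q : ℕ → ℕ) (ζ : ℕ → ℕ → ℝ) (x : ℕ → E m)
    (y : ℕ → E n) {K : ℕ} (hK : 1 ≤ K) : 0 < xiTilde F f c H₀ Q ζ x y K := by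
  have : Nonempty (Fin K) := ⟨⟨0, by omega⟩⟩
  obtain ⟨k, hk⟩ := exists_eq_ciInf_of_finite (f := fun k : Fin K => xiTildeAt F f c H₀ Q ζ x y k)
  rw [xiTilde, ← hk]
  exact xiTildeAt_pos _ _ _ _ _ _

theorem xiTilde_le (H₀ : E n →L[ℝ] E n) (Q : ℕ → ℕ) (ζ : ℕ → ℕ → ℝ) (x : ℕ → E m)
    (y : ℕ → E n) {K k : ℕ} (hk : k < K) :
    xiTilde F f c H₀ Q ζ x y K ≤ xiTildeAt F f c H₀ Q ζ x y k :=
  ciInf_le (f := fun k : Fin K => xiTildeAt F f c H₀ Q ζ x y k)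
    (Set.finite_range _).bddBelow ⟨k, hk⟩

theorem xiTildeAt_le (H₀ : E n →L[ℝ] E n) {Q : ℕ → ℕ} (ζ : ℕ → ℕ → ℝ) (x : ℕ → E m)
    (y : ℕ → E n) {k : ℕ} (hQ : 1 < Q k) : xiTildeAt F f c H₀ Q ζ x y k ≤
      1 / (2 * (xi F f c H₀ ζ x y k (Q k) ^ 2 + xi F f c H₀ ζ x y k (Q k))) := by
  rw [xiTildeAt, if_pos hQ]
  have h := ciInf_le (f := fun i : Fin (Q k) =>
      1 / (2 * (xi F f c H₀ ζ x y k (i + 1) ^ 2 + xi F f c H₀ ζ x y k (i + 1))))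
    -- The index set is shifted by one, so the last index Q_k - 1 belongs to ξ_{k,Q_k}.
    (Set.finite_range _).bddBelow ⟨Q k - 1, by omega⟩
  simpa only [Nat.sub_add_cancel hQ.le] using h

namespace LowerAssumption

variable {α β : ℝ} {P T K : ℕ} {Q : ℕ → ℕ} {ζ : ℕ → ℕ → ℝ} {x : ℕ → E m} {y u : ℕ → E n}

/-- Error of the linear system if the matrix of subroutine `𝒜` is shared. -/
theorem shared_error (hf : LowerAssumption f c) (hn : 1 ≤ n) (hF : UpperAssumption F c)
    (hβ : 0 < β) (hβL : β ≤ 2 / (c.L + c.μ))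
    (hrun : IsRun F f ((1 / c.L) • ContinuousLinearMap.id ℝ (E n)) α β 1 P T K Q ζ x y u)
    {k : ℕ} (hk : k < K)
    (hw : c.Lfyy = 0 ∨ (1 - β * c.μ) ^ P * ‖y k - yStar f (x k)‖ ≤ c.K₁ n) (hQ : Q k = 1) :
    ‖(hessYY f (x k) (y (k + 1))).inverse (gradY F (x k) (y (k + 1))) - u (k + 1)‖ ^ 2 ≤
      0.75 * (c.L * c.CFy ^ 2 / c.μ ^ 3) := by
  have hL := hf.μ_le_L hn
  have hμ := hf.μ_pos
  have hgd := hf.gdIter_le hβ.le hβL hL (x k) (y k) P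
  have h := hf.qnIter_solve hn (hw.imp id hgd.trans) T (gradY F (x k) (y (k + 1)))
  simp only at h
  rw [hrun.u_shared k hk hQ]
  rw [show (qnIter f ((1 / c.L) • ContinuousLinearMap.id ℝ (E n)) 1 (x k)
    (gdIter f β (x k) (y k) P) T).1 = y (k + 1) from (hrun.y_step k hk).symm] at h
  refine h.trans ?_
  have hκ := hf.one_le_κ hL
  have h1 := pow_le_pow_left₀ (norm_nonneg _) (hF.gradY_bound (x k) (y (k + 1))) 2
  refine (mul_le_mul_of_nonneg_left h1 (by positivity)).trans (le_of_eq ?_)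
  rw [Consts.κ]
  field_simp

/-- Error of the linear system in an iteration. -/
theorem solve_error (hf : LowerAssumption f c) (hn : 1 ≤ n) (hF : UpperAssumption F c)
    (hβ : 0 < β) (hβL : β ≤ 2 / (c.L + c.μ)) (hζ : ∀ k i, 0 < ζ k i)
    (hrun : IsRun F f ((1 / c.L) • ContinuousLinearMap.id ℝ (E n)) α β 1 P T K Q ζ x y u)
    {k : ℕ} (hk : k < K)
    (hw : c.Lfyy = 0 ∨ (1 - β * c.μ) ^ P * ‖y k - yStar f (x k)‖ ≤ c.K₁ n) (hQ : 1 ≤ Q k) :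
    ‖(hessYY f (x k) (y (k + 1))).inverse (gradY F (x k) (y (k + 1))) - u (k + 1)‖ ^ 2 ≤
      n * c.L * c.CFy ^ 2 / (c.μ ^ 3 *
        xiTilde F f c ((1 / c.L) • ContinuousLinearMap.id ℝ (E n)) Q ζ x y K) / Q k := by
  have hL := hf.μ_le_L hn
  have hμ := hf.μ_pos
  have hL0 : 0 < c.L := hμ.trans_le hL
  set H₀ := (1 / c.L) • ContinuousLinearMap.id ℝ (E n)
  have hξ := xiTilde_pos (F := F) (f := f) (c := c) H₀ Q ζ x y (by omega : 1 ≤ K)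
  have hle := xiTilde_le (F := F) (f := f) (c := c) H₀ Q ζ x y hk
  set X := xiTilde F f c H₀ Q ζ x y K
  rcases hQ.eq_or_lt with h1 | h1
  · refine (hf.shared_error hn hF hβ hβL hrun hk hw h1.symm).trans ?_
    rw [xiTildeAt, if_neg (by omega)] at hle
    have hn' : (1 : ℝ) ≤ n := by exact_mod_cast hn
    have e : n * c.L * c.CFy ^ 2 / (c.μ ^ 3 * X) / Q k =
        n / X * (c.L * c.CFy ^ 2 / c.μ ^ 3) := by
      rw [← h1]
      field_simp
      simp
    rw [e]
    refine mul_le_mul_of_nonneg_right ?_ (by positivity)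
    rw [le_div_iff₀ hξ]
    linarith
  · have hle2 := hle.trans (xiTildeAt_le H₀ ζ x y h1)
    obtain ⟨i, hi, h2⟩ := hf.subB_solve hn (hζ k) (x k) (y (k + 1))
      (gradY F (x k) (y (k + 1))) hQ (ξ := xi F f c H₀ ζ x y k (Q k)) rfl
    obtain ⟨-, -, -, hbest⟩ := hrun.u_step k hk h1
    have hξQ := xi_pos (F := F) (f := f) (c := c) H₀ ζ x y k (Q k)
    set ξ := xi F f c H₀ ζ x y k (Q k)
    have hQ0 : (0 : ℝ) < Q k := by exact_mod_cast hQ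
    have h3 := pow_le_pow_left₀ (norm_nonneg _) (hbest i hi) 2
    have h4 := (mul_le_mul_of_nonneg_left h3 hQ0.le).trans h2
    have hCF := pow_le_pow_left₀ (norm_nonneg _) (hF.gradY_bound (x k) (y (k + 1))) 2
    have hκ := hf.one_le_κ hL
    have h5 := h4.trans (mul_le_mul_of_nonneg_left hCF (by positivity))
    have h6 : 2 * (ξ ^ 2 + ξ) ≤ 1 / X := by
      rw [le_div_iff₀ hξ]
      rw [le_div_iff₀ (by positivity)] at hle2
      linarith
    have h7 := mul_le_mul_of_nonneg_left h6
      (by positivity : 0 ≤ n * c.κ / c.μ ^ 2 * c.CFy ^ 2)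
    rw [le_div_iff₀ hQ0]
    calc _ = (Q k : ℝ) * ‖(hessYY f (x k) (y (k + 1))).inverse (gradY F (x k) (y (k + 1))) -
          u (k + 1)‖ ^ 2 := mul_comm _ _
      _ ≤ _ := h5
      _ = n * c.κ / c.μ ^ 2 * c.CFy ^ 2 * (2 * (ξ ^ 2 + ξ)) := by ring
      _ ≤ _ := h7
      _ = _ := by
        rw [Consts.κ]
        field_simp

end LowerAssumption

end rate

end QNBO

end

/-! ### The averaged rate -/

theorem mainTheorem3 {m n : ℕ} (hn : 1 ≤ n)
    (F f : QNBO.E m → QNBO.E n → ℝ) (c : QNBO.Consts)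
    (hF : QNBO.UpperAssumption F c) (hf : QNBO.LowerAssumption f c)
    (hΦ : BddBelow (Set.range (QNBO.Phi F f)))
    (α β ε : ℝ) (hα : 0 < α) (hβ : 0 < β) (hβL : β ≤ 2 / (c.L + c.μ)) (hε : 0 < ε)
    (P T K : ℕ) (hK : 1 ≤ K) (hT : c.K₀ n ≤ T)
    (Q : ℕ → ℕ) (hQ : ∀ k < K, 1 ≤ Q k)
    (ζ : ℕ → ℕ → ℝ) (hζ : ∀ k i, 0 < ζ k i)
    (H₀ : QNBO.E n →L[ℝ] QNBO.E n)
    (hH₀ : H₀ = (1 / c.L) • ContinuousLinearMap.id ℝ (QNBO.E n))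
    (x : ℕ → QNBO.E m) (y u : ℕ → QNBO.E n)
    (hrun : QNBO.IsRun F f H₀ α β 1 P T K Q ζ x y u)
    (hwarm : ∀ k < K, c.Lfyy = 0 ∨
      (1 - β * c.μ) ^ P * ‖y k - QNBO.yStar f (x k)‖ ≤ c.K₁ n)
    (hτ : c.τ n T P α β ε < 1)
    (hstep : α * c.LPhi + c.ω n T P β ε * α ^ 2 * (1 / 2 + α * c.LPhi) *
      (1 / (1 - c.τ n T P α β ε)) ≤ 1 / 4) :
    Differentiable ℝ (QNBO.Phi F f) ∧
    (1 / (K : ℝ)) * ∑ k ∈ Finset.range K, ‖gradient (QNBO.Phi F f) (x k)‖ ^ 2 ≤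
      4 * (QNBO.Phi F f (x 0) - ⨅ z, QNBO.Phi F f z) / (α * K) +
      3 * c.δ₀ n T P β ‖QNBO.yStar f (x 0) - y 0‖ / (K * (1 - c.τ n T P α β ε)) +
      (1 / (K : ℝ)) * ∑ k ∈ Finset.range K, 18 * n * c.L * c.Mfxy ^ 2 * c.CFy ^ 2 /
        (c.μ ^ 3 * QNBO.xiTilde F f c H₀ Q ζ x y K * Q k) ∧
    ((∀ k < K, Q k = k + 1) →
      (1 / (K : ℝ)) * ∑ k ∈ Finset.range K, ‖gradient (QNBO.Phi F f) (x k)‖ ^ 2 ≤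
        4 * (QNBO.Phi F f (x 0) - ⨅ z, QNBO.Phi F f z) / (α * K) +
        3 * c.δ₀ n T P β ‖QNBO.yStar f (x 0) - y 0‖ / (K * (1 - c.τ n T P α β ε)) +
        18 * n * c.L * c.Mfxy ^ 2 * c.CFy ^ 2 * Real.log K /
          (c.μ ^ 3 * QNBO.xiTilde F f c H₀ Q ζ x y K * K)) := by
  have hL := hf.μ_le_L hn
  have hμ := hf.μ_pos
  have hL0 : 0 < c.L := hμ.trans_le hL
  subst hH₀
  have hdiff := hf.differentiable_Phi hF hL
  have hlp := hf.LPhi_nonneg hF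
  have hsum := hf.run_sum_le hn hF hΦ hα hβ hβL hε hT hrun hwarm hτ hstep
  have hX := QNBO.xiTilde_pos (F := F) (f := f) (c := c)
    ((1 / c.L) • ContinuousLinearMap.id ℝ (QNBO.E n)) Q ζ x y hK
  have herr := fun k (hk : k < K) =>
    hf.solve_error hn hF hβ hβL hζ hrun hk (hwarm k hk) (hQ k hk)
  have hle := fun k (hk : k < K) => QNBO.xiTilde_le (F := F) (f := f) (c := c)
    ((1 / c.L) • ContinuousLinearMap.id ℝ (QNBO.E n)) Q ζ x y hk
  set X := QNBO.xiTilde F f c ((1 / c.L) • ContinuousLinearMap.id ℝ (QNBO.E n)) Q ζ x y K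
  set err : ℕ → ℝ := fun k => ‖(QNBO.hessYY f (x k) (y (k + 1))).inverse
    (QNBO.gradY F (x k) (y (k + 1))) - u (k + 1)‖ ^ 2 with herr_def
  set S := ∑ k ∈ Finset.range K, ‖gradient (QNBO.Phi F f) (x k)‖ ^ 2 with hS
  set A := 4 * (QNBO.Phi F f (x 0) - ⨅ z, QNBO.Phi F f z) with hA
  set B := 3 * c.δ₀ n T P β ‖QNBO.yStar f (x 0) - y 0‖ with hB
  have hτ1 : 0 < 1 - c.τ n T P α β ε := by linarith
  have hK0 : (0 : ℝ) < K := by exact_mod_cast hK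
  have hCF := hF.CFy_nonneg
  have hconcl : ∀ W V : ℝ, S ≤ A / α + B / (1 - c.τ n T P α β ε) + V → V = K * W →
      1 / (K : ℝ) * S ≤ A / (α * K) + B / (K * (1 - c.τ n T P α β ε)) + W := by
    rintro W V h rfl
    rw [one_div_mul_eq_div, div_le_iff₀ hK0]
    refine h.trans (le_of_eq ?_)
    field_simp
  refine ⟨hdiff, hconcl _ (∑ k ∈ Finset.range K, 18 * n * c.L * c.Mfxy ^ 2 * c.CFy ^ 2 /
    (c.μ ^ 3 * X * Q k)) (hsum.trans ?_) (by field_simp), fun hQk => ?_⟩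
  · gcongr
    rw [Finset.mul_sum]
    refine Finset.sum_le_sum fun k hk => ?_
    refine (mul_le_mul_of_nonneg_left (herr k (Finset.mem_range.1 hk)) (by positivity)).trans
      (le_of_eq ?_)
    field_simp
  · refine hconcl _ (18 * n * c.L * c.Mfxy ^ 2 * c.CFy ^ 2 * Real.log K / (c.μ ^ 3 * X)) ?_
      (by field_simp)
    -- For K = 1 the logarithm vanishes, so no error of the linear system may appear. The descent
    -- lemma along an exact gradient step from x₀, which need not be the step of the algorithm,
    -- bounds ‖∇Φ(x₀)‖² by the first term alone.
    rcases hK.eq_or_lt with h1 | h1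
    · have hα4 : α * c.LPhi ≤ 1 / 4 := by
        have hct := hf.contr_nonneg hn hβL hβ.le T P
        have hD := c.D_nonneg
        have : 0 ≤ c.ω n T P β ε * α ^ 2 * (1 / 2 + α * c.LPhi) *
            (1 / (1 - c.τ n T P α β ε)) := by
          rw [QNBO.Consts.ω]
          positivity
        linarith
      have h2 := QNBO.descent_lemma hdiff (hf.gradient_Phi_lip hF hL) (x 0)
        (-(α • gradient (QNBO.Phi F f) (x 0)))
      have h3 := (ciInf_le hΦ _).trans h2
      rw [inner_neg_right, inner_smul_right, real_inner_self_eq_norm_sq, norm_neg, norm_smul,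
        Real.norm_of_nonneg hα.le] at h3
      have hB0 : 0 ≤ B := by
        have hct := hf.contr_nonneg hn hβL hβ.le T P
        have hD := c.D_nonneg
        rw [hB, QNBO.Consts.δ₀]
        positivity
      have hS1 : S = ‖gradient (QNBO.Phi F f) (x 0)‖ ^ 2 := by rw [hS, ← h1, Finset.sum_range_one]
      have h4 : S ≤ A / α := by
        rw [le_div_iff₀ hα, hA, hS1]
        have h5 := mul_le_mul_of_nonneg_right hα4
          (by positivity : 0 ≤ α * ‖gradient (QNBO.Phi F f) (x 0)‖ ^ 2)
        have h6 : 0 ≤ α * ‖gradient (QNBO.Phi F f) (x 0)‖ ^ 2 := by positivity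
        nlinarith
      have h5 : 0 ≤ B / (1 - c.τ n T P α β ε) := by positivity
      rw [← h1, Nat.cast_one, Real.log_one, mul_zero, zero_div]
      linarith
    · refine hsum.trans ?_
      have hX4 : X ≤ 1 / 4 := by
        have := hle 0 (by omega)
        rwa [QNBO.xiTildeAt, if_neg (by have := hQk 0 (by omega); omega)] at this
      have hn' : (1 : ℝ) ≤ n := by exact_mod_cast hn
      -- Iteration 0 has Q₀ = 1 and shares the matrix of 𝒜, with constant 0.75 = 0.1875 · 4, while X
      -- ≤ 1/4 gives n/X ≥ 4.
      have hb : err 0 ≤ 0.1875 * (n * c.L * c.CFy ^ 2 / (c.μ ^ 3 * X)) := by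
        refine (hf.shared_error hn hF hβ hβL hrun (by omega) (hwarm 0 (by omega))
          (hQk 0 (by omega))).trans ?_
        have e : n * c.L * c.CFy ^ 2 / (c.μ ^ 3 * X) = n / X * (c.L * c.CFy ^ 2 / c.μ ^ 3) := by
          field_simp
        have h2 : 4 ≤ n / X := by
          rw [le_div_iff₀ hX]
          linarith
        have h3 := mul_le_mul_of_nonneg_right h2
          (by positivity : 0 ≤ c.L * c.CFy ^ 2 / c.μ ^ 3)
        rw [e]
        linarith
      have h2 := QNBO.harmonic_le_log (a := err) (by positivity) hb h1 fun k hk => by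
        have := herr k hk
        rwa [hQk k hk] at this
      have h3 := mul_le_mul_of_nonneg_left h2 (by positivity : 0 ≤ 18 * c.Mfxy ^ 2)
      refine add_le_add le_rfl (h3.trans (le_of_eq ?_))
      field_simp
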